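/- Let $r\ge 1$ and let $f,g:\mathbb R^r\to\mathbb R$, $F:\mathbb R^r\times\mathbb R\to\mathbb R$, $E:\mathbb R^r\times\mathbb R^r\to\mathbb R$, $x_0\in\mathbb R^r$, with $g(x)\neq 0$ for all $x$. Problem B is to minimize $$J(x,u)=\int_{-1}^{1}F(x(t),u(t))\,dt+E(x(-1),x(1))$$ over all pairs $(x,u)$ with $u\in L^\infty[-1,1]$ and $x:[-1,1]\to\mathbb R^r$ absolutely continuous such that, almost everywhere, $$\dot x_1=x_2,\ \dots,\ \dot x_{r-1}=x_r,\ \dot x_r=f(x)+g(x)u,\qquad x(-1)=x_0 .$$ Discretization. Let $L_n$ be the Legendre polynomial of degree $n$. For $N\ge1$ let $-1=t_0<t_1<\dots<t_N=1$ be the Legendre–Gauss–Lobatto nodes ($t_1,\dots,t_{N-1}$ are the roots of $L_N'$), let $w_k=\frac{2}{N(N+1)}\frac1{L_N(t_k)^2}$, and let $D$ be the $(N+1)\times(N+1)$ matrix with $D_{ik}=\frac{L_N(t_i)}{L_N(t_k)}\frac1{t_i-t_k}$ for $i\ne k$, $D_{00}=-\frac{N(N+1)}4$, $D_{NN}=\frac{N(N+1)}4$,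 and all other diagonal entries $0$. Let $m_1\ge 1$ be an integer. Given bounds $\underline b,\bar b\in\mathbb R^{r+1}$, $\underline b_j,\bar b_j\in\mathbb R$ ($1\le j\le m_1-1$) and $d\in\mathbb R$, Problem B$^N$ is to minimize $$\bar J^N(\bar x,\bar u)=\sum_{k=0}^N F(\bar x^{k},\bar u^{k})w_k+E(\bar x^{0},\bar x^{N})$$ over $\bar x^k=(\bar x_1^k,\dots,\bar x_r^k)\in\mathbb R^r$, $\bar u^k\in\mathbb R$ ($0\le k\le N$), subject to the following constraints, where $\bar x_i=(\bar x_i^0,\dots,\bar x_i^N)^T$: 1. $D\bar x_i=\bar x_{i+1}$ for $1\le i<r$, and $(D\bar x_r)_k=f(\bar x^k)+g(\bar x^k)\bar u^k$ for all $k$; 2. $\bar x^0=x_0$; 3. $\underline b\le(\bar x^k,\bar u^k)\le\bar b$ componentwise for all $k$; 4. $\underline b_j\le (D^j\bar x_r)_0\le\bar b_j$ for $1\le j\le m_1-1$; 5. $\sum_{n=0}^{N-r-m_1+1}|a_n|\le d$, where $a_n=(n+\tfrac12)\sum_{k=0}^N L_n(t_k)\,w_k\,(D^{m_1}\bar x_r)_k$.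 The interpolation of $(\bar x,\bar u)$ is the pair $(x^N,u^N)$ in which $x^N_i$ is the polynomial of degree at most $N$ with $x_i^N(t_k)=\bar x_i^k$ for all $k$, and $u^N(t)=\big(\dot x^N_r(t)-f(x^N(t))\big)/g(x^N(t))$. **Theorem.** Let $m\ge3$ and $1\le m_1\le m-1$ be integers. Suppose that $f$, $g$, $F$ and $E(x_0,\cdot)$ are $C^m$ and globally Lipschitz, and that Problem B has an optimal solution $(x^*,u^*)$ such that the $m$-th order weak derivative of $x_r^*$ exists and has bounded variation on $[-1,1]$. Then for all sufficiently large bounds (that is, there is a $B$ such that, whenever $d$ and all the components of $\bar b$ and all $\bar b_j$ are at least $B$, and all the components of $\underline b$ and all $\underline b_j$ are at most $-B$) and for every real $\alpha$ with $0<\alpha<m_1-1$, there are constants $M_1,M_2$ with the following property. Let $N_1\ge1$ and let $(\bar x^{*N},\bar u^{*N})_{N\ge N_1}$ be any sequence of optimal solutions of Problem B$^N$, with interpolations $(x^{*N},u^{*N})$. Then for every $N\ge N_1$ the function $x^{*N}$ is the trajectory of the control system with initial state $x_0$ under the control $u^{*N}$, and if moreover $N>r+m_1+1$, then $$\left|J(x^*,u^*)-J(x^{*N},u^{*N})\right|\le\frac{M_1}{(N-r-m_1-1)^{2m-2m_1-1}}+\frac{M_2}{N^\alpha},$$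 $$\left|J(x^*,u^*)-\bar J^N(\bar x^{*N},\bar u^{*N})\right|\le\frac{M_1}{(N-r-m_1-1)^{2m-2m_1-1}}+\frac{M_2}{N^\alpha}.$$ -/

import Mathlib

open Set MeasureTheory
open scoped ContDiff Matrix

noncomputable section

namespace PSOptimalControl

/-! ### The continuous-time Bolza problem -/

/-- Data of the Bolza problem on `[-1, 1]` for the single-input chain
`ẋ₁ = x₂, …, ẋ_{r-1} = x_r, ẋ_r = f(x) + g(x) u`, `x(-1) = x₀`. Coordinates are indexed from `0`. -/
structure BolzaProblem (r : ℕ) where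
  /-- drift of the last equation -/
  f : (Fin r → ℝ) → ℝ
  /-- control coefficient of the last equation -/
  g : (Fin r → ℝ) → ℝ
  /-- running cost -/
  F : (Fin r → ℝ) × ℝ → ℝ
  /-- endpoint cost, a function of the initial and the final state -/
  E : (Fin r → ℝ) → (Fin r → ℝ) → ℝ
  /-- initial state -/
  x0 : Fin r → ℝ

/-- The index of the last coordinate of the state. -/
def lastIdx (r : ℕ) [NeZero r] : Fin r :=
  ⟨r - 1, Nat.sub_lt (Nat.pos_of_ne_zero (NeZero.ne r)) Nat.one_pos⟩

/-- Right-hand side of the control system. -/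
def BolzaProblem.field {r : ℕ} (P : BolzaProblem r) (x : Fin r → ℝ) (u : ℝ) : Fin r → ℝ :=
  fun i => if h : (i : ℕ) + 1 < r then x ⟨(i : ℕ) + 1, h⟩ else P.f x + P.g x * u

/-- `J(x, u) = ∫_{-1}^{1} F(x(t), u(t)) dt + E(x(-1), x(1))`. -/
def BolzaProblem.cost {r : ℕ} (P : BolzaProblem r) (x : ℝ → Fin r → ℝ) (u : ℝ → ℝ) : ℝ :=
  (∫ t in (-1 : ℝ)..1, P.F (x t, u t)) + P.E (x (-1)) (x 1)

/-- Admissible pairs: a measurable, essentially bounded control together with an absolutely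
continuous trajectory that starts at `x₀` and solves the system almost everywhere. -/
structure BolzaProblem.IsAdmissible {r : ℕ} (P : BolzaProblem r)
    (x : ℝ → Fin r → ℝ) (u : ℝ → ℝ) : Prop where
  control_bdd : MemLp u ⊤ (volume.restrict (Icc (-1 : ℝ) 1))
  traj_ac : AbsolutelyContinuousOnInterval x (-1) 1
  ode : ∀ᵐ t ∂(volume.restrict (Icc (-1 : ℝ) 1)), HasDerivAt x (P.field (x t) (u t)) t
  init : x (-1) = P.x0

/-- `(x, u)` is an optimal solution of the Bolza problem. -/
def BolzaProblem.IsOptimal {r : ℕ} (P : BolzaProblem r)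
    (x : ℝ → Fin r → ℝ) (u : ℝ → ℝ) : Prop :=
  P.IsAdmissible x u ∧ ∀ x' u', P.IsAdmissible x' u' → P.cost x u ≤ P.cost x' u'

/-- `v` is the `k`-th order weak derivative of `ξ` on `(-1, 1)`. -/
def IsWeakDeriv (k : ℕ) (ξ v : ℝ → ℝ) : Prop :=
  IntervalIntegrable ξ volume (-1) 1 ∧ IntervalIntegrable v volume (-1) 1 ∧
  ∀ φ : ℝ → ℝ, ContDiff ℝ ∞ φ → HasCompactSupport φ → tsupport φ ⊆ Ioo (-1 : ℝ) 1 →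
    ∫ t in (-1 : ℝ)..1, ξ t * iteratedDeriv k φ t
      = (-1 : ℝ) ^ k * ∫ t in (-1 : ℝ)..1, v t * φ t

/-- The `k`-th order weak derivative of `ξ` on `[-1, 1]` exists and has (a representative of)
bounded variation. -/
def HasBVWeakDeriv (k : ℕ) (ξ : ℝ → ℝ) : Prop :=
  ∃ v : ℝ → ℝ, IsWeakDeriv k ξ v ∧ BoundedVariationOn v (Icc (-1 : ℝ) 1)

/-! ### Legendre polynomials and the Legendre–Gauss–Lobatto (LGL) rule -/

/-- The Legendre polynomial `L_n = (1 / (2ⁿ n!)) dⁿ/dtⁿ (t² - 1)ⁿ`. -/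
def legendre (n : ℕ) : Polynomial ℝ :=
  Polynomial.C (1 / ((2 : ℝ) ^ n * (n.factorial : ℝ))) *
    Polynomial.derivative^[n] ((Polynomial.X ^ 2 - 1) ^ n)

/-- The value `L_n(t)`. -/
def legendreEval (n : ℕ) (t : ℝ) : ℝ := (legendre n).eval t

/-- The set of LGL nodes for `N ≥ 1`: the endpoints `-1`, `1` and the roots of `L_N'`. -/
def lglNodeSet (N : ℕ) : Finset ℝ :=
  {-1, 1} ∪ (Polynomial.derivative (legendre N)).roots.toFinset

/-- The LGL nodes `t₀ < t₁ < ⋯ < t_N` in increasing order. -/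
def lglNode (N : ℕ) (k : Fin (N + 1)) : ℝ :=
  ((lglNodeSet N).sort (· ≤ ·)).getD (k : ℕ) 0

/-- The LGL weights `w_k = (2 / (N (N + 1))) (1 / L_N(t_k)²)`. -/
def lglWeight (N : ℕ) (k : Fin (N + 1)) : ℝ :=
  2 / ((N : ℝ) * ((N : ℝ) + 1)) * (1 / legendreEval N (lglNode N k) ^ 2)

/-- The LGL differentiation matrix `D`. -/
def diffMatrix (N : ℕ) : Matrix (Fin (N + 1)) (Fin (N + 1)) ℝ :=
  Matrix.of fun i k =>
    if i ≠ k then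
      legendreEval N (lglNode N i) / legendreEval N (lglNode N k) *
        (1 / (lglNode N i - lglNode N k))
    else if i = 0 then -((N : ℝ) * ((N : ℝ) + 1) / 4)
    else if i = Fin.last N then (N : ℝ) * ((N : ℝ) + 1) / 4
    else 0

/-! ### The discretized problem

A discrete state is `X : Fin (N + 1) → Fin r → ℝ`, `X k i` being the value of the `i`-th coordinate
at the node `t_k`; a discrete control is `U : Fin (N + 1) → ℝ`. -/

/-- The vector `D^j (x̄_r)ᵀ` of nodal values of the `j`-th derivative of the last coordinate. -/
def nodalDeriv {r N : ℕ} [NeZero r] (j : ℕ) (X : Fin (N + 1) → Fin r → ℝ) : Fin (N + 1) → ℝ :=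
  (diffMatrix N ^ j) *ᵥ (fun k => X k (lastIdx r))

/-- The Legendre spectral coefficient `a_n(m₁) = (n + 1/2) ∑_k L_n(t_k) w_k (D^{m₁} (x̄_r)ᵀ)_k`. -/
def spectralCoeff {r N : ℕ} [NeZero r] (m1 : ℕ) (X : Fin (N + 1) → Fin r → ℝ) (n : ℕ) : ℝ :=
  ((n : ℝ) + 1 / 2) *
    ∑ k : Fin (N + 1), legendreEval n (lglNode N k) * (lglWeight N k * nodalDeriv m1 X k)

/-- The bounds that define the search region of the discretized problem. -/
structure Bounds (r : ℕ) where
  /-- lower bound of the discrete state -/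
  xLo : Fin r → ℝ
  /-- upper bound of the discrete state -/
  xHi : Fin r → ℝ
  /-- lower bound of the discrete control -/
  uLo : ℝ
  /-- upper bound of the discrete control -/
  uHi : ℝ
  /-- lower bound of the `j`-th initial derivative -/
  dLo : ℕ → ℝ
  /-- upper bound of the `j`-th initial derivative -/
  dHi : ℕ → ℝ
  /-- bound of the sum of the spectral coefficients -/
  d : ℝ

/-- All the bounds used by the discretization of order `m₁` are at least `B` in size: every lower
bound is at most `-B`, every upper bound at least `B`. -/
structure Bounds.AtLeast {r : ℕ} (b : Bounds r) (m1 : ℕ) (B : ℝ) : Prop where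
  xLo_le : ∀ i, b.xLo i ≤ -B
  le_xHi : ∀ i, B ≤ b.xHi i
  uLo_le : b.uLo ≤ -B
  le_uHi : B ≤ b.uHi
  dLo_le : ∀ j, 1 ≤ j → j + 1 ≤ m1 → b.dLo j ≤ -B
  le_dHi : ∀ j, 1 ≤ j → j + 1 ≤ m1 → B ≤ b.dHi j
  le_d : B ≤ b.d

/-- The discrete cost `∑_k F(x̄^k, ū^k) w_k + E(x̄^0, x̄^N)`. -/
def BolzaProblem.discreteCost {r : ℕ} (P : BolzaProblem r) {N : ℕ}
    (X : Fin (N + 1) → Fin r → ℝ) (U : Fin (N + 1) → ℝ) : ℝ :=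
  (∑ k : Fin (N + 1), P.F (X k, U k) * lglWeight N k) + P.E (X 0) (X (Fin.last N))

/-- Feasibility for the discretized problem. The spectral coefficients are summed over
`0 ≤ n ≤ N - r - m₁ + 1`. -/
structure BolzaProblem.IsDiscreteFeasible {r : ℕ} [NeZero r] (P : BolzaProblem r)
    (m1 : ℕ) (b : Bounds r) {N : ℕ}
    (X : Fin (N + 1) → Fin r → ℝ) (U : Fin (N + 1) → ℝ) : Prop where
  dynamics : ∀ i k, (diffMatrix N *ᵥ fun l => X l i) k = P.field (X k) (U k) i
  init : X 0 = P.x0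
  state_box : ∀ k i, b.xLo i ≤ X k i ∧ X k i ≤ b.xHi i
  control_box : ∀ k, b.uLo ≤ U k ∧ U k ≤ b.uHi
  deriv_box : ∀ j, 1 ≤ j → j + 1 ≤ m1 → b.dLo j ≤ nodalDeriv j X 0 ∧ nodalDeriv j X 0 ≤ b.dHi j
  spectral : ∑ n ∈ Finset.range (N + 2 - (r + m1)), |spectralCoeff m1 X n| ≤ b.d

/-- Optimality for the discretized problem. -/
def BolzaProblem.IsDiscreteOptimal {r : ℕ} [NeZero r] (P : BolzaProblem r)
    (m1 : ℕ) (b : Bounds r) {N : ℕ}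
    (X : Fin (N + 1) → Fin r → ℝ) (U : Fin (N + 1) → ℝ) : Prop :=
  P.IsDiscreteFeasible m1 b X U ∧
    ∀ (X' : Fin (N + 1) → Fin r → ℝ) (U' : Fin (N + 1) → ℝ),
      P.IsDiscreteFeasible m1 b X' U' → P.discreteCost X U ≤ P.discreteCost X' U'

/-- The Lagrange interpolation polynomial of the `i`-th coordinate at the LGL nodes. -/
def interpPoly {r N : ℕ} (X : Fin (N + 1) → Fin r → ℝ) (i : Fin r) : Polynomial ℝ :=
  Lagrange.interpolate Finset.univ (lglNode N) (fun k => X k i)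

/-- The interpolated trajectory `x^N(t)`. -/
def interpState {r N : ℕ} (X : Fin (N + 1) → Fin r → ℝ) (t : ℝ) : Fin r → ℝ :=
  fun i => (interpPoly X i).eval t

/-- The interpolated control `u^N(t) = (ẋ_r^N(t) - f(x^N(t))) / g(x^N(t))`. -/
def BolzaProblem.interpControl {r N : ℕ} [NeZero r] (P : BolzaProblem r)
    (X : Fin (N + 1) → Fin r → ℝ) (t : ℝ) : ℝ :=
  ((Polynomial.derivative (interpPoly X (lastIdx r))).eval t - P.f (interpState X t)) /
    P.g (interpState X t)

end PSOptimalControl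

end

/-!
The system is flat: a trajectory is determined by its first coordinate `y` (the flat output), since
the state at `t` is `(y, y', …, y^(r-1))(t)` and the control is `(y^(r) - f(x)) / g(x)`. The problem
thus becomes the minimization of the integral of a smooth Lagrangian of `(y, …, y^(r))` plus an
endpoint cost, over outputs with prescribed initial data. The optimal state has a flat output `ys`
whose derivative of order `r - 1 + (m - 1)` is absolutely continuous with a derivative of bounded
variation (`BolzaProblem.IsAdmissible.exists_flatOutput`). In the discretized problem the
equations `ẋ_i = x_{i+1}` relate polynomials of degree at most `N`, so they hold identically as soon
as they hold at the `N + 1` nodes; the feasible points are nodal values of trajectories with a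
polynomial flat output, and the spectral coefficients are the
Legendre coefficients of a derivative of that output (`interpState_eq_flatState`,
`spectralCoeff_eq`).

Two estimates give the theorem.

* A good competitor. The polynomial `L_{n+2} - L_n`, a primitive of `(2 n + 3) L_{n+1}` that vanishes
  at the endpoints, is `O(n^(-1/2))` on `[-1, 1]`, because the energy of Legendre's equation is
  monotone on either side of `0` (`abs_legendre_add_two_sub_le`). By repeated integration by parts,
  the Legendre coefficients of the derivative of order `r - 1 + m₁` of `ys` are `O(n^(-q - 3/2))`
  with `q = m - 1 - m₁` (`exists_abs_legendreCoeff_le`). Truncating this series and integrating back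
  gives a polynomial output at distance `ε = O(N^(-q - 1/2))` from `ys`, and it is feasible when the
  bounds are large (`BolzaProblem.exists_isDiscreteFeasible`). Its cost exceeds the minimum only by
  `O(ε²)`: by minimality at the reflected output `2 ys - Y`, the excess at `Y` is at most the second
  difference of the cost (`BolzaProblem.exists_flatCost_le`). This is the first error term, with
  exponent `2 q + 1 = 2 m - 2 m₁ - 1`.

* The quadrature error. On the feasible set, the constraints on the initial derivatives and on the
  spectral coefficients bound all derivatives of the flat output up to order `r - 1 + m₁`, uniformly
  in `N`, hence also the derivative of order `m₁ - 1` of the integrand. Exactness of the rule for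
  degree at most `2 N - 1`, positivity of the weights and a theorem of Jackson type bound the
  quadrature error by `O(N^(-(m₁ - 1)))` (`exists_lgl_quadrature_error`,
  `BolzaProblem.exists_abs_discreteCost_sub_le`). This is the second error term.

Comparing the discrete optimum with the competitor, and the optimal cost with the cost of the
interpolated trajectory, closes the argument.
-/


namespace PSOptimalControl

open Polynomial

/-! ### Algebraic identities of Legendre polynomials -/

theorem legendre_zero : legendre 0 = 1 := by simp [legendre]

theorem derivative_legendre_succ (n : ℕ) :
    derivative (legendre (n + 1)) =
      X * derivative (legendre n) + ((n : ℝ[X]) + 1) * legendre n := by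
  have h1 : derivative ((X ^ 2 - 1 : ℝ[X]) ^ (n + 1))
      = C (2 * ((n : ℝ) + 1)) * (X * (X ^ 2 - 1) ^ n) := by
    simp [derivative_pow]; ring
  have h2 : derivative^[n + 1] (X * (X ^ 2 - 1 : ℝ[X]) ^ n)
      = X * derivative^[n + 1] ((X ^ 2 - 1 : ℝ[X]) ^ n)
        + ((n : ℝ[X]) + 1) * derivative^[n] ((X ^ 2 - 1 : ℝ[X]) ^ n) := by
    rw [mul_comm X, iterate_derivative_mul_X]; simp; ring
  have h3 : (1 / (2 ^ (n + 1) * ((n + 1).factorial : ℝ))) * (2 * ((n : ℝ) + 1))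
      = 1 / (2 ^ n * (n.factorial : ℝ)) := by
    have := Nat.cast_pos (α := ℝ).2 n.factorial_pos
    rw [Nat.factorial_succ]; push_cast; field_simp; ring
  simp only [legendre, derivative_C_mul]
  rw [← Function.iterate_succ_apply' (f := derivative), Function.iterate_succ_apply, h1,
    iterate_derivative_C_mul, h2, ← mul_assoc, ← C_mul, h3,
    ← Function.iterate_succ_apply' (f := derivative)]
  ring

theorem derivative_legendre_add_two (n : ℕ) :
    derivative (legendre (n + 2)) =
      (2 * (n : ℝ[X]) + 3) * legendre (n + 1) + derivative (legendre n) := by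
  have h1 : derivative (derivative ((X ^ 2 - 1 : ℝ[X]) ^ (n + 2)))
      = C (2 * ((n : ℝ) + 2)) * (C (2 * (n : ℝ) + 3) * (X ^ 2 - 1) ^ (n + 1)
        + C (2 * ((n : ℝ) + 1)) * (X ^ 2 - 1) ^ n) := by
    have e2 : (C 2 : ℝ[X]) = 2 := rfl
    have e3 : (C 3 : ℝ[X]) = 3 := rfl
    simp [derivative_pow, e2, e3]; ring
  have h3 : (1 / (2 ^ (n + 2) * ((n + 2).factorial : ℝ))) * (2 * ((n : ℝ) + 2))
      = 1 / (2 ^ (n + 1) * ((n + 1).factorial : ℝ)) := by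
    have := Nat.cast_pos (α := ℝ).2 (n + 1).factorial_pos
    rw [Nat.factorial_succ (n + 1)]; push_cast; field_simp; ring
  have h4 : (1 / (2 ^ (n + 1) * ((n + 1).factorial : ℝ))) * (2 * ((n : ℝ) + 1))
      = 1 / (2 ^ n * (n.factorial : ℝ)) := by
    have := Nat.cast_pos (α := ℝ).2 n.factorial_pos
    rw [Nat.factorial_succ]; push_cast; field_simp; ring
  simp only [legendre, derivative_C_mul]
  rw [← Function.iterate_succ_apply' (f := derivative), Function.iterate_succ_apply,
    Function.iterate_succ_apply, h1, iterate_derivative_C_mul, ← mul_assoc, ← C_mul, h3,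
    iterate_map_add, iterate_derivative_C_mul, iterate_derivative_C_mul, mul_add, ← mul_assoc,
    ← mul_assoc, ← C_mul, ← C_mul, h4,
    ← Function.iterate_succ_apply' (f := derivative)]
  simp only [C_mul, C_add, C_ofNat, map_natCast]
  ring

theorem derivative_legendre_pred (n : ℕ) :
    derivative (legendre n) =
      X * derivative (legendre (n + 1)) - ((n : ℝ[X]) + 1) * legendre (n + 1) := by
  have h1 := derivative_legendre_add_two n
  have h2 := derivative_legendre_succ (n + 1)
  push_cast at h2
  linear_combination h2 - h1

theorem sq_sub_one_mul_derivative_legendre (n : ℕ) :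
    (X ^ 2 - 1) * derivative (legendre (n + 1)) =
      ((n : ℝ[X]) + 1) * (X * legendre (n + 1) - legendre n) := by
  linear_combination -X * derivative_legendre_pred n - derivative_legendre_succ n

/-- Legendre's differential equation. -/
theorem derivative_sq_sub_one_mul_derivative_legendre (n : ℕ) :
    derivative ((X ^ 2 - 1) * derivative (legendre n)) =
      ((n : ℝ[X]) * ((n : ℝ[X]) + 1)) * legendre n := by
  rcases n with _ | n
  · simp [legendre_zero]
  · rw [sq_sub_one_mul_derivative_legendre]
    have := derivative_legendre_pred n
    have h : derivative ((n : ℝ[X]) + 1) = 0 := by simp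
    rw [derivative_mul, h]
    simp only [derivative_sub, derivative_mul, derivative_X]
    push_cast
    linear_combination (-(n : ℝ[X]) - 1) * this

theorem legendre_eval_one (n : ℕ) : (legendre n).eval 1 = 1 := by
  induction n with
  | zero => simp [legendre_zero]
  | succ n ih =>
    have := congrArg (eval 1) (sq_sub_one_mul_derivative_legendre n)
    simp [ih] at this
    have h : (n : ℝ) + 1 ≠ 0 := by positivity
    rcases this with h' | h'
    · exact absurd h' h
    · linarith

theorem legendre_eval_neg_one (n : ℕ) : (legendre n).eval (-1) = (-1) ^ n := by
  induction n with
  | zero => simp [legendre_zero]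
  | succ n ih =>
    have := congrArg (eval (-1)) (sq_sub_one_mul_derivative_legendre n)
    simp [ih] at this
    have h : (n : ℝ) + 1 ≠ 0 := by positivity
    rcases this with h' | h'
    · exact absurd h' h
    · rw [pow_succ]; linarith

theorem legendre_add_two_sub (n : ℕ) :
    ((n : ℝ[X]) + 1) * ((n : ℝ[X]) + 2) * (legendre (n + 2) - legendre n) =
      (2 * (n : ℝ[X]) + 3) * ((X ^ 2 - 1) * derivative (legendre (n + 1))) := by
  have h1 := sq_sub_one_mul_derivative_legendre n
  have h2 := sq_sub_one_mul_derivative_legendre (n + 1)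
  have h3 := derivative_legendre_pred (n + 1)
  push_cast at h2 h3
  have h4 : (X ^ 2 - 1) * derivative (legendre (n + 1)) =
      ((n : ℝ[X]) + 2) * (legendre (n + 2) - X * legendre (n + 1)) := by
    linear_combination (X ^ 2 - 1) * h3 + X * h2
  linear_combination -((n : ℝ[X]) + 1) * h4 - ((n : ℝ[X]) + 2) * h1

theorem natDegree_legendre_le (n : ℕ) : (legendre n).natDegree ≤ n := by
  refine (natDegree_C_mul_le _ _).trans ((natDegree_iterate_derivative _ _).trans ?_)
  have : ((X ^ 2 - 1 : ℝ[X]) ^ n).natDegree ≤ n * 2 := by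
    refine natDegree_pow_le.trans ?_
    gcongr
    compute_degree
  omega

theorem coeff_legendre_pos (n : ℕ) : 0 < (legendre n).coeff n := by
  induction n with
  | zero => simp [legendre_zero]
  | succ n ih =>
    have h := congrArg (fun p => coeff p n) (derivative_legendre_succ n)
    have h' : (X * derivative (legendre n)).coeff n = n * (legendre n).coeff n := by
      rcases n with _ | n
      · simp
      · rw [coeff_X_mul, coeff_derivative]; push_cast; ring
    have h'' : (((n : ℝ[X]) + 1) * legendre n).coeff n = ((n : ℝ) + 1) * (legendre n).coeff n := by
      rw [show (n : ℝ[X]) + 1 = C ((n : ℝ) + 1) by simp, coeff_C_mul]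
    simp only [coeff_add, h', h'', coeff_derivative] at h
    have h3 : 0 < (legendre (n + 1)).coeff (n + 1) * ((n : ℝ) + 1) := by
      rw [h]; positivity
    exact pos_of_mul_pos_left h3 (by positivity)

theorem natDegree_legendre (n : ℕ) : (legendre n).natDegree = n :=
  natDegree_eq_of_le_of_coeff_ne_zero (natDegree_legendre_le n) (coeff_legendre_pos n).ne'

/-! ### Integration of polynomials over `[-1, 1]`; orthogonality -/

theorem integral_derivative_eval (p : ℝ[X]) (a b : ℝ) :
    ∫ t in a..b, (derivative p).eval t = p.eval b - p.eval a :=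
  intervalIntegral.integral_eq_sub_of_hasDerivAt (fun t _ => p.hasDerivAt t)
    ((derivative p).continuous.intervalIntegrable _ _)

theorem exists_derivative_eq (p : ℝ[X]) (c : ℝ) :
    ∃ q : ℝ[X], derivative q = p ∧ q.eval (-1) = c ∧ q.natDegree ≤ p.natDegree + 1 := by
  set q0 : ℝ[X] := ∑ i ∈ Finset.range (p.natDegree + 1), C (p.coeff i / (i + 1)) * X ^ (i + 1)
  have h0 : q0.natDegree ≤ p.natDegree + 1 := by
    refine natDegree_sum_le_of_forall_le _ _ fun i hi => ?_
    refine (natDegree_C_mul_X_pow_le _ _).trans ?_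
    have := Finset.mem_range.1 hi
    omega
  refine ⟨q0 + C (c - q0.eval (-1)), ?_, by simp, ?_⟩
  · conv_rhs => rw [p.as_sum_range_C_mul_X_pow]
    simp only [q0, derivative_add, derivative_C, add_zero, derivative_sum, derivative_C_mul_X_pow]
    refine Finset.sum_congr rfl fun i _ => ?_
    have : (i : ℝ) + 1 ≠ 0 := by positivity
    rw [Nat.cast_add_one, div_mul_cancel₀ _ this, Nat.add_sub_cancel]
  · refine (natDegree_add_le _ _).trans (max_le h0 ?_)
    simp

theorem eq_zero_of_integral_eq_zero {p : ℝ[X]} (hp : ∀ t ∈ Icc (-1 : ℝ) 1, 0 ≤ p.eval t)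
    (h : ∫ t in (-1 : ℝ)..1, p.eval t = 0) : p = 0 := by
  refine eq_zero_of_infinite_isRoot p ((Icc_infinite (show (-1 : ℝ) < 1 by norm_num)).mono ?_)
  intro t ht
  by_contra hne
  have : 0 < ∫ t in (-1 : ℝ)..1, p.eval t :=
    intervalIntegral.integral_pos (by norm_num) p.continuous.continuousOn
      (fun x hx => hp x (Ioc_subset_Icc_self hx)) ⟨t, ht, lt_of_le_of_ne (hp t ht) (Ne.symm hne)⟩
  exact this.ne' h

theorem integral_legendre_mul_legendre_of_ne {n k : ℕ} (h : n ≠ k) :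
    ∫ t in (-1 : ℝ)..1, (legendre n * legendre k).eval t = 0 := by
  have hd : derivative ((X ^ 2 - 1) * (derivative (legendre n) * legendre k
      - legendre n * derivative (legendre k)))
      = C ((n : ℝ) * (n + 1) - k * (k + 1)) * (legendre n * legendre k) := by
    have h1 := derivative_sq_sub_one_mul_derivative_legendre n
    have h2 := derivative_sq_sub_one_mul_derivative_legendre k
    simp only [derivative_mul, derivative_sub] at h1 h2 ⊢
    simp only [C_sub, C_mul, C_add, map_natCast, C_1]
    linear_combination legendre k * h1 - legendre n * h2
  have h3 := integral_derivative_eval ((X ^ 2 - 1) * (derivative (legendre n) * legendre k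
      - legendre n * derivative (legendre k))) (-1) 1
  rw [hd] at h3
  simp only [eval_mul, eval_C, intervalIntegral.integral_const_mul] at h3
  simp at h3
  rcases h3 with h3 | h3
  · exfalso
    have h4 : ((n : ℝ) - k) * (n + k + 1) = 0 := by linear_combination h3
    rcases mul_eq_zero.1 h4 with h5 | h5
    · exact h (by exact_mod_cast sub_eq_zero.1 h5)
    · have : (0 : ℝ) < n + k + 1 := by positivity
      exact this.ne' h5
  · simpa using h3

/-- Every polynomial of degree at most `n` is a combination of `L_0, …, L_n`. -/
theorem exists_eq_sum_legendre (n : ℕ) (p : ℝ[X]) (hp : p.natDegree ≤ n) :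
    ∃ c : ℕ → ℝ, p = ∑ k ∈ Finset.range (n + 1), C (c k) * legendre k := by
  induction n generalizing p with
  | zero =>
    refine ⟨fun _ => p.coeff 0, ?_⟩
    rw [eq_C_of_natDegree_le_zero hp]
    simp [legendre_zero]
  | succ n ih =>
    set a := p.coeff (n + 1) / (legendre (n + 1)).coeff (n + 1) with ha
    have hq : (p - C a * legendre (n + 1)).natDegree ≤ n := by
      have h1 : (p - C a * legendre (n + 1)).natDegree ≤ n + 1 :=
        (natDegree_sub_le _ _).trans
          (max_le hp ((natDegree_C_mul_le _ _).trans (natDegree_legendre_le _)))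
      refine Nat.le_of_lt_succ (lt_of_le_of_ne h1 fun h2 => ?_)
      have h3 : (p - C a * legendre (n + 1)).coeff (n + 1) = 0 := by
        rw [coeff_sub, coeff_C_mul, ha, div_mul_cancel₀ _ (coeff_legendre_pos _).ne', sub_self]
      have h4 : p - C a * legendre (n + 1) = 0 := by
        rw [← leadingCoeff_eq_zero, leadingCoeff, h2, h3]
      rw [h4] at h2
      simp at h2
    obtain ⟨c, hc⟩ := ih _ hq
    refine ⟨Function.update c (n + 1) a, ?_⟩
    rw [Finset.sum_range_succ, Finset.sum_congr rfl (g := fun k => C (c k) * legendre k)]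
    · rw [← hc]; simp
    · intro k hk
      rw [Function.update_of_ne]
      have := Finset.mem_range.1 hk
      omega

theorem intervalIntegrable_eval (p : ℝ[X]) (a b : ℝ) :
    IntervalIntegrable (fun t => p.eval t) volume a b := p.continuous.intervalIntegrable _ _

theorem integral_legendre_mul_eq_zero {n : ℕ} {p : ℝ[X]} (hp : p.natDegree < n) :
    ∫ t in (-1 : ℝ)..1, (legendre n * p).eval t = 0 := by
  obtain ⟨c, hc⟩ := exists_eq_sum_legendre (n - 1) p (by omega)
  have h : ∀ t, (legendre n * p).eval t
      = ∑ k ∈ Finset.range (n - 1 + 1), c k * (legendre n * legendre k).eval t := by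
    intro t
    conv_lhs => rw [hc]
    simp only [eval_mul, eval_finsetSum, eval_C, Finset.mul_sum]
    exact Finset.sum_congr rfl fun _ _ => by ring
  simp only [h]
  rw [intervalIntegral.integral_finsetSum
    fun k _ => (intervalIntegrable_eval _ _ _).const_mul _]
  refine Finset.sum_eq_zero fun k hk => ?_
  rw [intervalIntegral.integral_const_mul, integral_legendre_mul_legendre_of_ne, mul_zero]
  have := Finset.mem_range.1 hk
  omega

theorem integral_legendre_sq (n : ℕ) :
    ∫ t in (-1 : ℝ)..1, (legendre n * legendre n).eval t = 2 / (2 * n + 1) := by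
  rcases n with _ | n
  · simp [legendre_zero]; norm_num
  · have hd : derivative (X * (legendre (n + 1) * legendre (n + 1)))
        = C (2 * ((n + 1 : ℕ) : ℝ) + 1) * (legendre (n + 1) * legendre (n + 1))
          + C 2 * (legendre (n + 1) * derivative (legendre n)) := by
      have := derivative_legendre_pred n
      have e2 : (C 2 : ℝ[X]) = 2 := rfl
      simp only [derivative_mul, derivative_X, C_add, C_mul, map_natCast, e2, C_1]
      push_cast
      linear_combination -2 * legendre (n + 1) * this
    have h := integral_derivative_eval (X * (legendre (n + 1) * legendre (n + 1))) (-1) 1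
    have h0 : ∫ t in (-1 : ℝ)..1, (legendre (n + 1) * derivative (legendre n)).eval t = 0 := by
      refine integral_legendre_mul_eq_zero ((natDegree_derivative_le _).trans_lt ?_)
      rw [natDegree_legendre]; omega
    rw [hd] at h
    simp only [eval_add, eval_C_mul] at h
    rw [intervalIntegral.integral_add ((intervalIntegrable_eval _ _ _).const_mul _)
      ((intervalIntegrable_eval _ _ _).const_mul _), intervalIntegral.integral_const_mul,
      intervalIntegral.integral_const_mul, h0] at h
    simp only [eval_mul, eval_X, legendre_eval_one, legendre_eval_neg_one, ← pow_add] at h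
    rw [Even.neg_one_pow ⟨n + 1, rfl⟩] at h
    have : (0 : ℝ) < 2 * ((n + 1 : ℕ) : ℝ) + 1 := by positivity
    rw [eq_div_iff this.ne']
    simp only [eval_mul]
    linarith

/-! ### Pointwise bounds of Legendre polynomials -/

/-- A polynomial whose derivative is `x s(x)` with `s ≥ 0` decreases on `[-1, 0]` and increases on
`[0, 1]`. -/
theorem eval_bounds_of_derivative_eq_X_mul {p s : ℝ[X]} (h : derivative p = X * s)
    (hs : ∀ t, 0 ≤ s.eval t) {t : ℝ} (ht : t ∈ Icc (-1 : ℝ) 1) :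
    p.eval 0 ≤ p.eval t ∧ p.eval t ≤ max (p.eval (-1)) (p.eval 1) := by
  have hm : MonotoneOn (fun t => p.eval t) (Ici (0 : ℝ)) := by
    refine monotoneOn_of_deriv_nonneg (convex_Ici 0) p.continuous.continuousOn
      p.differentiable.differentiableOn fun x hx => ?_
    rw [p.deriv, h, eval_mul, eval_X]
    rw [interior_Ici] at hx
    exact mul_nonneg (le_of_lt hx) (hs x)
  have ha : AntitoneOn (fun t => p.eval t) (Iic (0 : ℝ)) := by
    refine antitoneOn_of_deriv_nonpos (convex_Iic 0) p.continuous.continuousOn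
      p.differentiable.differentiableOn fun x hx => ?_
    rw [p.deriv, h, eval_mul, eval_X]
    rw [interior_Iic] at hx
    exact mul_nonpos_of_nonpos_of_nonneg (le_of_lt hx) (hs x)
  rcases le_total 0 t with h0 | h0
  · exact ⟨hm (mem_Ici.2 le_rfl) h0 h0, le_max_of_le_right (hm h0 (mem_Ici.2 zero_le_one) ht.2)⟩
  · exact ⟨ha h0 (mem_Iic.2 le_rfl) h0,
      le_max_of_le_left (ha (mem_Iic.2 (by norm_num)) h0 ht.1)⟩

/-- The energy `n (n + 1) L_n² + (1 - x²) L_n'²` of Legendre's equation. -/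
noncomputable def legendreEnergy (n : ℕ) : ℝ[X] :=
  ((n : ℝ[X]) * ((n : ℝ[X]) + 1)) * legendre n ^ 2 + (1 - X ^ 2) * derivative (legendre n) ^ 2

theorem derivative_legendreEnergy (n : ℕ) :
    derivative (legendreEnergy n) = X * (2 * derivative (legendre n) ^ 2) := by
  have h := derivative_sq_sub_one_mul_derivative_legendre n
  simp [legendreEnergy, derivative_pow] at h ⊢
  have e2 : (C 2 : ℝ[X]) = 2 := rfl
  simp only [e2] at h ⊢
  linear_combination -2 * derivative (legendre n) * h

theorem derivative_sub_sq_mul_legendreEnergy (n : ℕ) :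
    derivative (-((1 - X ^ 2) * legendreEnergy n)) =
      X * ((2 * ((n : ℝ[X]) * ((n : ℝ[X]) + 1))) * legendre n ^ 2) := by
  rw [derivative_neg, derivative_mul, derivative_legendreEnergy]
  have e2 : (C 2 : ℝ[X]) = 2 := rfl
  simp [legendreEnergy, derivative_pow, e2]
  ring

theorem legendreEnergy_eval (n : ℕ) (t : ℝ) : (legendreEnergy n).eval t =
    n * (n + 1) * (legendre n).eval t ^ 2 + (1 - t ^ 2) * (derivative (legendre n)).eval t ^ 2 := by
  simp [legendreEnergy]

/-- The energy increases with `|t|` and equals `n (n + 1)` at the endpoints. -/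
theorem abs_legendre_eval_le_one (n : ℕ) {t : ℝ} (ht : t ∈ Icc (-1 : ℝ) 1) :
    |(legendre n).eval t| ≤ 1 := by
  rcases Nat.eq_zero_or_pos n with rfl | hn
  · simp [legendre_zero]
  have h := (eval_bounds_of_derivative_eq_X_mul (derivative_legendreEnergy n)
    (fun t => by simp; positivity) ht).2
  have hl : (0 : ℝ) < n * (n + 1) := by positivity
  have h1 : (legendreEnergy n).eval (-1) = n * (n + 1) := by
    rw [legendreEnergy_eval, legendre_eval_neg_one, ← pow_mul, mul_comm n 2, pow_mul]; simp
  have h2 : (legendreEnergy n).eval 1 = n * (n + 1) := by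
    rw [legendreEnergy_eval, legendre_eval_one]; simp
  rw [h1, h2, max_self, legendreEnergy_eval] at h
  have h3 : 0 ≤ (1 - t ^ 2) * (derivative (legendre n)).eval t ^ 2 := by
    have : 0 ≤ 1 - t ^ 2 := by nlinarith [ht.1, ht.2]
    positivity
  rw [← sq_le_one_iff_abs_le_one]
  refine le_of_mul_le_mul_left ?_ hl
  linarith

theorem integral_one_sub_sq_mul_derivative_legendre_sq (n : ℕ) :
    ∫ t in (-1 : ℝ)..1, ((1 - X ^ 2) * derivative (legendre n) ^ 2 : ℝ[X]).eval t
      = n * (n + 1) * (2 / (2 * n + 1)) := by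
  have hd : derivative ((X ^ 2 - 1) * derivative (legendre n) * legendre n)
      = C ((n : ℝ) * (n + 1)) * (legendre n * legendre n)
        - (1 - X ^ 2) * derivative (legendre n) ^ 2 := by
    rw [derivative_mul, derivative_sq_sub_one_mul_derivative_legendre]
    simp only [C_mul, C_add, map_natCast, C_1]
    ring
  have h := integral_derivative_eval ((X ^ 2 - 1) * derivative (legendre n) * legendre n) (-1) 1
  rw [hd] at h
  simp only [eval_sub (p := C _ * _), eval_C_mul] at h
  rw [intervalIntegral.integral_sub ((intervalIntegrable_eval _ _ _).const_mul _)
    (intervalIntegrable_eval _ _ _), intervalIntegral.integral_const_mul,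
    integral_legendre_sq] at h
  have h1 : ((X ^ 2 - 1) * derivative (legendre n) * legendre n).eval 1 = 0 := by simp
  have h2 : ((X ^ 2 - 1) * derivative (legendre n) * legendre n).eval (-1) = 0 := by simp
  rw [h1, h2] at h
  linarith

/-- The energy `E` has its minimum on `[-1, 1]` at `0`, so `E(0)` is at most the mean of `E`, and
`(1 - x²) E` has its maximum there. -/
theorem sq_sub_one_mul_derivative_legendre_sq_le (n : ℕ) {t : ℝ} (ht : t ∈ Icc (-1 : ℝ) 1) :
    ((t ^ 2 - 1) * (derivative (legendre n)).eval t) ^ 2 ≤ n * (n + 1) * (2 / (2 * n + 1)) := by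
  have h1 : ∀ s ∈ Icc (-1 : ℝ) 1, (legendreEnergy n).eval 0 ≤ (legendreEnergy n).eval s :=
    fun s hs => (eval_bounds_of_derivative_eq_X_mul (derivative_legendreEnergy n)
      (fun t => by simp; positivity) hs).1
  have h2 : (1 - t ^ 2) * (legendreEnergy n).eval t ≤ (legendreEnergy n).eval 0 := by
    have := (eval_bounds_of_derivative_eq_X_mul (derivative_sub_sq_mul_legendreEnergy n)
      (fun t => by simp; positivity) ht).1
    simp at this
    linarith
  have h3 : ∫ s in (-1 : ℝ)..1, (legendreEnergy n).eval s
      = 2 * (n * (n + 1) * (2 / (2 * n + 1))) := by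
    have : ∀ s, (legendreEnergy n).eval s = (n * (n + 1)) * (legendre n * legendre n).eval s
        + ((1 - X ^ 2) * derivative (legendre n) ^ 2 : ℝ[X]).eval s := by
      intro s; simp [legendreEnergy, pow_two, mul_assoc]
    simp only [this]
    rw [intervalIntegral.integral_add ((intervalIntegrable_eval _ _ _).const_mul _)
      (intervalIntegrable_eval _ _ _), intervalIntegral.integral_const_mul,
      integral_legendre_sq, integral_one_sub_sq_mul_derivative_legendre_sq]
    ring
  have h4 : ∫ _ in (-1 : ℝ)..1, (legendreEnergy n).eval 0
      ≤ ∫ s in (-1 : ℝ)..1, (legendreEnergy n).eval s :=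
    intervalIntegral.integral_mono_on (by norm_num) (by simp) (intervalIntegrable_eval _ _ _) h1
  rw [h3] at h4
  simp at h4
  have h5 : 0 ≤ 1 - t ^ 2 := by nlinarith [ht.1, ht.2]
  have h6 : ((t ^ 2 - 1) * (derivative (legendre n)).eval t) ^ 2
      ≤ (1 - t ^ 2) * (legendreEnergy n).eval t := by
    rw [legendreEnergy_eval]
    have : 0 ≤ (1 - t ^ 2) * (n * (n + 1) * (legendre n).eval t ^ 2) := by positivity
    linarith
  linarith

/-- The difference is `(2 n + 3) (t² - 1) L_{n+1}' / ((n + 1) (n + 2))`. -/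
theorem abs_legendre_add_two_sub_le (n : ℕ) {t : ℝ} (ht : t ∈ Icc (-1 : ℝ) 1) :
    |(legendre (n + 2)).eval t - (legendre n).eval t| ≤ 2 / √(n + 1) := by
  have h1 := congrArg (eval t) (legendre_add_two_sub n)
  have h2 := sq_sub_one_mul_derivative_legendre_sq_le (n + 1) ht
  simp at h1
  set d := (legendre (n + 2)).eval t - (legendre n).eval t
  set e := (t ^ 2 - 1) * (derivative (legendre (n + 1))).eval t
  push_cast at h2
  have hn : (0 : ℝ) ≤ n := by positivity
  have h3 : e ^ 2 * (2 * n + 3) ≤ 2 * ((n + 1) * (n + 2)) := by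
    have : (0 : ℝ) < 2 * (n + 1) + 1 := by positivity
    rw [← mul_div_assoc, le_div_iff₀ this] at h2
    linarith
  have h4 : ((n + 1) * (n + 2) * d) ^ 2 ≤ (2 * n + 3) * (2 * ((n + 1) * (n + 2))) := by
    rw [h1]
    calc ((2 * n + 3) * e) ^ 2 = (2 * n + 3) * (e ^ 2 * (2 * n + 3)) := by ring
      _ ≤ _ := by gcongr
  have h5 : d ^ 2 * (n + 1) ≤ 4 := by
    have hp : (0 : ℝ) < (n + 1) * (n + 2) ^ 2 := by positivity
    refine le_of_mul_le_mul_left ?_ hp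
    nlinarith
  rw [le_div_iff₀ (by positivity)]
  refine abs_le_of_sq_le_sq' ?_ (by norm_num) |>.2
  rw [mul_pow, sq_abs, Real.sq_sqrt (by positivity)]
  linarith

/-! ### Legendre coefficients -/

/-- The `n`-th Legendre coefficient `(n + 1/2) ∫_{-1}^{1} f L_n` of `f`. -/
noncomputable def legendreCoeff (f : ℝ → ℝ) (n : ℕ) : ℝ :=
  ((n : ℝ) + 1 / 2) * ∫ t in (-1 : ℝ)..1, f t * (legendre n).eval t

theorem legendreCoeff_sum {n j : ℕ} (c : ℕ → ℝ) (hj : j ≤ n) :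
    legendreCoeff (fun t => (∑ k ∈ Finset.range (n + 1), C (c k) * legendre k).eval t) j = c j := by
  have h : ∀ t, (∑ k ∈ Finset.range (n + 1), C (c k) * legendre k).eval t * (legendre j).eval t
      = ∑ k ∈ Finset.range (n + 1), c k * (legendre k * legendre j).eval t := by
    intro t
    simp only [eval_mul, eval_finsetSum, eval_C, Finset.sum_mul]
    exact Finset.sum_congr rfl fun _ _ => by ring
  simp only [legendreCoeff, h]
  rw [intervalIntegral.integral_finsetSum
    fun k _ => (intervalIntegrable_eval _ _ _).const_mul _, Finset.sum_eq_single j]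
  · rw [intervalIntegral.integral_const_mul, integral_legendre_sq]
    have : (0 : ℝ) < 2 * j + 1 := by positivity
    field_simp
  · intro k _ hk
    rw [intervalIntegral.integral_const_mul, integral_legendre_mul_legendre_of_ne hk, mul_zero]
  · intro h; exact absurd (Finset.mem_range.2 (Nat.lt_succ_of_le hj)) h

theorem sum_legendreCoeff_mul_legendre {n : ℕ} {p : ℝ[X]} (hp : p.natDegree ≤ n) :
    p = ∑ k ∈ Finset.range (n + 1), C (legendreCoeff (fun t => p.eval t) k) * legendre k := by
  obtain ⟨c, hc⟩ := exists_eq_sum_legendre n p hp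
  conv_lhs => rw [hc]
  refine Finset.sum_congr rfl fun j hj => ?_
  rw [hc, legendreCoeff_sum c (Nat.lt_succ_iff.1 (Finset.mem_range.1 hj))]

theorem abs_eval_le_sum_abs_legendreCoeff {n : ℕ} {p : ℝ[X]} (hp : p.natDegree ≤ n) {t : ℝ}
    (ht : t ∈ Icc (-1 : ℝ) 1) :
    |p.eval t| ≤ ∑ k ∈ Finset.range (n + 1), |legendreCoeff (fun t => p.eval t) k| := by
  conv_lhs => rw [sum_legendreCoeff_mul_legendre hp]
  rw [eval_finsetSum]
  refine (Finset.abs_sum_le_sum_abs _ _).trans (Finset.sum_le_sum fun k _ => ?_)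
  rw [eval_mul, eval_C, abs_mul]
  exact mul_le_of_le_one_right (abs_nonneg _) (abs_legendre_eval_le_one k ht)

end PSOptimalControl

namespace PSOptimalControl

open Polynomial

/-! ### Legendre–Gauss–Lobatto nodes -/

/-- The nodal polynomial `(x² - 1) L_N'`. -/
noncomputable def lglPoly (N : ℕ) : ℝ[X] := (X ^ 2 - 1) * derivative (legendre N)

theorem derivative_lglPoly (N : ℕ) :
    derivative (lglPoly N) = C ((N : ℝ) * (N + 1)) * legendre N := by
  rw [lglPoly, derivative_sq_sub_one_mul_derivative_legendre]
  simp

theorem natDegree_derivative_legendre (N : ℕ) :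
    (derivative (legendre N)).natDegree = N - 1 := by
  rw [natDegree_derivative, natDegree_legendre]

theorem derivative_legendre_ne_zero {N : ℕ} (hN : 1 ≤ N) : derivative (legendre N) ≠ 0 := by
  intro h
  have h1 := legendre_eval_one N
  have := congrArg (eval 1) (derivative_sq_sub_one_mul_derivative_legendre N)
  rw [h] at this
  simp [h1] at this
  rcases this with h | h
  · omega
  · have : (0 : ℝ) < N + 1 := by positivity
    exact this.ne' h

theorem natDegree_X_sq_sub_one : (X ^ 2 - 1 : ℝ[X]).natDegree = 2 := by compute_degree!

theorem natDegree_lglPoly {N : ℕ} (hN : 1 ≤ N) : (lglPoly N).natDegree = N + 1 := by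
  rw [lglPoly, natDegree_mul (by intro h; have := natDegree_X_sq_sub_one; rw [h] at this; simp at this)
    (derivative_legendre_ne_zero hN), natDegree_X_sq_sub_one, natDegree_derivative_legendre]
  omega

theorem lglPoly_ne_zero {N : ℕ} (hN : 1 ≤ N) : lglPoly N ≠ 0 := by
  intro h
  have := natDegree_lglPoly hN
  rw [h] at this
  simp at this

theorem integral_lglPoly_mul_derivative (N : ℕ) (q : ℝ[X]) :
    ∫ t in (-1 : ℝ)..1, (lglPoly N * derivative q).eval t
      = -(N * (N + 1) * ∫ t in (-1 : ℝ)..1, (legendre N * q).eval t) := by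
  have h := integral_derivative_eval (lglPoly N * q) (-1) 1
  rw [derivative_mul, derivative_lglPoly] at h
  simp only [eval_add, mul_assoc, eval_C_mul] at h
  rw [intervalIntegral.integral_add, intervalIntegral.integral_const_mul,
    intervalIntegral.integral_const_mul] at h
  · have h1 : (lglPoly N * q).eval 1 = 0 := by simp [lglPoly]
    have h2 : (lglPoly N * q).eval (-1) = 0 := by simp [lglPoly]
    rw [h1, h2] at h
    linarith
  · exact ((intervalIntegrable_eval _ _ _).const_mul _).const_mul _
  · exact intervalIntegrable_eval _ _ _

theorem integral_lglPoly_mul_eq_zero {N : ℕ} {q : ℝ[X]} (hq : q.natDegree + 1 < N) :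
    ∫ t in (-1 : ℝ)..1, (lglPoly N * q).eval t = 0 := by
  obtain ⟨Q, hQ, -, hd⟩ := exists_derivative_eq q 0
  rw [← hQ, integral_lglPoly_mul_derivative, integral_legendre_mul_eq_zero (hd.trans_lt hq)]
  simp

/-- By orthogonality `L_N'` has no nonconstant divisor that is nonnegative on `[-1, 1]`: if
`L_N' = s q`, then `∫ (1 - x²) s q² = 0`. -/
theorem natDegree_eq_zero_of_dvd_of_nonneg {N : ℕ} (hN : 1 ≤ N) {s : ℝ[X]}
    (hs : s ∣ derivative (legendre N)) (h0 : ∀ t ∈ Icc (-1 : ℝ) 1, 0 ≤ s.eval t) :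
    s.natDegree = 0 := by
  obtain ⟨q, hq⟩ := hs
  have hne := derivative_legendre_ne_zero hN
  have hs0 : s ≠ 0 := by rintro rfl; exact hne (by rw [hq, zero_mul])
  have hq0 : q ≠ 0 := by rintro rfl; exact hne (by rw [hq, mul_zero])
  by_contra hd
  have hdeg := natDegree_derivative_legendre N
  rw [hq, natDegree_mul hs0 hq0] at hdeg
  have h1 := integral_lglPoly_mul_eq_zero (N := N) (q := q) (by omega)
  have h2 : (1 - X ^ 2) * s * q ^ 2 = 0 := by
    refine eq_zero_of_integral_eq_zero (fun t ht => ?_) ?_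
    · have : 0 ≤ 1 - t ^ 2 := by nlinarith [ht.1, ht.2]
      have := h0 t ht
      simp only [eval_mul, eval_sub, eval_one, eval_pow, eval_X]
      positivity
    · have : ∀ t, ((1 - X ^ 2) * s * q ^ 2 : ℝ[X]).eval t = -(lglPoly N * q).eval t := by
        intro t; simp [lglPoly, hq]; ring
      simp only [this]
      rw [intervalIntegral.integral_neg, h1, neg_zero]
  have h3 : (1 - X ^ 2 : ℝ[X]) ≠ 0 := by
    intro h
    have := congrArg (eval 0) h
    simp at this
  exact mul_ne_zero (mul_ne_zero h3 hs0) (pow_ne_zero 2 hq0) h2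

theorem mem_Ioo_of_isRoot_derivative_legendre {N : ℕ} (hN : 1 ≤ N) {a : ℝ}
    (ha : (derivative (legendre N)).IsRoot a) : a ∈ Ioo (-1 : ℝ) 1 := by
  have hd := dvd_iff_isRoot.2 ha
  constructor
  · by_contra h
    have := natDegree_eq_zero_of_dvd_of_nonneg hN hd fun t ht => by
      simp; linarith [ht.1, not_lt.1 h]
    simp at this
  · by_contra h
    have := natDegree_eq_zero_of_dvd_of_nonneg hN (neg_dvd.2 hd) fun t ht => by
      simp; linarith [ht.2, not_lt.1 h]
    rw [natDegree_neg] at this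
    simp at this

theorem nodup_roots_derivative_legendre {N : ℕ} (hN : 1 ≤ N) :
    (derivative (legendre N)).roots.Nodup := by
  rw [Multiset.nodup_iff_count_le_one]
  intro a
  by_contra h
  rw [count_roots, not_le] at h
  have hd := (le_rootMultiplicity_iff (derivative_legendre_ne_zero hN)).1 (Nat.succ_le_of_lt h)
  have := natDegree_eq_zero_of_dvd_of_nonneg hN hd fun t _ => by simp; positivity
  simp at this

theorem card_roots_derivative_legendre {N : ℕ} (hN : 1 ≤ N) :
    Multiset.card (derivative (legendre N)).roots = N - 1 := by
  obtain ⟨q, hq, hc, hr⟩ := exists_prod_multiset_X_sub_C_mul (derivative (legendre N))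
  have hne := derivative_legendre_ne_zero hN
  have hd : q ∣ derivative (legendre N) := ⟨_, by rw [mul_comm]; exact hq.symm⟩
  have hq0 : q ≠ 0 := by rintro rfl; simp at hq; exact hne hq.symm
  have hroot : ∀ t, q.eval t ≠ 0 := fun t ht => by
    have := (mem_roots hq0).2 ht
    simp [hr] at this
  -- a polynomial without real roots has constant sign
  have hsign : (∀ t, 0 ≤ q.eval t) ∨ (∀ t, q.eval t ≤ 0) := by
    by_contra hcon
    push Not at hcon
    obtain ⟨⟨a, ha⟩, b, hb⟩ := hcon
    obtain ⟨c, hc⟩ := mem_range_of_exists_le_of_exists_ge q.continuous ⟨a, ha.le⟩ ⟨b, hb.le⟩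
    exact hroot c hc
  have h0 : q.natDegree = 0 := by
    rcases hsign with h | h
    · exact natDegree_eq_zero_of_dvd_of_nonneg hN hd fun t _ => h t
    · have := natDegree_eq_zero_of_dvd_of_nonneg hN (neg_dvd.2 hd) fun t _ => by
        simp [h t]
      simpa using this
  rw [natDegree_derivative_legendre] at hc
  omega

theorem mem_lglNodeSet {N : ℕ} (hN : 1 ≤ N) {t : ℝ} :
    t ∈ lglNodeSet N ↔ (lglPoly N).eval t = 0 := by
  have hne := derivative_legendre_ne_zero hN
  simp only [lglNodeSet, Finset.mem_union, Finset.mem_insert, Finset.mem_singleton,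
    Multiset.mem_toFinset, mem_roots hne, IsRoot.def, lglPoly, eval_mul, mul_eq_zero]
  have : (X ^ 2 - 1 : ℝ[X]).eval t = (t - 1) * (t + 1) := by simp; ring
  rw [this, mul_eq_zero, sub_eq_zero, add_eq_zero_iff_eq_neg]
  tauto

theorem lglNodeSet_subset {N : ℕ} (hN : 1 ≤ N) {t : ℝ} (ht : t ∈ lglNodeSet N) :
    t ∈ Icc (-1 : ℝ) 1 := by
  have hne := derivative_legendre_ne_zero hN
  simp only [lglNodeSet, Finset.mem_union, Finset.mem_insert, Finset.mem_singleton,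
    Multiset.mem_toFinset, mem_roots hne] at ht
  rcases ht with (rfl | rfl) | h
  · norm_num
  · norm_num
  · exact Ioo_subset_Icc_self (mem_Ioo_of_isRoot_derivative_legendre hN h)

theorem card_lglNodeSet {N : ℕ} (hN : 1 ≤ N) : (lglNodeSet N).card = N + 1 := by
  have hne := derivative_legendre_ne_zero hN
  rw [lglNodeSet, Finset.card_union_of_disjoint, Finset.card_pair (by norm_num),
    Multiset.toFinset_card_of_nodup (nodup_roots_derivative_legendre hN),
    card_roots_derivative_legendre hN]
  · omega
  · rw [Finset.disjoint_left]
    intro a ha hb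
    have := mem_Ioo_of_isRoot_derivative_legendre hN
      ((mem_roots hne).1 (Multiset.mem_toFinset.1 hb))
    simp only [Finset.mem_insert, Finset.mem_singleton] at ha
    rcases ha with rfl | rfl
    · exact this.1.false
    · exact this.2.false

theorem lglNode_eq_orderEmbOfFin {N : ℕ} (hN : 1 ≤ N) (k : Fin (N + 1)) :
    lglNode N k = (lglNodeSet N).orderEmbOfFin (card_lglNodeSet hN) k := by
  have hk : (k : ℕ) < ((lglNodeSet N).sort (· ≤ ·)).length := by
    rw [Finset.length_sort, card_lglNodeSet hN]; exact k.2
  rw [lglNode, Finset.orderEmbOfFin_apply, List.getD_eq_getElem _ _ hk]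
  rfl

theorem lglNode_mem {N : ℕ} (hN : 1 ≤ N) (k : Fin (N + 1)) : lglNode N k ∈ lglNodeSet N := by
  rw [lglNode_eq_orderEmbOfFin hN]
  exact Finset.orderEmbOfFin_mem _ _ _

theorem lglNode_mem_Icc {N : ℕ} (hN : 1 ≤ N) (k : Fin (N + 1)) :
    lglNode N k ∈ Icc (-1 : ℝ) 1 := lglNodeSet_subset hN (lglNode_mem hN k)

theorem lglPoly_eval_lglNode {N : ℕ} (hN : 1 ≤ N) (k : Fin (N + 1)) :
    (lglPoly N).eval (lglNode N k) = 0 := (mem_lglNodeSet hN).1 (lglNode_mem hN k)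

theorem lglNode_injective {N : ℕ} (hN : 1 ≤ N) : Function.Injective (lglNode N) := by
  intro i j h
  rw [lglNode_eq_orderEmbOfFin hN, lglNode_eq_orderEmbOfFin hN] at h
  exact (Finset.orderEmbOfFin _ _).injective h

theorem lglNode_zero {N : ℕ} (hN : 1 ≤ N) : lglNode N 0 = -1 := by
  rw [lglNode_eq_orderEmbOfFin hN]
  have := Finset.orderEmbOfFin_zero (card_lglNodeSet hN) (Nat.succ_pos N)
  refine Eq.trans this (le_antisymm (Finset.min'_le _ _ ?_) ?_)
  · simp [lglNodeSet]
  · exact Finset.le_min' _ _ _ fun y hy => (lglNodeSet_subset hN hy).1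

theorem lglNode_last {N : ℕ} (hN : 1 ≤ N) : lglNode N (Fin.last N) = 1 := by
  rw [lglNode_eq_orderEmbOfFin hN]
  have := Finset.orderEmbOfFin_last (card_lglNodeSet hN) (Nat.succ_pos N)
  refine Eq.trans this (le_antisymm ?_ (Finset.le_max' _ _ ?_))
  · exact Finset.max'_le _ _ _ fun y hy => (lglNodeSet_subset hN hy).2
  · simp [lglNodeSet]

theorem derivative_legendre_eval_lglNode {N : ℕ} (hN : 1 ≤ N) {k : Fin (N + 1)} (h0 : k ≠ 0)
    (h1 : k ≠ Fin.last N) : (derivative (legendre N)).eval (lglNode N k) = 0 := by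
  have h := lglPoly_eval_lglNode hN k
  rw [lglPoly, eval_mul, mul_eq_zero] at h
  refine h.resolve_left fun h => ?_
  have h2 : (lglNode N k - 1) * (lglNode N k + 1) = 0 := by
    simp at h
    linear_combination h
  rcases mul_eq_zero.1 h2 with h3 | h3
  · exact h1 (lglNode_injective hN (by rw [lglNode_last hN]; linarith))
  · exact h0 (lglNode_injective hN (by rw [lglNode_zero hN]; linarith))

theorem legendre_eval_ne_zero_of_derivative (n : ℕ) {t : ℝ}
    (h : (derivative (legendre n)).eval t = 0) : (legendre n).eval t ≠ 0 := by
  induction n with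
  | zero => simp [legendre_zero]
  | succ n ih =>
    intro h0
    have h1 := congrArg (eval t) (sq_sub_one_mul_derivative_legendre n)
    have h2 := congrArg (eval t) (derivative_legendre_pred n)
    simp [h, h0] at h1 h2
    refine ih h2 (h1.resolve_left ?_)
    positivity

theorem legendre_eval_lglNode_ne_zero {N : ℕ} (hN : 1 ≤ N) (k : Fin (N + 1)) :
    (legendre N).eval (lglNode N k) ≠ 0 := by
  by_cases h0 : k = 0
  · rw [h0, lglNode_zero hN, legendre_eval_neg_one]
    exact pow_ne_zero _ (by norm_num)
  by_cases h1 : k = Fin.last N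
  · rw [h1, lglNode_last hN, legendre_eval_one]
    exact one_ne_zero
  exact legendre_eval_ne_zero_of_derivative N (derivative_legendre_eval_lglNode hN h0 h1)

/-! ### The differentiation matrix and the quadrature rule -/

/-- The quotient `ω / (x - t_k)` of the nodal polynomial `ω = (x² - 1) L_N'`. -/
noncomputable def nodeQuotient (N : ℕ) (k : Fin (N + 1)) : ℝ[X] :=
  lglPoly N /ₘ (X - C (lglNode N k))

section Nodes

variable {N : ℕ} (hN : 1 ≤ N)
include hN

theorem mul_nodeQuotient (k : Fin (N + 1)) :
    (X - C (lglNode N k)) * nodeQuotient N k = lglPoly N :=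
  mul_divByMonic_eq_iff_isRoot.2 (lglPoly_eval_lglNode hN k)

theorem natDegree_nodeQuotient (k : Fin (N + 1)) : (nodeQuotient N k).natDegree = N := by
  rw [nodeQuotient, natDegree_divByMonic _ (monic_X_sub_C _), natDegree_lglPoly hN]
  simp

theorem nodeQuotient_eval_of_ne {j k : Fin (N + 1)} (h : j ≠ k) :
    (nodeQuotient N k).eval (lglNode N j) = 0 := by
  have := congrArg (eval (lglNode N j)) (mul_nodeQuotient hN k)
  rw [lglPoly_eval_lglNode hN, eval_mul, mul_eq_zero] at this
  refine this.resolve_left fun h' => h (lglNode_injective hN ?_)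
  simpa [sub_eq_zero] using h'

theorem derivative_nodeQuotient_eval (k : Fin (N + 1)) (t : ℝ) :
    (nodeQuotient N k).eval t + (t - lglNode N k) * (derivative (nodeQuotient N k)).eval t
      = N * (N + 1) * (legendre N).eval t := by
  have := congrArg (fun p => eval t (derivative p)) (mul_nodeQuotient hN k)
  rw [derivative_lglPoly] at this
  simpa [derivative_mul] using this

theorem nodeQuotient_eval_self (k : Fin (N + 1)) :
    (nodeQuotient N k).eval (lglNode N k)
      = N * (N + 1) * (legendre N).eval (lglNode N k) := by
  have := derivative_nodeQuotient_eval hN k (lglNode N k)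
  simpa using this

theorem two_mul_derivative_nodeQuotient_eval_self (k : Fin (N + 1)) :
    2 * (derivative (nodeQuotient N k)).eval (lglNode N k)
      = N * (N + 1) * (derivative (legendre N)).eval (lglNode N k) := by
  have := congrArg (fun p => eval (lglNode N k) (derivative (derivative p))) (mul_nodeQuotient hN k)
  rw [derivative_lglPoly] at this
  simp [derivative_mul] at this
  linarith

theorem nodeQuotient_eval_self_ne_zero (k : Fin (N + 1)) :
    (N : ℝ) * (N + 1) * (legendre N).eval (lglNode N k) ≠ 0 := by
  have : (0 : ℝ) < N := by exact_mod_cast hN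
  exact mul_ne_zero (by positivity) (legendre_eval_lglNode_ne_zero hN k)

theorem eq_of_eval_lglNode_eq {p q : ℝ[X]} (hp : p.natDegree ≤ N) (hq : q.natDegree ≤ N)
    (h : ∀ k, p.eval (lglNode N k) = q.eval (lglNode N k)) : p = q := by
  refine eq_of_natDegree_lt_card_of_eval_eq p q (lglNode_injective hN) h ?_
  rw [Fintype.card_fin]
  exact Nat.lt_succ_of_le (max_le hp hq)

/-- Lagrange interpolation at the nodes. -/
theorem eq_sum_nodeQuotient {p : ℝ[X]} (hp : p.natDegree ≤ N) :
    p = ∑ k, C (p.eval (lglNode N k) / (N * (N + 1) * (legendre N).eval (lglNode N k)))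
      * nodeQuotient N k := by
  refine eq_of_eval_lglNode_eq hN hp ?_ fun j => ?_
  · refine natDegree_sum_le_of_forall_le _ _ fun i _ => ?_
    exact (natDegree_C_mul_le _ _).trans (natDegree_nodeQuotient hN i).le
  · rw [eval_finsetSum, Finset.sum_eq_single j]
    · rw [eval_mul, eval_C, nodeQuotient_eval_self hN,
        div_mul_cancel₀ _ (nodeQuotient_eval_self_ne_zero hN j)]
    · intro k _ hk
      rw [eval_mul, nodeQuotient_eval_of_ne hN hk.symm, mul_zero]
    · intro h; exact absurd (Finset.mem_univ j) h

theorem diffMatrix_eq (i k : Fin (N + 1)) :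
    diffMatrix N i k = (derivative (nodeQuotient N k)).eval (lglNode N i)
      / (N * (N + 1) * (legendre N).eval (lglNode N k)) := by
  have hN0 : (0 : ℝ) < N := by exact_mod_cast hN
  have hk := legendre_eval_lglNode_ne_zero hN k
  simp only [diffMatrix, Matrix.of_apply, legendreEval]
  split_ifs with h1 h2 h3
  · have h := derivative_nodeQuotient_eval hN k (lglNode N i)
    rw [nodeQuotient_eval_of_ne hN h1, zero_add] at h
    have hs : lglNode N i - lglNode N k ≠ 0 :=
      sub_ne_zero.2 fun h => h1 (lglNode_injective hN h)
    have hz : (N : ℝ) + 1 ≠ 0 := by positivity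
    rw [eq_comm, div_eq_iff (nodeQuotient_eval_self_ne_zero hN k)]
    rw [mul_comm] at h
    rw [eq_div_of_mul_eq hs h]
    field_simp
  · obtain rfl : i = k := not_not.1 h1
    have h := two_mul_derivative_nodeQuotient_eval_self hN i
    subst h2
    have hL := congrArg (eval (-1)) (derivative_sq_sub_one_mul_derivative_legendre N)
    rw [lglNode_zero hN] at h hk ⊢
    simp [derivative_mul] at hL
    rw [eq_comm, div_eq_iff (mul_ne_zero (by positivity) hk)]
    linear_combination h / 2 + (N * (N + 1) / 4) * -hL
  · obtain rfl : i = k := not_not.1 h1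
    have h := two_mul_derivative_nodeQuotient_eval_self hN i
    subst h3
    have hL := congrArg (eval 1) (derivative_sq_sub_one_mul_derivative_legendre N)
    rw [lglNode_last hN] at h hk ⊢
    simp [derivative_mul] at hL
    rw [eq_comm, div_eq_iff (mul_ne_zero (by positivity) hk)]
    linear_combination h / 2 + (N * (N + 1) / 4) * hL
  · obtain rfl : i = k := not_not.1 h1
    have h := two_mul_derivative_nodeQuotient_eval_self hN i
    rw [derivative_legendre_eval_lglNode hN h2 h3, mul_zero] at h
    rw [show (derivative (nodeQuotient N i)).eval (lglNode N i) = 0 by linarith, zero_div]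

/-- The matrix `D` differentiates polynomials of degree at most `N` at the nodes. -/
theorem diffMatrix_mulVec_eval {p : ℝ[X]} (hp : p.natDegree ≤ N) :
    diffMatrix N *ᵥ (fun k => p.eval (lglNode N k))
      = fun k => (derivative p).eval (lglNode N k) := by
  funext i
  conv_rhs => rw [eq_sum_nodeQuotient hN hp]
  simp only [derivative_sum, derivative_C_mul, eval_finsetSum, eval_C_mul, Matrix.mulVec,
    dotProduct, diffMatrix_eq hN]
  refine Finset.sum_congr rfl fun k _ => ?_
  ring

theorem diffMatrix_pow_mulVec_eval {p : ℝ[X]} (hp : p.natDegree ≤ N) (j : ℕ) :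
    (diffMatrix N ^ j) *ᵥ (fun k => p.eval (lglNode N k))
      = fun k => (derivative^[j] p).eval (lglNode N k) := by
  induction j with
  | zero => simp
  | succ j ih =>
    rw [pow_succ', ← Matrix.mulVec_mulVec, ih, diffMatrix_mulVec_eval hN
      ((natDegree_iterate_derivative _ _).trans ((Nat.sub_le _ _).trans hp)),
      Function.iterate_succ_apply']

theorem integral_eq_sum_of_natDegree_le {p : ℝ[X]} (hp : p.natDegree ≤ N) :
    ∫ t in (-1 : ℝ)..1, p.eval t = ∑ k, p.eval (lglNode N k) *
      ((∫ t in (-1 : ℝ)..1, (nodeQuotient N k).eval t)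
        / (N * (N + 1) * (legendre N).eval (lglNode N k))) := by
  conv_lhs => rw [eq_sum_nodeQuotient hN hp]
  simp only [eval_finsetSum, eval_C_mul]
  rw [intervalIntegral.integral_finsetSum fun k _ => (intervalIntegrable_eval _ _ _).const_mul _]
  refine Finset.sum_congr rfl fun k _ => ?_
  rw [intervalIntegral.integral_const_mul]
  ring

/-- Division by the nodal polynomial, which is orthogonal to the quotient, extends the exactness
of interpolatory quadrature from degree `N` to degree `2 N - 1`. -/
theorem integral_eq_sum_of_natDegree_le_two_mul {p : ℝ[X]} (hp : p.natDegree ≤ 2 * N - 1) :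
    ∫ t in (-1 : ℝ)..1, p.eval t = ∑ k, p.eval (lglNode N k) *
      ((∫ t in (-1 : ℝ)..1, (nodeQuotient N k).eval t)
        / (N * (N + 1) * (legendre N).eval (lglNode N k))) := by
  have hdm := EuclideanDomain.div_add_mod p (lglPoly N)
  have hω := natDegree_lglPoly hN
  have hr : (p % lglPoly N).natDegree < N + 1 := by
    have := natDegree_mod_lt p (q := lglPoly N) (by omega)
    omega
  have hq : ∫ t in (-1 : ℝ)..1, (lglPoly N * (p / lglPoly N)).eval t = 0 := by
    by_cases h0 : p / lglPoly N = 0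
    · simp [h0]
    · refine integral_lglPoly_mul_eq_zero ?_
      have h1 : (lglPoly N * (p / lglPoly N)).natDegree ≤ max (2 * N - 1) N := by
        rw [eq_sub_of_add_eq hdm]
        exact (natDegree_sub_le _ _).trans (max_le_max hp (Nat.lt_succ_iff.1 hr))
      rw [natDegree_mul (lglPoly_ne_zero hN) h0, hω, max_eq_left (by omega)] at h1
      omega
  have he : ∀ k, p.eval (lglNode N k) = (p % lglPoly N).eval (lglNode N k) := by
    intro k
    conv_lhs => rw [← hdm]
    rw [eval_add, eval_mul, lglPoly_eval_lglNode hN, zero_mul, zero_add]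
  simp only [he]
  rw [← integral_eq_sum_of_natDegree_le hN (Nat.lt_succ_iff.1 hr)]
  conv_lhs => rw [← hdm]
  simp only [eval_add]
  rw [intervalIntegral.integral_add (intervalIntegrable_eval _ _ _)
    (intervalIntegrable_eval _ _ _), hq, zero_add]

/-- The polynomial `s = L_N - (x - t_k) L_N' / N` has degree less than `N` and the value `L_N(t_k)`
at `t_k`, so that the quadrature rule, applied to `s ω / (x - t_k)`, isolates the weight. -/
theorem integral_nodeQuotient (k : Fin (N + 1)) :
    (∫ t in (-1 : ℝ)..1, (nodeQuotient N k).eval t)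
        / (N * (N + 1) * (legendre N).eval (lglNode N k)) = lglWeight N k := by
  have hN0 : (0 : ℝ) < N := by exact_mod_cast hN
  have hc := (coeff_legendre_pos N)
  have hLk := legendre_eval_lglNode_ne_zero hN k
  set W := fun k : Fin (N + 1) => (∫ t in (-1 : ℝ)..1, (nodeQuotient N k).eval t)
        / (N * (N + 1) * (legendre N).eval (lglNode N k)) with hW
  set s : ℝ[X] := legendre N
    - C (1 / (N : ℝ)) * ((X - C (lglNode N k)) * derivative (legendre N)) with hs
  have hsdeg : s.natDegree ≤ N - 1 := by
    have h1 : s.natDegree ≤ N := by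
      refine (natDegree_sub_le _ _).trans (max_le (natDegree_legendre N).le ?_)
      refine (natDegree_C_mul_le _ _).trans (natDegree_mul_le.trans ?_)
      rw [natDegree_derivative_legendre, natDegree_X_sub_C]
      omega
    have h2 : s.coeff N = 0 := by
      obtain ⟨M, rfl⟩ : ∃ M, N = M + 1 := ⟨N - 1, by omega⟩
      have h3 : (derivative (legendre (M + 1))).coeff (M + 1) = 0 :=
        coeff_eq_zero_of_natDegree_lt (by rw [natDegree_derivative_legendre]; omega)
      rw [hs, coeff_sub, coeff_C_mul, sub_mul, coeff_sub, coeff_X_mul, coeff_C_mul, h3,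
        coeff_derivative]
      push_cast at hN0 ⊢
      field_simp
      ring
    refine Nat.le_sub_one_of_lt (lt_of_le_of_ne h1 fun h3 => ?_)
    have h4 : s = 0 := by rw [← leadingCoeff_eq_zero, leadingCoeff, h3, h2]
    rw [h4] at h3
    simp at h3
    omega
  have hseval : s.eval (lglNode N k) = (legendre N).eval (lglNode N k) := by simp [hs]
  have h1 := integral_eq_sum_of_natDegree_le_two_mul hN (p := nodeQuotient N k * s) (by
    refine natDegree_mul_le.trans ?_
    rw [natDegree_nodeQuotient hN]
    omega)
  rw [Finset.sum_eq_single k] at h1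
  rotate_left
  · intro j _ hj
    rw [eval_mul, nodeQuotient_eval_of_ne hN hj]
    simp
  · intro h; exact absurd (Finset.mem_univ k) h
  rw [eval_mul, nodeQuotient_eval_self hN, hseval] at h1
  -- the two parts of `∫ s ω / (x - t_k)`
  have h2 : ∫ t in (-1 : ℝ)..1, (lglPoly N * derivative (legendre N)).eval t
      = -(N * (N + 1) * (2 / (2 * N + 1))) := by
    rw [integral_lglPoly_mul_derivative, integral_legendre_sq]
  have h3 : ∫ t in (-1 : ℝ)..1, (nodeQuotient N k * legendre N).eval t
      = N * (2 / (2 * N + 1)) := by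
    have hd : (nodeQuotient N k - C (N : ℝ) * legendre N).natDegree < N := by
      have h4 : (nodeQuotient N k - C (N : ℝ) * legendre N).natDegree ≤ N :=
        (natDegree_sub_le _ _).trans (max_le (natDegree_nodeQuotient hN k).le
          ((natDegree_C_mul_le _ _).trans (natDegree_legendre N).le))
      have h5 : (nodeQuotient N k).coeff N = N * (legendre N).coeff N := by
        have h6 := congrArg (fun p => coeff p (N + 1)) (mul_nodeQuotient hN k)
        have h7 : (nodeQuotient N k).coeff (N + 1) = 0 :=
          coeff_eq_zero_of_natDegree_lt (by rw [natDegree_nodeQuotient hN]; omega)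
        have h8 : (derivative (legendre N)).coeff (N + 1) = 0 :=
          coeff_eq_zero_of_natDegree_lt (by rw [natDegree_derivative_legendre]; omega)
        obtain ⟨M, rfl⟩ : ∃ M, N = M + 1 := ⟨N - 1, by omega⟩
        rw [lglPoly] at h6
        simp only [sub_mul, coeff_sub, coeff_X_mul, coeff_C_mul, h7, one_mul, h8] at h6
        rw [show M + 1 + 1 = M + 2 from rfl, coeff_X_pow_mul, coeff_derivative] at h6
        push_cast
        linarith
      refine lt_of_le_of_ne h4 fun h9 => ?_
      have h10 : nodeQuotient N k - C (N : ℝ) * legendre N = 0 := by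
        rw [← leadingCoeff_eq_zero, leadingCoeff, h9, coeff_sub, coeff_C_mul, h5, sub_self]
      rw [h10] at h9
      simp at h9
      omega
    have h4 : ∀ t, (nodeQuotient N k * legendre N).eval t
        = (legendre N * (nodeQuotient N k - C (N : ℝ) * legendre N)).eval t
          + N * (legendre N * legendre N).eval t := by
      intro t; simp; ring
    simp only [h4]
    rw [intervalIntegral.integral_add (intervalIntegrable_eval _ _ _)
      ((intervalIntegrable_eval _ _ _).const_mul _), integral_legendre_mul_eq_zero hd,
      intervalIntegral.integral_const_mul, integral_legendre_sq, zero_add]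
  have h5 : ∫ t in (-1 : ℝ)..1, (nodeQuotient N k * s).eval t = 2 := by
    have h4 : nodeQuotient N k * s = nodeQuotient N k * legendre N
        - C (1 / (N : ℝ)) * (lglPoly N * derivative (legendre N)) := by
      rw [hs, ← mul_nodeQuotient hN k]; ring
    rw [h4]
    simp only [eval_sub, eval_C_mul]
    rw [intervalIntegral.integral_sub (intervalIntegrable_eval _ _ _)
      ((intervalIntegrable_eval _ _ _).const_mul _), intervalIntegral.integral_const_mul, h2, h3]
    have : (0 : ℝ) < 2 * N + 1 := by positivity
    field_simp
    ring
  rw [h5] at h1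
  have hz : (N : ℝ) + 1 ≠ 0 := by positivity
  change W k = _
  change 2 = _ * W k at h1
  rw [lglWeight, legendreEval]
  field_simp
  linarith

/-- The Legendre–Gauss–Lobatto rule is exact for polynomials of degree at most `2 N - 1`. -/
theorem lgl_quadrature {p : ℝ[X]} (hp : p.natDegree ≤ 2 * N - 1) :
    ∑ k, p.eval (lglNode N k) * lglWeight N k = ∫ t in (-1 : ℝ)..1, p.eval t := by
  rw [integral_eq_sum_of_natDegree_le_two_mul hN hp]
  simp only [integral_nodeQuotient hN]

theorem sum_lglWeight : ∑ k, lglWeight N k = 2 := by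
  have := lgl_quadrature hN (p := 1) (by simp)
  norm_num at this
  exact this

end Nodes

theorem lglWeight_nonneg (N : ℕ) (k : Fin (N + 1)) : 0 ≤ lglWeight N k := by
  unfold lglWeight
  positivity

end PSOptimalControl

namespace PSOptimalControl

open Polynomial

/-! ### Jackson's theorem -/

/-- The nonnegative trigonometric polynomial `|∑_{j ≤ n} a_j e^{ijs}|²`. -/
noncomputable def trigKernel (a : ℕ → ℝ) (n : ℕ) (s : ℝ) : ℝ :=
  (∑ j ∈ Finset.range (n + 1), a j * Real.cos (j * s)) ^ 2
    + (∑ j ∈ Finset.range (n + 1), a j * Real.sin (j * s)) ^ 2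

theorem trigKernel_nonneg (a : ℕ → ℝ) (n : ℕ) (s : ℝ) : 0 ≤ trigKernel a n s := by
  unfold trigKernel; positivity

theorem continuous_trigKernel (a : ℕ → ℝ) (n : ℕ) : Continuous (trigKernel a n) := by
  unfold trigKernel; fun_prop

theorem trigKernel_eq (a : ℕ → ℝ) (n : ℕ) (s : ℝ) :
    trigKernel a n s = ∑ j ∈ Finset.range (n + 1), ∑ l ∈ Finset.range (n + 1),
      a j * a l * Real.cos ((((j : ℤ) - l : ℤ) : ℝ) * s) := by
  rw [trigKernel, sq, sq, Finset.sum_mul_sum, Finset.sum_mul_sum, ← Finset.sum_add_distrib]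
  refine Finset.sum_congr rfl fun j _ => ?_
  rw [← Finset.sum_add_distrib]
  refine Finset.sum_congr rfl fun l _ => ?_
  push_cast
  rw [sub_mul, Real.cos_sub]
  ring

theorem trigKernel_sub_add_trigKernel_add (a : ℕ → ℝ) (n : ℕ) (θ φ : ℝ) :
    trigKernel a n (θ - φ) + trigKernel a n (θ + φ)
      = ∑ j ∈ Finset.range (n + 1), ∑ l ∈ Finset.range (n + 1),
        2 * (a j * a l) * (Real.cos ((((j : ℤ) - l : ℤ) : ℝ) * θ)
          * Real.cos ((((j : ℤ) - l : ℤ) : ℝ) * φ)) := by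
  rw [trigKernel_eq, trigKernel_eq, ← Finset.sum_add_distrib]
  refine Finset.sum_congr rfl fun j _ => ?_
  rw [← Finset.sum_add_distrib]
  refine Finset.sum_congr rfl fun l _ => ?_
  rw [mul_sub, mul_add, Real.cos_sub, Real.cos_add]
  ring

theorem integral_cos_int_mul (m : ℤ) :
    ∫ φ in (0 : ℝ)..Real.pi, Real.cos (m * φ) = if m = 0 then Real.pi else 0 := by
  split_ifs with h
  · simp [h]
  · have hm : (m : ℝ) ≠ 0 := by exact_mod_cast h
    rw [intervalIntegral.integral_comp_mul_left (fun x => Real.cos x) hm, integral_cos]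
    simp [Real.sin_int_mul_pi]

theorem integral_trigKernel (a : ℕ → ℝ) (n : ℕ) (θ : ℝ) :
    ∫ φ in (0 : ℝ)..Real.pi, (trigKernel a n (θ - φ) + trigKernel a n (θ + φ))
      = 2 * Real.pi * ∑ j ∈ Finset.range (n + 1), a j ^ 2 := by
  simp only [trigKernel_sub_add_trigKernel_add]
  rw [intervalIntegral.integral_finsetSum fun j _ =>
    Continuous.intervalIntegrable (by fun_prop) _ _, Finset.mul_sum]
  refine Finset.sum_congr rfl fun j hj => ?_
  rw [intervalIntegral.integral_finsetSum fun j _ =>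
    Continuous.intervalIntegrable (by fun_prop) _ _, Finset.sum_eq_single j]
  · simp only [intervalIntegral.integral_const_mul]
    rw [integral_cos_int_mul]
    simp
    ring
  · intro l _ hl
    simp only [intervalIntegral.integral_const_mul]
    rw [integral_cos_int_mul, if_neg (by omega)]
    simp
  · intro h; exact absurd hj h

/-- Multiplying `|A(e^{is})|²` by `|1 - e^{is}|² = 2 (1 - cos s)` amounts to replacing the
coefficients of `A` by their differences. -/
theorem two_mul_one_sub_cos_mul_trigKernel {s0 : ℕ → ℝ} {n : ℕ} (h0 : s0 0 = 0)
    (hn : s0 (n + 2) = 0) (s : ℝ) :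
    2 * (1 - Real.cos s) * trigKernel (fun j => s0 (j + 1)) n s
      = trigKernel (fun j => s0 (j + 1) - s0 j) (n + 1) s := by
  have h1 : ∀ F : ℕ → ℝ, ∑ j ∈ Finset.range (n + 1 + 1), (s0 (j + 1) - s0 j) * F j
      = ∑ j ∈ Finset.range (n + 1), s0 (j + 1) * F j
        - ∑ j ∈ Finset.range (n + 1), s0 (j + 1) * F (j + 1) := by
    intro F
    simp only [sub_mul, Finset.sum_sub_distrib]
    rw [Finset.sum_range_succ, hn, Finset.sum_range_succ' (fun j => s0 j * F j), h0]
    simp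
  unfold trigKernel
  rw [h1, h1]
  set C := ∑ j ∈ Finset.range (n + 1), s0 (j + 1) * Real.cos (j * s) with hC
  set S := ∑ j ∈ Finset.range (n + 1), s0 (j + 1) * Real.sin (j * s) with hS
  have h2 : ∑ j ∈ Finset.range (n + 1), s0 (j + 1) * Real.cos ((j + 1 : ℕ) * s)
      = Real.cos s * C - Real.sin s * S := by
    rw [hC, hS, Finset.mul_sum, Finset.mul_sum, ← Finset.sum_sub_distrib]
    refine Finset.sum_congr rfl fun j _ => ?_
    push_cast
    rw [add_mul, one_mul, Real.cos_add]
    ring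
  have h3 : ∑ j ∈ Finset.range (n + 1), s0 (j + 1) * Real.sin ((j + 1 : ℕ) * s)
      = Real.sin s * C + Real.cos s * S := by
    rw [hC, hS, Finset.mul_sum, Finset.mul_sum, ← Finset.sum_add_distrib]
    refine Finset.sum_congr rfl fun j _ => ?_
    push_cast
    rw [add_mul, one_mul, Real.sin_add]
    ring
  rw [h2, h3]
  linear_combination -(C ^ 2 + S ^ 2) * Real.sin_sq_add_cos_sq s

theorem sum_sin_sub_sin_sq (β : ℝ) (k : ℕ) :
    ∑ j ∈ Finset.range (k + 1), (Real.sin ((j + 1 : ℕ) * β) - Real.sin (j * β)) ^ 2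
      = 2 * (1 - Real.cos β) * ∑ j ∈ Finset.range (k + 1), Real.sin (j * β) ^ 2
        + Real.sin ((k + 1 : ℕ) * β) ^ 2 - Real.sin ((k + 1 : ℕ) * β) * Real.sin (k * β) := by
  induction k with
  | zero => simp
  | succ k ih =>
    rw [Finset.sum_range_succ, ih, Finset.sum_range_succ _ (k + 1)]
    have h1 : Real.sin ((k + 1 + 1 : ℕ) * β) + Real.sin (k * β)
        = 2 * Real.cos β * Real.sin ((k + 1 : ℕ) * β) := by
      have e1 : ((k + 1 + 1 : ℕ) : ℝ) * β = (k + 1 : ℕ) * β + β := by push_cast; ring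
      have e2 : (k : ℝ) * β = (k + 1 : ℕ) * β - β := by push_cast; ring
      rw [e1, e2, Real.sin_add, Real.sin_sub]
      ring
    linear_combination -Real.sin ((k + 1 : ℕ) * β) * h1

set_option maxHeartbeats 1000000 in
/-- Jackson's theorem for Lipschitz functions. The function `f ∘ cos` is convolved with
`|∑_{j ≤ n} sin ((j + 1) β) e^{ijs}|²`, `β = π / (n + 2)`, the kernel of degree `n` whose first
moment is as concentrated as possible. -/
theorem exists_polynomial_near_of_lipschitz {f : ℝ → ℝ} {L : ℝ} (hL : 0 ≤ L)
    (hf : ∀ x ∈ Icc (-1 : ℝ) 1, ∀ y ∈ Icc (-1 : ℝ) 1, |f x - f y| ≤ L * |x - y|) (n : ℕ) :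
    ∃ p : ℝ[X], p.natDegree ≤ n ∧
      ∀ x ∈ Icc (-1 : ℝ) 1, |f x - p.eval x| ≤ 6 * L / (n + 1) := by
  have hcos : ∀ φ : ℝ, Real.cos φ ∈ Icc (-1 : ℝ) 1 :=
    fun φ => ⟨Real.neg_one_le_cos φ, Real.cos_le_one φ⟩
  have hfc : Continuous fun φ => f (Real.cos φ) := by
    have h1 : ContinuousOn f (Icc (-1 : ℝ) 1) := by
      refine LipschitzOnWith.continuousOn (K := ⟨L, hL⟩) (LipschitzOnWith.of_dist_le_mul ?_)
      intro x hx y hy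
      exact hf x hx y hy
    exact h1.comp_continuous Real.continuous_cos hcos
  set β : ℝ := Real.pi / (n + 2) with hβ
  have hn2 : (0 : ℝ) < n + 2 := by positivity
  set s0 : ℕ → ℝ := fun j => Real.sin (j * β) with hs0
  set a : ℕ → ℝ := fun j => s0 (j + 1) with ha
  set A : ℝ := ∑ j ∈ Finset.range (n + 1), a j ^ 2 with hA
  have hs00 : s0 0 = 0 := by simp [hs0]
  have hs0n : s0 (n + 2) = 0 := by
    have : ((n + 2 : ℕ) : ℝ) * β = Real.pi := by rw [hβ]; push_cast; field_simp
    simp only [hs0, this, Real.sin_pi]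
  have hApos : 0 < A := by
    have h1 : 0 < a 0 := by
      simp only [ha, hs0]
      refine Real.sin_pos_of_pos_of_lt_pi (by positivity) ?_
      have : (0 : ℝ) ≤ n := by positivity
      rw [hβ, zero_add, Nat.cast_one, one_mul, div_lt_iff₀ hn2]
      nlinarith [Real.pi_pos]
    exact Finset.sum_pos' (fun i _ => sq_nonneg _) ⟨0, by simp, pow_pos h1 2⟩
  have hB : ∑ j ∈ Finset.range (n + 1 + 1), (s0 (j + 1) - s0 j) ^ 2
      = 2 * (1 - Real.cos β) * A := by
    have h1 := sum_sin_sub_sin_sq β (n + 1)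
    have h2 : Real.sin ((n + 1 + 1 : ℕ) * β) = 0 := hs0n
    rw [h2, Finset.sum_range_succ' (fun j : ℕ => Real.sin (j * β) ^ 2)] at h1
    simpa [hs0, ha, hA] using h1
  have hπA : 0 < 2 * Real.pi * A := mul_pos Real.two_pi_pos hApos
  set S : ℝ → ℝ → ℝ := fun θ φ => trigKernel a n (θ - φ) + trigKernel a n (θ + φ) with hS
  have hScont : ∀ θ, Continuous (S θ) := fun θ => by
    have := continuous_trigKernel a n
    simp only [hS]
    fun_prop
  set c : ℤ → ℝ := fun m => ∫ φ in (0 : ℝ)..Real.pi, f (Real.cos φ) * Real.cos (m * φ) with hc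
  set p : ℝ[X] := ∑ j ∈ Finset.range (n + 1), ∑ l ∈ Finset.range (n + 1),
    C ((2 * Real.pi * A)⁻¹ * (2 * (a j * a l) * c ((j : ℤ) - l)))
      * Chebyshev.T ℝ ((j : ℤ) - l) with hp
  have hpe : ∀ θ, 2 * Real.pi * A * p.eval (Real.cos θ)
      = ∫ φ in (0 : ℝ)..Real.pi, f (Real.cos φ) * S θ φ := by
    intro θ
    have h1 : ∀ φ, f (Real.cos φ) * S θ φ
        = ∑ j ∈ Finset.range (n + 1), ∑ l ∈ Finset.range (n + 1),
        2 * (a j * a l) * Real.cos ((((j : ℤ) - l : ℤ) : ℝ) * θ)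
          * (f (Real.cos φ) * Real.cos ((((j : ℤ) - l : ℤ) : ℝ) * φ)) := by
      intro φ
      simp only [hS, trigKernel_sub_add_trigKernel_add, Finset.mul_sum]
      refine Finset.sum_congr rfl fun j _ => Finset.sum_congr rfl fun l _ => ?_
      ring
    simp only [h1]
    rw [intervalIntegral.integral_finsetSum fun j _ =>
      Continuous.intervalIntegrable (by
        exact continuous_finsetSum _ fun l _ =>
          continuous_const.mul (hfc.mul (by fun_prop))) _ _, hp, eval_finsetSum, Finset.mul_sum]
    refine Finset.sum_congr rfl fun j _ => ?_
    rw [intervalIntegral.integral_finsetSum fun j _ =>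
      Continuous.intervalIntegrable
        (by exact continuous_const.mul (hfc.mul (by fun_prop))) _ _,
      eval_finsetSum, Finset.mul_sum]
    refine Finset.sum_congr rfl fun l _ => ?_
    rw [intervalIntegral.integral_const_mul, eval_mul, eval_C, Chebyshev.T_real_cos]
    simp only [hc]
    field_simp
  refine ⟨p, ?_, fun x hx => ?_⟩
  · refine natDegree_sum_le_of_forall_le _ _ fun j hj =>
      natDegree_sum_le_of_forall_le _ _ fun l hl => ?_
    refine (natDegree_C_mul_le _ _).trans ?_
    rw [Chebyshev.natDegree_T]
    have h1 := Finset.mem_range.1 hj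
    have h2 := Finset.mem_range.1 hl
    omega
  · set θ := Real.arccos x
    have hx' : Real.cos θ = x := Real.cos_arccos hx.1 hx.2
    rw [← hx']
    have hSint : ∫ φ in (0 : ℝ)..Real.pi, S θ φ = 2 * Real.pi * A := integral_trigKernel a n θ
    have h1 : 2 * Real.pi * A * (f (Real.cos θ) - p.eval (Real.cos θ))
        = ∫ φ in (0 : ℝ)..Real.pi, (f (Real.cos θ) - f (Real.cos φ)) * S θ φ := by
      simp only [sub_mul]
      have := hScont θ
      rw [intervalIntegral.integral_sub (Continuous.intervalIntegrable (by fun_prop) _ _)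
        (Continuous.intervalIntegrable (by exact hfc.mul this) _ _), intervalIntegral.integral_const_mul,
        hSint, mul_sub, hpe]
      ring
    set b : ℕ → ℝ := fun j => s0 (j + 1) - s0 j with hb
    set R : ℝ → ℝ := fun φ => trigKernel b (n + 1) (θ - φ) + trigKernel b (n + 1) (θ + φ) with hR
    have hRcont : Continuous R := by
      have := continuous_trigKernel b (n + 1)
      simp only [hR]
      fun_prop
    have hRint : ∫ φ in (0 : ℝ)..Real.pi, R φ = 2 * Real.pi * (2 * (1 - Real.cos β) * A) := by
      rw [← hB]; exact integral_trigKernel b (n + 1) θ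
    -- `|u| ≤ (c u² + 1 / c) / 2` with `c = n + 2`, and `(cos θ - cos φ)² ≤ 2 (1 - cos (θ ± φ))`
    have h2 : ∀ φ, ‖(f (Real.cos θ) - f (Real.cos φ)) * S θ φ‖
        ≤ L * ((n + 2) / 2 * R φ + 1 / (2 * (n + 2)) * S θ φ) := by
      intro φ
      have hk1 := trigKernel_nonneg a n (θ - φ)
      have hk2 := trigKernel_nonneg a n (θ + φ)
      have hS0 : 0 ≤ S θ φ := add_nonneg hk1 hk2
      rw [norm_mul, Real.norm_eq_abs, Real.norm_eq_abs, abs_of_nonneg hS0]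
      set u := Real.cos θ - Real.cos φ with hu
      have hu1 : u ^ 2 ≤ 2 * (1 - Real.cos (θ - φ)) := by
        rw [Real.cos_sub]
        nlinarith [sq_nonneg (Real.sin θ - Real.sin φ), Real.sin_sq_add_cos_sq θ,
          Real.sin_sq_add_cos_sq φ]
      have hu2 : u ^ 2 ≤ 2 * (1 - Real.cos (θ + φ)) := by
        rw [Real.cos_add]
        nlinarith [sq_nonneg (Real.sin θ + Real.sin φ), Real.sin_sq_add_cos_sq θ,
          Real.sin_sq_add_cos_sq φ]
      have hRu : u ^ 2 * S θ φ ≤ R φ := by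
        simp only [hS, hR, hb, ← two_mul_one_sub_cos_mul_trigKernel hs00 hs0n, mul_add]
        exact add_le_add (mul_le_mul_of_nonneg_right hu1 hk1)
          (mul_le_mul_of_nonneg_right hu2 hk2)
      have hamgm : |u| ≤ (n + 2) / 2 * u ^ 2 + 1 / (2 * (n + 2)) := by
        have h3 : (n + 2) / 2 * u ^ 2 + 1 / (2 * (n + 2)) - |u|
            = ((n + 2) * |u| - 1) ^ 2 / (2 * (n + 2)) := by
          rw [← sq_abs u]
          field_simp
          ring
        have h4 : 0 ≤ ((n + 2) * |u| - 1) ^ 2 / (2 * ((n : ℝ) + 2)) := by positivity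
        linarith
      calc |f (Real.cos θ) - f (Real.cos φ)| * S θ φ
          ≤ L * |u| * S θ φ := by gcongr; exact hf _ (hcos θ) _ (hcos φ)
        _ ≤ L * ((n + 2) / 2 * u ^ 2 + 1 / (2 * (n + 2))) * S θ φ := by gcongr
        _ = L * ((n + 2) / 2 * (u ^ 2 * S θ φ) + 1 / (2 * (n + 2)) * S θ φ) := by ring
        _ ≤ _ := by gcongr
    have h3 : |2 * Real.pi * A * (f (Real.cos θ) - p.eval (Real.cos θ))|
        ≤ L * ((n + 2) / 2 * (2 * Real.pi * (2 * (1 - Real.cos β) * A))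
          + 1 / (2 * (n + 2)) * (2 * Real.pi * A)) := by
      rw [h1, ← Real.norm_eq_abs]
      have hSc := hScont θ
      refine (intervalIntegral.norm_integral_le_of_norm_le Real.pi_pos.le
        (Filter.Eventually.of_forall fun φ _ => h2 φ)
        (Continuous.intervalIntegrable (by fun_prop) _ _)).trans (le_of_eq ?_)
      rw [intervalIntegral.integral_const_mul, intervalIntegral.integral_add
        (Continuous.intervalIntegrable (by fun_prop) _ _)
        (Continuous.intervalIntegrable (by fun_prop) _ _), intervalIntegral.integral_const_mul,
        intervalIntegral.integral_const_mul, hRint, hSint]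
    have h4 : 1 - Real.cos β ≤ β ^ 2 / 2 := by
      linarith [Real.one_sub_sq_div_two_le_cos (x := β)]
    have h5 : β ^ 2 ≤ 10 / (n + 2) ^ 2 := by
      rw [hβ, div_pow]
      gcongr
      nlinarith [Real.pi_pos, Real.pi_lt_d2]
    rw [abs_mul, abs_of_pos hπA] at h3
    have h6 : |f (Real.cos θ) - p.eval (Real.cos θ)|
        ≤ L * ((n + 2) * (1 - Real.cos β) + 1 / (2 * (n + 2))) := by
      refine le_of_mul_le_mul_left (h3.trans (le_of_eq ?_)) hπA
      ring
    refine h6.trans ?_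
    have h7 : (n + 2) * (1 - Real.cos β) + 1 / (2 * (n + 2)) ≤ 6 / ((n : ℝ) + 1) := by
      calc (n + 2) * (1 - Real.cos β) + 1 / (2 * (n + 2))
          ≤ (n + 2) * (10 / (n + 2) ^ 2 / 2) + 1 / (2 * (n + 2)) := by gcongr; linarith
        _ = (11 / 2) / ((n : ℝ) + 2) := by field_simp; ring
        _ ≤ 6 / ((n : ℝ) + 1) := by gcongr <;> norm_num
    calc _ ≤ L * (6 / ((n : ℝ) + 1)) := by gcongr
      _ = _ := by ring

/-- Jackson's theorem for `C^k` functions: the derivative is approximated by a polynomial, and the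
difference of `f` and an antiderivative of the latter has a small Lipschitz constant. -/
theorem exists_polynomial_near_of_contDiff (k : ℕ) :
    ∃ K : ℝ, 0 ≤ K ∧ ∀ (f : ℝ → ℝ) (M : ℝ), ContDiff ℝ k f →
      (∀ t ∈ Icc (-1 : ℝ) 1, |iteratedDeriv k f t| ≤ M) → ∀ n : ℕ, k ≤ n →
        ∃ p : ℝ[X], p.natDegree ≤ n ∧
          ∀ t ∈ Icc (-1 : ℝ) 1, |f t - p.eval t| ≤ K * M / n ^ k := by
  induction k with
  | zero =>
    refine ⟨1, zero_le_one, fun f M _ hM n _ => ⟨0, by simp, fun t ht => ?_⟩⟩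
    simpa using hM t ht
  | succ k ih =>
    obtain ⟨K, hK, ih⟩ := ih
    refine ⟨6 * K * 2 ^ k, by positivity, fun f M hf hM n hn => ?_⟩
    have hM0 : 0 ≤ M := (abs_nonneg _).trans (hM 0 (by norm_num))
    have hf' : ContDiff ℝ k (deriv f) := by
      have : ContDiff ℝ ((k : WithTop ℕ∞) + 1) f := by exact_mod_cast hf
      exact (contDiff_succ_iff_deriv.1 this).2.2
    have hfd : Differentiable ℝ f := hf.differentiable (by simp)
    obtain ⟨q, hq, hqe⟩ := ih (deriv f) M hf'
      (fun t ht => by rw [← iteratedDeriv_succ']; exact hM t ht) (n - 1) (by omega)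
    obtain ⟨Q, hQ, -, hQd⟩ := exists_derivative_eq q 0
    have hn1 : (1 : ℝ) ≤ n := by exact_mod_cast (by omega : 1 ≤ n)
    set L := K * M / ((n - 1 : ℕ) : ℝ) ^ k with hLdef
    have hL : 0 ≤ L := by positivity
    have hlip : ∀ x ∈ Icc (-1 : ℝ) 1, ∀ y ∈ Icc (-1 : ℝ) 1,
        |(f x - Q.eval x) - (f y - Q.eval y)| ≤ L * |x - y| := by
      intro x hx y hy
      refine Convex.norm_image_sub_le_of_norm_hasDerivWithin_le
        (f := fun t => f t - Q.eval t) (f' := fun t => deriv f t - q.eval t) (C := L)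
        (s := Icc (-1 : ℝ) 1) ?_ ?_ (convex_Icc _ _) hy hx
      · intro t _
        have h1 := Q.hasDerivAt t
        rw [hQ] at h1
        exact ((hfd t).hasDerivAt.sub h1).hasDerivWithinAt
      · intro t ht
        exact hqe t ht
    obtain ⟨p, hp, hpe⟩ := exists_polynomial_near_of_lipschitz hL hlip n
    refine ⟨p + Q, (natDegree_add_le _ _).trans (max_le hp (by omega)), fun t ht => ?_⟩
    have h1 := hpe t ht
    rw [eval_add, show f t - (p.eval t + Q.eval t) = f t - Q.eval t - p.eval t by ring]
    refine h1.trans ?_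
    have h2 : L ≤ K * M * 2 ^ k / n ^ k := by
      rcases Nat.eq_zero_or_pos k with rfl | hk
      · simp [hLdef]
      · have h3 : (n : ℝ) / 2 ≤ ((n - 1 : ℕ) : ℝ) := by
          have : 2 ≤ n := by omega
          have h4 : (2 : ℝ) ≤ n := by exact_mod_cast this
          rw [Nat.cast_sub (by omega)]
          push_cast
          linarith
        calc L ≤ K * M / ((n : ℝ) / 2) ^ k := by rw [hLdef]; gcongr
          _ = _ := by rw [div_pow]; field_simp
    calc 6 * L / (n + 1) ≤ 6 * (K * M * 2 ^ k / n ^ k) / n := by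
          gcongr
          linarith
      _ = _ := by rw [pow_succ]; field_simp

/-- Error of the Legendre–Gauss–Lobatto rule for a `C^k` function: the rule is exact for a
polynomial of degree at most `2 N - 1`, and its weights are nonnegative with sum `2`. -/
theorem exists_lgl_quadrature_error (k : ℕ) :
    ∃ K : ℝ, 0 ≤ K ∧ ∀ (f : ℝ → ℝ) (M : ℝ), ContDiff ℝ k f →
      (∀ t ∈ Icc (-1 : ℝ) 1, |iteratedDeriv k f t| ≤ M) → ∀ N : ℕ, 1 ≤ N → k ≤ N →
        |∑ j, f (lglNode N j) * lglWeight N j - ∫ t in (-1 : ℝ)..1, f t| ≤ K * M / N ^ k := by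
  obtain ⟨K, hK, h⟩ := exists_polynomial_near_of_contDiff k
  refine ⟨4 * K, by positivity, fun f M hf hM N hN hkN => ?_⟩
  obtain ⟨p, hp, hpe⟩ := h f M hf hM N hkN
  have hq := lgl_quadrature hN (p := p) (by omega)
  set ε := K * M / N ^ k
  have h1 : |∑ j, f (lglNode N j) * lglWeight N j - ∑ j, p.eval (lglNode N j) * lglWeight N j|
      ≤ ε * 2 := by
    rw [← Finset.sum_sub_distrib, ← sum_lglWeight hN, Finset.mul_sum]
    refine (Finset.abs_sum_le_sum_abs _ _).trans (Finset.sum_le_sum fun j _ => ?_)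
    rw [← sub_mul, abs_mul, abs_of_nonneg (lglWeight_nonneg N j)]
    exact mul_le_mul_of_nonneg_right (hpe _ (lglNode_mem_Icc hN j)) (lglWeight_nonneg N j)
  have h2 : |(∫ t in (-1 : ℝ)..1, f t) - ∫ t in (-1 : ℝ)..1, p.eval t| ≤ ε * 2 := by
    have hfc := hf.continuous
    rw [← intervalIntegral.integral_sub (hfc.intervalIntegrable _ _)
      (intervalIntegrable_eval _ _ _), ← Real.norm_eq_abs]
    refine (intervalIntegral.norm_integral_le_of_norm_le_const (C := ε) fun t ht => ?_).trans
      (le_of_eq (by norm_num))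
    rw [uIoc_of_le (by norm_num)] at ht
    exact hpe t (Ioc_subset_Icc_self ht)
  rw [hq] at h1
  have h3 : 4 * K * M / N ^ k = ε * 2 + ε * 2 := by simp only [ε]; ring
  rw [h3]
  rw [abs_le] at *
  constructor <;> linarith [h1.1, h1.2, h2.1, h2.2]

end PSOptimalControl

namespace PSOptimalControl

open Polynomial

/-! ### Decay of Legendre coefficients -/

theorem exists_monotoneOn_dominating {v : ℝ → ℝ} (hv : BoundedVariationOn v (Icc (-1 : ℝ) 1)) :
    IntervalIntegrable v volume (-1) 1 ∧ ∃ w : ℝ → ℝ,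
      ∀ s ∈ Icc (-1 : ℝ) 1, ∀ t ∈ Icc (-1 : ℝ) 1, s ≤ t → |v t - v s| ≤ w t - w s := by
  obtain ⟨p, q, hp, hq, rfl⟩ :=
    hv.locallyBoundedVariationOn.exists_monotoneOn_sub_monotoneOn
  have hu : uIcc (-1 : ℝ) 1 = Icc (-1) 1 := uIcc_of_le (by norm_num)
  refine ⟨(MonotoneOn.intervalIntegrable (hu ▸ hp)).sub (MonotoneOn.intervalIntegrable (hu ▸ hq)),
    fun t => p t + q t, fun s hs t ht hst => ?_⟩
  have h1 := hp hs ht hst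
  have h2 := hq hs ht hst
  rw [abs_le]
  constructor <;> simp only [Pi.sub_apply] <;> linarith

/-- If `v` has bounded variation, then `∫ v Ψ'` is at most the variation of `v` times the maximum
of `|Ψ|`, for a polynomial `Ψ` that vanishes at the endpoints. -/
theorem exists_abs_integral_mul_derivative_le {v : ℝ → ℝ}
    (hv : BoundedVariationOn v (Icc (-1 : ℝ) 1)) :
    ∃ V : ℝ, 0 ≤ V ∧ ∀ (Ψ : ℝ[X]) (M : ℝ), Ψ.eval (-1) = 0 → Ψ.eval 1 = 0 →
      (∀ t ∈ Icc (-1 : ℝ) 1, |Ψ.eval t| ≤ M) →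
      |∫ t in (-1 : ℝ)..1, v t * (derivative Ψ).eval t| ≤ V * M := by
  obtain ⟨hvi, w, hw⟩ := exists_monotoneOn_dominating hv
  have hm1 : (-1 : ℝ) ∈ Icc (-1 : ℝ) 1 := by norm_num
  have h1 : (1 : ℝ) ∈ Icc (-1 : ℝ) 1 := by norm_num
  have hV : 0 ≤ w 1 - w (-1) := (abs_nonneg _).trans (hw _ hm1 _ h1 (by norm_num))
  refine ⟨w 1 - w (-1), hV, fun Ψ M hΨ0 hΨ1 hM => ?_⟩
  obtain ⟨M', hM'⟩ := isCompact_Icc.exists_bound_of_continuousOn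
    (derivative Ψ).continuous.continuousOn (s := Icc (-1 : ℝ) 1)
  have hM'0 : 0 ≤ M' := (norm_nonneg _).trans (hM' _ h1)
  have hint : IntervalIntegrable (fun t => v t * (derivative Ψ).eval t) volume (-1) 1 :=
    hvi.mul_continuousOn (derivative Ψ).continuous.continuousOn
  -- the Riemann–Stieltjes sums on the partition into `n` intervals of length `2 / n`
  have key : ∀ n : ℕ, |∫ t in (-1 : ℝ)..1, v t * (derivative Ψ).eval t|
      ≤ (w 1 - w (-1)) * M + (w 1 - w (-1)) * M' * 2 * (1 / ((n : ℝ) + 1)) := by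
    intro n
    have hn : (0 : ℝ) < n + 1 := by positivity
    set τ : ℕ → ℝ := fun i => -1 + 2 * i / (n + 1) with hτ
    have hτ0 : τ 0 = -1 := by simp [hτ]
    have hτ1 : τ (n + 1) = 1 := by
      simp only [hτ]; push_cast; field_simp; norm_num
    have hτmem : ∀ i ≤ n + 1, τ i ∈ Icc (-1 : ℝ) 1 := by
      intro i hi
      have hi' : (i : ℝ) ≤ n + 1 := by exact_mod_cast hi
      constructor
      · simp only [hτ]
        have : 0 ≤ 2 * (i : ℝ) / (n + 1) := by positivity
        linarith
      · simp only [hτ]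
        have : 2 * (i : ℝ) / (n + 1) ≤ 2 := by rw [div_le_iff₀ hn]; linarith
        linarith
    have hτstep : ∀ i, τ (i + 1) - τ i = 2 / (n + 1) := by
      intro i; simp only [hτ]; push_cast; field_simp; ring
    have hτle : ∀ i, τ i ≤ τ (i + 1) := by
      intro i
      have := hτstep i
      have h2 : 0 < 2 / ((n : ℝ) + 1) := by positivity
      linarith
    have hsub : ∀ i < n + 1, Icc (τ i) (τ (i + 1)) ⊆ Icc (-1 : ℝ) 1 := fun i hi =>
      Icc_subset_Icc (hτmem i (by omega)).1 (hτmem (i + 1) (by omega)).2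
    have hpiece : ∀ i < n + 1, |(∫ t in τ i..τ (i + 1), v t * (derivative Ψ).eval t)
        - (v (τ (i + 1)) * Ψ.eval (τ (i + 1)) - v (τ i) * Ψ.eval (τ i))|
        ≤ (w (τ (i + 1)) - w (τ i)) * (M + M' * (2 / (n + 1))) := by
      intro i hi
      have hs := hτmem i (by omega)
      have he := hτmem (i + 1) (by omega)
      have hle := hτle i
      have hvi' : IntervalIntegrable v volume (τ i) (τ (i + 1)) := by
        refine hvi.mono_set ?_
        rw [uIcc_of_le hle, uIcc_of_le (by norm_num)]
        exact hsub i hi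
      have hΨi := intervalIntegrable_eval (derivative Ψ) (τ i) (τ (i + 1))
      have e1 : (∫ t in τ i..τ (i + 1), v t * (derivative Ψ).eval t)
          = (∫ t in τ i..τ (i + 1), (v t - v (τ i)) * (derivative Ψ).eval t)
            + v (τ i) * (Ψ.eval (τ (i + 1)) - Ψ.eval (τ i)) := by
        rw [← integral_derivative_eval, ← intervalIntegral.integral_const_mul,
          ← intervalIntegral.integral_add]
        · refine intervalIntegral.integral_congr fun t _ => ?_
          ring
        · exact (hvi'.sub (by simp)).mul_continuousOn (derivative Ψ).continuous.continuousOn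
        · exact hΨi.const_mul _
      have e2 : |∫ t in τ i..τ (i + 1), (v t - v (τ i)) * (derivative Ψ).eval t|
          ≤ (w (τ (i + 1)) - w (τ i)) * M' * (2 / (n + 1)) := by
        have := intervalIntegral.norm_integral_le_of_norm_le_const (a := τ i) (b := τ (i + 1))
          (f := fun t => (v t - v (τ i)) * (derivative Ψ).eval t)
          (C := (w (τ (i + 1)) - w (τ i)) * M') (fun t ht => ?_)
        · rwa [hτstep, abs_of_pos (by positivity)] at this
        · rw [uIoc_of_le hle] at ht
          have ht' := hsub i hi (Ioc_subset_Icc_self ht)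
          have a1 := hw _ hs _ ht' ht.1.le
          have a2 := hw _ ht' _ he ht.2
          have a3 : |v t - v (τ i)| ≤ w (τ (i + 1)) - w (τ i) := by
            linarith [abs_nonneg (v (τ (i + 1)) - v t)]
          rw [norm_mul]
          exact mul_le_mul a3 (hM' t ht') (norm_nonneg _) ((abs_nonneg _).trans a3)
      have e3 : |Ψ.eval (τ (i + 1)) * (v (τ (i + 1)) - v (τ i))|
          ≤ M * (w (τ (i + 1)) - w (τ i)) := by
        rw [abs_mul]
        exact mul_le_mul (hM _ he) (hw _ hs _ he hle) (abs_nonneg _)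
          ((abs_nonneg _).trans (hM _ he))
      rw [e1]
      rw [abs_le] at e2 e3 ⊢
      constructor <;> nlinarith [e2.1, e2.2, e3.1, e3.2]
    have hsum := intervalIntegral.sum_integral_adjacent_intervals (a := τ) (n := n + 1)
      (μ := volume) (f := fun t => v t * (derivative Ψ).eval t) (fun i hi => by
        refine hint.mono_set ?_
        rw [uIcc_of_le (hτle i), uIcc_of_le (by norm_num)]
        exact hsub i hi)
    have htel := Finset.sum_range_sub (fun i => v (τ i) * Ψ.eval (τ i)) (n + 1)
    rw [hτ0, hτ1, hΨ0, hΨ1, mul_zero, mul_zero, sub_zero] at htel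
    have htw := Finset.sum_range_sub (fun i => w (τ i)) (n + 1)
    rw [hτ0, hτ1] at hsum htw
    calc |∫ t in (-1 : ℝ)..1, v t * (derivative Ψ).eval t|
        = |∑ i ∈ Finset.range (n + 1), ((∫ t in τ i..τ (i + 1), v t * (derivative Ψ).eval t)
          - (v (τ (i + 1)) * Ψ.eval (τ (i + 1)) - v (τ i) * Ψ.eval (τ i)))| := by
          rw [Finset.sum_sub_distrib, hsum, htel, sub_zero]
      _ ≤ ∑ i ∈ Finset.range (n + 1), (w (τ (i + 1)) - w (τ i)) * (M + M' * (2 / (n + 1))) :=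
          (Finset.abs_sum_le_sum_abs _ _).trans
            (Finset.sum_le_sum fun i hi => hpiece i (Finset.mem_range.1 hi))
      _ = _ := by rw [← Finset.sum_mul, htw]; ring
  refine ge_of_tendsto (x := Filter.atTop) (f := fun n : ℕ =>
    (w 1 - w (-1)) * M + (w 1 - w (-1)) * M' * 2 * (1 / ((n : ℝ) + 1))) ?_
    (Filter.Eventually.of_forall key)
  have h := (tendsto_one_div_add_atTop_nhds_zero_nat (𝕜 := ℝ)).const_mul
    ((w 1 - w (-1)) * M' * 2)
  simpa using h.const_add ((w 1 - w (-1)) * M)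

theorem derivative_legendre_add_two_sub (n : ℕ) :
    derivative (legendre (n + 2) - legendre n) = C (2 * (n : ℝ) + 3) * legendre (n + 1) := by
  have e2 : (C 2 : ℝ[X]) = 2 := rfl
  have e3 : (C 3 : ℝ[X]) = 3 := rfl
  rw [derivative_sub, derivative_legendre_add_two]
  simp [e2, e3]

theorem legendreCoeff_succ_eq (v : ℝ → ℝ) (n : ℕ) : legendreCoeff v (n + 1) =
    1 / 2 * ∫ t in (-1 : ℝ)..1, v t * (derivative (legendre (n + 2) - legendre n)).eval t := by
  rw [derivative_legendre_add_two_sub, legendreCoeff]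
  have : ∀ t, v t * (C (2 * (n : ℝ) + 3) * legendre (n + 1)).eval t
      = (2 * (n : ℝ) + 3) * (v t * (legendre (n + 1)).eval t) := by
    intro t; rw [eval_C_mul]; ring
  simp only [this]
  rw [intervalIntegral.integral_const_mul]
  push_cast
  ring

theorem legendre_add_two_sub_eval_one (n : ℕ) : (legendre (n + 2) - legendre n).eval 1 = 0 := by
  simp [legendre_eval_one]

theorem legendre_add_two_sub_eval_neg_one (n : ℕ) :
    (legendre (n + 2) - legendre n).eval (-1) = 0 := by
  simp [legendre_eval_neg_one, pow_add]

/-- `L_n` is, up to the factor `2 n + 1`, the derivative of `L_{n+1} - L_{n-1}`, which vanishes at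
the endpoints and is `O(n^{-1/2})`. -/
theorem exists_abs_legendreCoeff_le_of_boundedVariationOn {v : ℝ → ℝ}
    (hv : BoundedVariationOn v (Icc (-1 : ℝ) 1)) :
    ∃ K : ℝ, 0 ≤ K ∧ ∀ n : ℕ, 1 ≤ n → |legendreCoeff v n| ≤ K / √n := by
  obtain ⟨V, hV, h⟩ := exists_abs_integral_mul_derivative_le hv
  refine ⟨V, hV, fun n hn => ?_⟩
  obtain ⟨n, rfl⟩ : ∃ k, n = k + 1 := ⟨n - 1, by omega⟩
  have := h (legendre (n + 2) - legendre n) (2 / √(n + 1)) (legendre_add_two_sub_eval_neg_one n)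
    (legendre_add_two_sub_eval_one n) (fun t ht => by
      rw [eval_sub]; exact abs_legendre_add_two_sub_le n ht)
  rw [legendreCoeff_succ_eq, abs_mul, abs_of_pos (by norm_num : (0 : ℝ) < 1 / 2)]
  push_cast
  calc _ ≤ 1 / 2 * (V * (2 / √(n + 1))) := by gcongr
    _ = _ := by ring

/-- Integration by parts for a primitive of an integrable function. -/
theorem integral_primitive_mul_eq {v Φ Φ' : ℝ → ℝ} (hv : IntervalIntegrable v volume (-1) 1)
    (hΦ : ∀ t, HasDerivAt Φ (Φ' t) t) (hΦ' : Continuous Φ') (c : ℝ) :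
    ∫ t in (-1 : ℝ)..1, (c + ∫ s in (-1 : ℝ)..t, v s) * Φ' t
      = (c + ∫ s in (-1 : ℝ)..1, v s) * Φ 1 - c * Φ (-1) - ∫ t in (-1 : ℝ)..1, v t * Φ t := by
  have hd : deriv Φ = Φ' := funext fun t => (hΦ t).deriv
  have hac : AbsolutelyContinuousOnInterval (fun t => ∫ s in (-1 : ℝ)..t, v s) (-1) 1 :=
    hv.absolutelyContinuousOnInterval_intervalIntegral (by simp)
  have hΦac : AbsolutelyContinuousOnInterval Φ (-1) 1 := by
    refine ContDiffOn.absolutelyContinuousOnInterval (ContDiff.contDiffOn ?_)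
    rw [contDiff_one_iff_deriv, hd]
    exact ⟨fun t => (hΦ t).differentiableAt, hΦ'⟩
  have h1 := hac.integral_mul_deriv_eq_deriv_mul hΦac
  rw [hd] at h1
  have h2 : ∫ t in (-1 : ℝ)..1, deriv (fun t => ∫ s in (-1 : ℝ)..t, v s) t * Φ t
      = ∫ t in (-1 : ℝ)..1, v t * Φ t := by
    refine intervalIntegral.integral_congr_ae ?_
    filter_upwards [hv.ae_hasDerivAt_integral] with t ht hmem
    rw [(ht (uIoc_subset_uIcc hmem) (-1) (by simp)).deriv]
  have h3 : ∫ t in (-1 : ℝ)..1, Φ' t = Φ 1 - Φ (-1) :=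
    intervalIntegral.integral_eq_sub_of_hasDerivAt (fun t _ => hΦ t) (hΦ'.intervalIntegrable _ _)
  simp only [add_mul]
  rw [intervalIntegral.integral_add ((hΦ'.intervalIntegrable _ _).const_mul c)
    (by exact (hac.continuousOn.mul hΦ'.continuousOn).intervalIntegrable),
    intervalIntegral.integral_const_mul, h1, h2, h3]
  simp
  ring

/-- One integration raises the order of decay of the Legendre coefficients by one. -/
theorem exists_abs_legendreCoeff_primitive_le {v z : ℝ → ℝ} {c : ℝ} {q : ℕ}
    (hv : IntervalIntegrable v volume (-1) 1)
    (hz : ∀ t ∈ Icc (-1 : ℝ) 1, z t = c + ∫ s in (-1 : ℝ)..t, v s)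
    (hd : ∃ K : ℝ, 0 ≤ K ∧ ∀ n : ℕ, 1 ≤ n → |legendreCoeff v n| ≤ K / (n ^ q * √n)) :
    ∃ K : ℝ, 0 ≤ K ∧ ∀ n : ℕ, 1 ≤ n → |legendreCoeff z n| ≤ K / (n ^ (q + 1) * √n) := by
  obtain ⟨K, hK, hd⟩ := hd
  have hrec : ∀ n : ℕ, legendreCoeff z (n + 1) =
      1 / 2 * (legendreCoeff v n / (n + 1 / 2) - legendreCoeff v (n + 2) / (n + 2 + 1 / 2)) := by
    intro n
    have h1 := integral_primitive_mul_eq hv (fun t => (legendre (n + 2) - legendre n).hasDerivAt t)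
      (derivative _).continuous c
    rw [legendre_add_two_sub_eval_one, legendre_add_two_sub_eval_neg_one] at h1
    have h2 : ∫ t in (-1 : ℝ)..1, z t * (derivative (legendre (n + 2) - legendre n)).eval t
        = ∫ t in (-1 : ℝ)..1, (c + ∫ s in (-1 : ℝ)..t, v s)
          * (derivative (legendre (n + 2) - legendre n)).eval t := by
      refine intervalIntegral.integral_congr fun t ht => ?_
      rw [uIcc_of_le (by norm_num)] at ht
      simp only [hz t ht]
    have hvL : ∀ k, IntervalIntegrable (fun t => v t * (legendre k).eval t) volume (-1) 1 :=
      fun k => hv.mul_continuousOn (legendre k).continuous.continuousOn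
    have h3 : ∫ t in (-1 : ℝ)..1, v t * (legendre (n + 2) - legendre n).eval t
        = (∫ t in (-1 : ℝ)..1, v t * (legendre (n + 2)).eval t)
          - ∫ t in (-1 : ℝ)..1, v t * (legendre n).eval t := by
      rw [← intervalIntegral.integral_sub (hvL _) (hvL _)]
      refine intervalIntegral.integral_congr fun t _ => ?_
      simp only [eval_sub]
      ring
    rw [legendreCoeff_succ_eq, h2, h1, h3, legendreCoeff, legendreCoeff]
    push_cast
    have a1 : (n : ℝ) + 1 / 2 ≠ 0 := by positivity
    have a2 : (n : ℝ) + 2 + 1 / 2 ≠ 0 := by positivity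
    rw [mul_div_cancel_left₀ _ a1, mul_div_cancel_left₀ _ a2]
    ring
  refine ⟨|legendreCoeff z 1| + K * 2 ^ (q + 2), by positivity, fun n hn => ?_⟩
  obtain ⟨n, rfl⟩ : ∃ k, n = k + 1 := ⟨n - 1, by omega⟩
  rcases Nat.eq_zero_or_pos n with rfl | hn0
  · simp
    positivity
  · have hnp : (0 : ℝ) < n := by exact_mod_cast hn0
    have hn1 : (1 : ℝ) ≤ n := by exact_mod_cast hn0
    have b1 : |legendreCoeff v n / (n + 1 / 2)| ≤ K / (n ^ (q + 1) * √n) := by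
      rw [abs_div, abs_of_pos (by positivity : (0 : ℝ) < n + 1 / 2)]
      calc _ ≤ K / (n ^ q * √n) / n := by
            gcongr
            · exact hd n hn0
            · linarith
        _ = _ := by rw [pow_succ]; field_simp
    have b2 : |legendreCoeff v (n + 2) / (n + 2 + 1 / 2)| ≤ K / (n ^ (q + 1) * √n) := by
      rw [abs_div, abs_of_pos (by positivity : (0 : ℝ) < n + 2 + 1 / 2)]
      have := hd (n + 2) (by omega)
      push_cast at this
      calc _ ≤ K / (n ^ q * √n) / n := by
            gcongr
            · refine this.trans ?_
              gcongr <;> linarith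
            · linarith
        _ = _ := by rw [pow_succ]; field_simp
    have b3 : |legendreCoeff z (n + 1)| ≤ K / (n ^ (q + 1) * √n) := by
      rw [hrec, abs_mul, abs_of_pos (by norm_num : (0 : ℝ) < 1 / 2)]
      have := abs_sub (legendreCoeff v n / (n + 1 / 2)) (legendreCoeff v (n + 2) / (n + 2 + 1 / 2))
      linarith
    refine b3.trans ?_
    push_cast
    have hs : √((n : ℝ) + 1) ≤ 2 * √n := by
      rw [Real.sqrt_le_left (by positivity), mul_pow, Real.sq_sqrt hnp.le]
      linarith
    rw [div_le_div_iff₀ (by positivity) (by positivity)]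
    calc K * (((n : ℝ) + 1) ^ (q + 1) * √(n + 1))
        ≤ K * ((2 * n) ^ (q + 1) * (2 * √n)) := by gcongr; linarith
      _ = K * 2 ^ (q + 2) * (n ^ (q + 1) * √n) := by rw [mul_pow]; ring
      _ ≤ _ := by gcongr; linarith [abs_nonneg (legendreCoeff z 1)]

/-- Decay of the coefficients of a function whose derivative of order `q` is the primitive of a
function of bounded variation. -/
theorem exists_abs_legendreCoeff_le {v : ℝ → ℝ} (hv : BoundedVariationOn v (Icc (-1 : ℝ) 1))
    (c : ℝ) (q : ℕ) {z : ℝ → ℝ} (hz : ContDiff ℝ q z)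
    (hzq : ∀ t ∈ Icc (-1 : ℝ) 1, iteratedDeriv q z t = c + ∫ s in (-1 : ℝ)..t, v s) :
    ∃ K : ℝ, 0 ≤ K ∧ ∀ n : ℕ, 1 ≤ n → |legendreCoeff z n| ≤ K / (n ^ (q + 1) * √n) := by
  induction q generalizing z with
  | zero =>
    refine exists_abs_legendreCoeff_primitive_le (exists_monotoneOn_dominating hv).1
      (by simpa using hzq) ?_
    simpa using exists_abs_legendreCoeff_le_of_boundedVariationOn hv
  | succ q ih =>
    have hz' : ContDiff ℝ q (deriv z) := by
      have : ContDiff ℝ ((q : WithTop ℕ∞) + 1) z := by exact_mod_cast hz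
      exact (contDiff_succ_iff_deriv.1 this).2.2
    have hzd : Differentiable ℝ z := hz.differentiable (by simp)
    refine exists_abs_legendreCoeff_primitive_le (v := deriv z) (c := z (-1))
      (hz'.continuous.intervalIntegrable _ _) (fun t _ => ?_)
      (ih hz' fun t ht => by rw [← iteratedDeriv_succ']; exact hzq t ht)
    rw [intervalIntegral.integral_deriv_eq_sub (fun x _ => hzd x)
      (hz'.continuous.intervalIntegrable _ _)]
    ring

/-! ### Uniform convergence of Legendre series -/

/-- Completeness of the Legendre polynomials, by Weierstrass's theorem. -/
theorem eq_zero_of_legendreCoeff_eq_zero {w : ℝ → ℝ} (hw : ContinuousOn w (Icc (-1 : ℝ) 1))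
    (h : ∀ n, ∫ t in (-1 : ℝ)..1, w t * (legendre n).eval t = 0) :
    ∀ t ∈ Icc (-1 : ℝ) 1, w t = 0 := by
  have hu : uIcc (-1 : ℝ) 1 = Icc (-1) 1 := uIcc_of_le (by norm_num)
  have hwi : IntervalIntegrable w volume (-1) 1 := (hu ▸ hw).intervalIntegrable
  have hpoly : ∀ p : ℝ[X], ∫ t in (-1 : ℝ)..1, w t * p.eval t = 0 := by
    intro p
    obtain ⟨c, hc⟩ := exists_eq_sum_legendre _ p le_rfl
    have h1 : ∀ t, w t * p.eval t = ∑ k ∈ Finset.range (p.natDegree + 1),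
        c k * (w t * (legendre k).eval t) := by
      intro t
      conv_lhs => rw [hc]
      simp only [eval_finsetSum, eval_C_mul, Finset.mul_sum]
      exact Finset.sum_congr rfl fun _ _ => by ring
    simp only [h1]
    rw [intervalIntegral.integral_finsetSum fun k _ =>
      (hwi.mul_continuousOn (legendre k).continuous.continuousOn).const_mul _]
    refine Finset.sum_eq_zero fun k _ => ?_
    rw [intervalIntegral.integral_const_mul, h, mul_zero]
  by_contra hcon
  push Not at hcon
  obtain ⟨t0, ht0, hne⟩ := hcon
  have hI : 0 < ∫ t in (-1 : ℝ)..1, w t ^ 2 :=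
    intervalIntegral.integral_pos (by norm_num) (hw.pow 2) (fun t _ => sq_nonneg _)
      ⟨t0, ht0, by positivity⟩
  obtain ⟨B, hB⟩ := isCompact_Icc.exists_bound_of_continuousOn hw
  have hB0 : 0 ≤ B := (norm_nonneg _).trans (hB t0 ht0)
  set I := ∫ t in (-1 : ℝ)..1, w t ^ 2 with hIdef
  obtain ⟨p, hp⟩ := exists_polynomial_near_of_continuousOn (-1) 1 w hw (I / (4 * (B + 1)))
    (by positivity)
  have h1 : I = ∫ t in (-1 : ℝ)..1, w t * (w t - p.eval t) := by
    have : ∀ t, w t * (w t - p.eval t) = w t ^ 2 - w t * p.eval t := fun t => by ring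
    simp only [this]
    rw [intervalIntegral.integral_sub (hu ▸ hw.pow 2).intervalIntegrable
      (hwi.mul_continuousOn p.continuous.continuousOn), hpoly, sub_zero]
  have h2 : |∫ t in (-1 : ℝ)..1, w t * (w t - p.eval t)| ≤ B * (I / (4 * (B + 1))) * 2 := by
    have := intervalIntegral.norm_integral_le_of_norm_le_const (a := (-1 : ℝ)) (b := 1)
      (f := fun t => w t * (w t - p.eval t)) (C := B * (I / (4 * (B + 1)))) (fun t ht => ?_)
    · norm_num at this
      exact this
    · rw [uIoc_of_le (by norm_num)] at ht
      have ht' := Ioc_subset_Icc_self ht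
      rw [norm_mul]
      refine mul_le_mul (hB t ht') ?_ (norm_nonneg _) hB0
      rw [Real.norm_eq_abs, abs_sub_comm]
      exact (hp t ht').le
  rw [← h1, abs_of_pos hI] at h2
  have h3 : B * (I / (4 * (B + 1))) * 2 = I * (B / (2 * (B + 1))) := by field_simp; ring
  have h4 : B / (2 * (B + 1)) < 1 := by rw [div_lt_one (by positivity)]; linarith
  rw [h3] at h2
  nlinarith

theorem one_div_mul_sqrt_le (n : ℕ) (hn : 1 ≤ n) :
    1 / (((n + 1 : ℕ) : ℝ) * √((n + 1 : ℕ) : ℝ)) ≤ 2 * (1 / √n - 1 / √((n + 1 : ℕ) : ℝ)) := by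
  have hn0 : (0 : ℝ) < n := by exact_mod_cast hn
  have ha : 0 < √(n : ℝ) := Real.sqrt_pos.2 hn0
  have hb : 0 < √((n + 1 : ℕ) : ℝ) := Real.sqrt_pos.2 (by positivity)
  have ha2 : √(n : ℝ) ^ 2 = n := Real.sq_sqrt hn0.le
  have hb2 : √((n + 1 : ℕ) : ℝ) ^ 2 = n + 1 := by rw [Real.sq_sqrt (by positivity)]; push_cast; ring
  have hab : √(n : ℝ) ≤ √((n + 1 : ℕ) : ℝ) := Real.sqrt_le_sqrt (by push_cast; linarith)
  have hcast : ((n + 1 : ℕ) : ℝ) = √((n + 1 : ℕ) : ℝ) ^ 2 := by rw [hb2]; push_cast; ring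
  set a := √(n : ℝ)
  set b := √((n + 1 : ℕ) : ℝ)
  rw [hcast]
  -- `b - a = 1 / (a + b) ≥ 1 / (2 b)`
  have h1 : (b - a) * (b + a) = 1 := by linear_combination hb2 - ha2
  have h2 : 1 ≤ 2 * b * (b - a) := by nlinarith
  rw [div_sub_div _ _ ha.ne' hb.ne', ← mul_div_assoc, div_le_div_iff₀ (by positivity)
    (by positivity)]
  have h3 : a * b ≤ b ^ 2 := by nlinarith
  calc 1 * (a * b) ≤ b ^ 2 * 1 := by linarith
    _ ≤ b ^ 2 * (2 * b * (b - a)) := by gcongr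
    _ = _ := by ring

/-- The tail of the Legendre series of a function whose coefficients are `O(n^{-q-3/2})`: the tail
of the absolutely convergent series is `O(M^{-q-1/2})`, and the sum is `z` by completeness. -/
theorem exists_legendre_series_error {z : ℝ → ℝ} (hz : Continuous z) {q : ℕ}
    (hd : ∃ K : ℝ, 0 ≤ K ∧ ∀ n : ℕ, 1 ≤ n → |legendreCoeff z n| ≤ K / (n ^ (q + 1) * √n)) :
    ∃ K : ℝ, 0 ≤ K ∧
      (∀ M : ℕ, ∑ n ∈ Finset.range M, |legendreCoeff z n| ≤ K) ∧
      ∀ M : ℕ, 1 ≤ M → ∀ t ∈ Icc (-1 : ℝ) 1,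
        |z t - ∑ n ∈ Finset.range (M + 1), legendreCoeff z n * (legendre n).eval t|
          ≤ K / (M ^ q * √M) := by
  obtain ⟨K, hK, hd⟩ := hd
  set a := legendreCoeff z with ha
  have hstep : ∀ M : ℕ, 1 ≤ M → ∀ n, M ≤ n →
      |a (n + 1)| ≤ 2 * K / M ^ q * (1 / √n - 1 / √((n + 1 : ℕ) : ℝ)) := by
    intro M hM n hn
    have hM0 : (0 : ℝ) < M := by exact_mod_cast hM
    have hMn : (M : ℝ) ≤ ((n + 1 : ℕ) : ℝ) := by exact_mod_cast (by omega : M ≤ n + 1)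
    have hn1 : (0 : ℝ) < ((n + 1 : ℕ) : ℝ) := by positivity
    calc |a (n + 1)| ≤ K / (((n + 1 : ℕ) : ℝ) ^ (q + 1) * √((n + 1 : ℕ) : ℝ)) := hd _ (by omega)
      _ = K / ((n + 1 : ℕ) : ℝ) ^ q * (1 / (((n + 1 : ℕ) : ℝ) * √((n + 1 : ℕ) : ℝ))) := by
          rw [pow_succ]; field_simp
      _ ≤ K / M ^ q * (2 * (1 / √n - 1 / √((n + 1 : ℕ) : ℝ))) := by
          refine mul_le_mul ?_ (one_div_mul_sqrt_le n (by omega)) (by positivity) (by positivity)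
          gcongr
      _ = _ := by ring
  have htail : ∀ M : ℕ, 1 ≤ M → ∀ j : ℕ, ∑ i ∈ Finset.range j, |a (M + i + 1)|
      ≤ 2 * K / (M ^ q * √M) := by
    intro M hM j
    have hM0 : (0 : ℝ) < M := by exact_mod_cast hM
    calc ∑ i ∈ Finset.range j, |a (M + i + 1)|
        ≤ ∑ i ∈ Finset.range j, 2 * K / M ^ q *
          (1 / √((M + i : ℕ) : ℝ) - 1 / √((M + (i + 1) : ℕ) : ℝ)) :=
          Finset.sum_le_sum fun i _ => hstep M hM (M + i) (by omega)
      _ = 2 * K / M ^ q * (1 / √(M : ℝ) - 1 / √((M + j : ℕ) : ℝ)) := by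
          rw [← Finset.mul_sum, Finset.sum_range_sub' (fun i => 1 / √((M + i : ℕ) : ℝ)), add_zero]
      _ ≤ 2 * K / M ^ q * (1 / √(M : ℝ)) := by
          gcongr
          have : 0 ≤ 1 / √((M + j : ℕ) : ℝ) := by positivity
          linarith
      _ = _ := by field_simp
  have hbd : ∀ M : ℕ, ∑ n ∈ Finset.range M, |a n| ≤ |a 0| + |a 1| + 2 * K := by
    intro M
    calc ∑ n ∈ Finset.range M, |a n| ≤ ∑ n ∈ Finset.range (M + 1 + 1), |a n| :=
          Finset.sum_le_sum_of_subset_of_nonneg (Finset.range_mono (by omega))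
            fun _ _ _ => abs_nonneg _
      _ = (∑ i ∈ Finset.range M, |a (1 + i + 1)|) + |a 1| + |a 0| := by
          rw [Finset.sum_range_succ', Finset.sum_range_succ']
          simp only [add_comm 1, zero_add]
      _ ≤ _ := by
          have := htail 1 le_rfl M
          simp at this
          linarith
  have hsum : Summable fun n => |a n| := summable_of_sum_range_le (fun _ => abs_nonneg _) hbd
  have hterm : ∀ n, ∀ t ∈ Icc (-1 : ℝ) 1, ‖a n * (legendre n).eval t‖ ≤ |a n| := by
    intro n t ht
    rw [norm_mul]
    exact mul_le_of_le_one_right (abs_nonneg _) (abs_legendre_eval_le_one n ht)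
  have hS : ∀ t ∈ Icc (-1 : ℝ) 1, Summable fun n => a n * (legendre n).eval t :=
    fun t ht => Summable.of_norm_bounded hsum fun n => hterm n t ht
  set S : ℝ → ℝ := fun t => ∑' n, a n * (legendre n).eval t with hSdef
  have hScont : ContinuousOn S (Icc (-1 : ℝ) 1) :=
    continuousOn_tsum (fun n => (continuous_const.mul (legendre n).continuous).continuousOn)
      hsum hterm
  have hu : uIcc (-1 : ℝ) 1 = Icc (-1) 1 := uIcc_of_le (by norm_num)
  have hzS : ∀ t ∈ Icc (-1 : ℝ) 1, z t - S t = 0 := by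
    refine eq_zero_of_legendreCoeff_eq_zero (hz.continuousOn.sub hScont) fun k => ?_
    have h1 : HasSum (fun n => ∫ t in (-1 : ℝ)..1, a n * (legendre n).eval t * (legendre k).eval t)
        (∫ t in (-1 : ℝ)..1, S t * (legendre k).eval t) := by
      refine intervalIntegral.hasSum_integral_of_dominated_convergence (fun n _ => |a n|)
        (fun n => ((continuous_const.mul (legendre n).continuous).mul
          (legendre k).continuous).aestronglyMeasurable) (fun n => ?_) ?_ (by simp) ?_
      · refine Filter.Eventually.of_forall fun t ht => ?_
        rw [uIoc_of_le (by norm_num)] at ht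
        have ht' := Ioc_subset_Icc_self ht
        rw [norm_mul]
        exact (mul_le_of_le_one_right (norm_nonneg _) (abs_legendre_eval_le_one k ht')).trans
          (hterm n t ht')
      · exact Filter.Eventually.of_forall fun _ _ => hsum
      · refine Filter.Eventually.of_forall fun t ht => ?_
        rw [uIoc_of_le (by norm_num)] at ht
        exact (hS t (Ioc_subset_Icc_self ht)).hasSum.mul_right _
    have h2 : ∀ n, n ≠ k →
        ∫ t in (-1 : ℝ)..1, a n * (legendre n).eval t * (legendre k).eval t = 0 := by
      intro n hn
      have := integral_legendre_mul_legendre_of_ne hn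
      simp only [eval_mul] at this
      simp only [mul_assoc, intervalIntegral.integral_const_mul, this, mul_zero]
    have h3 := h1.unique (hasSum_single k h2)
    have h4 : ∫ t in (-1 : ℝ)..1, a k * (legendre k).eval t * (legendre k).eval t
        = ∫ t in (-1 : ℝ)..1, z t * (legendre k).eval t := by
      have := integral_legendre_sq k
      simp only [eval_mul] at this
      simp only [mul_assoc, intervalIntegral.integral_const_mul, this]
      rw [ha, legendreCoeff]
      have : (0 : ℝ) < 2 * k + 1 := by positivity
      field_simp
    simp only [sub_mul]
    rw [intervalIntegral.integral_sub, h3, h4, sub_self]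
    · exact (hz.mul (legendre k).continuous).intervalIntegrable _ _
    · exact (hu ▸ hScont.mul (legendre k).continuous.continuousOn).intervalIntegrable
  refine ⟨|a 0| + |a 1| + 2 * K, by positivity, hbd, fun M hM t ht => ?_⟩
  have hM0 : (0 : ℝ) < M := by exact_mod_cast hM
  have hlim : Filter.Tendsto (fun j => |(∑ n ∈ Finset.range (j + (M + 1)),
      a n * (legendre n).eval t) - ∑ n ∈ Finset.range (M + 1), a n * (legendre n).eval t|)
      Filter.atTop (nhds |z t - ∑ n ∈ Finset.range (M + 1), a n * (legendre n).eval t|) := by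
    have h1 := (hS t ht).hasSum.tendsto_sum_nat
    rw [show ∑' n, a n * (legendre n).eval t = z t by linarith [hzS t ht]] at h1
    exact (((Filter.tendsto_add_atTop_iff_nat (M + 1)).2 h1).sub_const _).abs
  refine le_of_tendsto' hlim fun j => ?_
  rw [add_comm j, Finset.sum_range_add, add_sub_cancel_left]
  refine (Finset.abs_sum_le_sum_abs _ _).trans ?_
  calc ∑ i ∈ Finset.range j, |a (M + 1 + i) * (legendre (M + 1 + i)).eval t|
      ≤ ∑ i ∈ Finset.range j, |a (M + i + 1)| := by
        refine Finset.sum_le_sum fun i _ => ?_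
        rw [show M + 1 + i = M + i + 1 by ring]
        exact hterm _ t ht
    _ ≤ 2 * K / (M ^ q * √M) := htail M hM j
    _ ≤ _ := by
        gcongr
        have := abs_nonneg (a 0)
        have := abs_nonneg (a 1)
        linarith

end PSOptimalControl

namespace PSOptimalControl

/-! ### Weak derivatives -/

/-- Smooth functions with compact support in `(-1, 1)`. -/
structure IsTestFunction (φ : ℝ → ℝ) : Prop where
  contDiff : ContDiff ℝ ∞ φ
  hasCompactSupport : HasCompactSupport φ
  tsupport_subset : tsupport φ ⊆ Ioo (-1 : ℝ) 1

namespace IsTestFunction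

variable {φ ψ : ℝ → ℝ}

theorem eq_zero_of_notMem (hφ : IsTestFunction φ) {t : ℝ} (ht : t ∉ Ioo (-1 : ℝ) 1) : φ t = 0 :=
  image_eq_zero_of_notMem_tsupport fun h => ht (hφ.tsupport_subset h)

theorem continuous (hφ : IsTestFunction φ) : Continuous φ := hφ.contDiff.continuous

theorem sub_const_mul (hφ : IsTestFunction φ) (hψ : IsTestFunction ψ) (c : ℝ) :
    IsTestFunction fun t => φ t - c * ψ t where
  contDiff := hφ.contDiff.sub (contDiff_const.mul hψ.contDiff)
  hasCompactSupport := hφ.hasCompactSupport.sub hψ.hasCompactSupport.mul_left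
  tsupport_subset := by
    refine (tsupport_sub _ _).trans (union_subset hφ.tsupport_subset ?_)
    exact (tsupport_mul_subset_right).trans hψ.tsupport_subset

theorem exists_integral_eq_one :
    ∃ ψ : ℝ → ℝ, IsTestFunction ψ ∧ ∫ t in (-1 : ℝ)..1, ψ t = 1 := by
  let b : ContDiffBump (0 : ℝ) := ⟨1 / 4, 1 / 2, by norm_num, by norm_num⟩
  have hb : IsTestFunction b := by
    refine ⟨b.contDiff, b.hasCompactSupport, ?_⟩
    rw [b.tsupport_eq, Real.closedBall_eq_Icc]
    intro t ht
    have h1 : b.rOut = 1 / 2 := rfl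
    rw [h1] at ht
    exact ⟨by linarith [ht.1], by linarith [ht.2]⟩
  have hI : 0 < ∫ t in (-1 : ℝ)..1, b t := by
    refine intervalIntegral.integral_pos (by norm_num) hb.continuous.continuousOn
      (fun t _ => b.nonneg) ⟨0, by norm_num, ?_⟩
    rw [b.one_of_mem_closedBall (by simp [b.rIn_pos.le])]
    exact one_pos
  refine ⟨fun t => (∫ t in (-1 : ℝ)..1, b t)⁻¹ * b t, ⟨?_, ?_, ?_⟩, ?_⟩
  · exact contDiff_const.mul hb.contDiff
  · exact hb.hasCompactSupport.mul_left
  · exact (tsupport_mul_subset_right).trans hb.tsupport_subset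
  · rw [intervalIntegral.integral_const_mul, inv_mul_cancel₀ hI.ne']

/-- A test function with vanishing integral is the derivative of a test function. -/
theorem primitive (hφ : IsTestFunction φ) (h0 : ∫ t in (-1 : ℝ)..1, φ t = 0) :
    IsTestFunction (fun t => ∫ s in (-1 : ℝ)..t, φ s) ∧
      deriv (fun t => ∫ s in (-1 : ℝ)..t, φ s) = φ := by
  have hd : ∀ t, HasDerivAt (fun t => ∫ s in (-1 : ℝ)..t, φ s) (φ t) t := fun t =>
    intervalIntegral.integral_hasDerivAt_right (hφ.continuous.intervalIntegrable _ _)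
      hφ.continuous.stronglyMeasurable.stronglyMeasurableAtFilter hφ.continuous.continuousAt
  have hderiv : deriv (fun t => ∫ s in (-1 : ℝ)..t, φ s) = φ := funext fun t => (hd t).deriv
  have hK : IsCompact (insert 0 (tsupport φ)) := hφ.hasCompactSupport.isCompact.insert 0
  have hKne : (insert 0 (tsupport φ)).Nonempty := insert_nonempty _ _
  have hKsub : insert 0 (tsupport φ) ⊆ Ioo (-1 : ℝ) 1 :=
    insert_subset (by norm_num) hφ.tsupport_subset
  set a := sInf (insert 0 (tsupport φ)) with ha
  set b := sSup (insert 0 (tsupport φ)) with hb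
  have ha1 := hKsub (hK.sInf_mem hKne)
  have hb1 := hKsub (hK.sSup_mem hKne)
  have hlt : ∀ s, s < a → φ s = 0 := fun s hs => image_eq_zero_of_notMem_tsupport fun h =>
    not_le.2 hs (csInf_le hK.bddBelow (mem_insert_of_mem _ h))
  have hgt : ∀ s, b < s → φ s = 0 := fun s hs => image_eq_zero_of_notMem_tsupport fun h =>
    not_le.2 hs (le_csSup hK.bddAbove (mem_insert_of_mem _ h))
  have hsupp : Function.support (fun t => ∫ s in (-1 : ℝ)..t, φ s) ⊆ Icc a b := by
    intro t ht
    by_contra hcon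
    refine ht ?_
    rw [mem_Icc, not_and_or, not_le, not_le] at hcon
    rcases hcon with h | h
    · refine (intervalIntegral.integral_congr (g := fun _ => (0 : ℝ)) fun s hs => ?_).trans (by simp)
      exact hlt s (lt_of_le_of_lt hs.2 (max_lt ha1.1 h))
    · have h1 : ∫ s in (1 : ℝ)..t, φ s = 0 := by
        refine (intervalIntegral.integral_congr (g := fun _ => (0 : ℝ)) fun s hs => ?_).trans
          (by simp)
        exact hgt s (lt_of_lt_of_le (lt_min hb1.2 h) hs.1)
      show ∫ s in (-1 : ℝ)..t, φ s = 0
      rw [← intervalIntegral.integral_add_adjacent_intervals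
        (hφ.continuous.intervalIntegrable (-1) 1) (hφ.continuous.intervalIntegrable 1 t), h0, h1,
        add_zero]
  refine ⟨⟨?_, HasCompactSupport.of_support_subset_isCompact isCompact_Icc hsupp, ?_⟩, hderiv⟩
  · rw [contDiff_infty_iff_deriv, hderiv]
    exact ⟨fun t => (hd t).differentiableAt, hφ.contDiff⟩
  · exact (closure_minimal hsupp isClosed_Icc).trans fun t ht =>
      ⟨lt_of_lt_of_le ha1.1 ht.1, lt_of_le_of_lt ht.2 hb1.2⟩

end IsTestFunction

/-- If `v` is the weak derivative of order `k + 1`, then a primitive of `v` is the weak derivative of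
order `k` (the lemma of du Bois-Reymond). -/
theorem IsWeakDeriv.exists_primitive {k : ℕ} {ξ v : ℝ → ℝ} (h : IsWeakDeriv (k + 1) ξ v) :
    ∃ c : ℝ, IsWeakDeriv k ξ fun t => c + ∫ s in (-1 : ℝ)..t, v s := by
  obtain ⟨hξ, hv, h⟩ := h
  obtain ⟨ψ, hψ, hψ1⟩ := IsTestFunction.exists_integral_eq_one
  set V : ℝ → ℝ := fun t => ∫ s in (-1 : ℝ)..t, v s with hV
  have hVc : ContinuousOn V (uIcc (-1) 1) :=
    (hv.absolutelyContinuousOnInterval_intervalIntegral (by simp)).continuousOn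
  have hkcont : ∀ φ : ℝ → ℝ, IsTestFunction φ → Continuous (iteratedDeriv k φ) := fun φ hφ =>
    hφ.contDiff.continuous_iteratedDeriv k (by exact_mod_cast le_top)
  have hzero : ∀ θ : ℝ → ℝ, IsTestFunction θ → ∫ t in (-1 : ℝ)..1, θ t = 0 →
      ∫ t in (-1 : ℝ)..1, ξ t * iteratedDeriv k θ t
        = (-1) ^ k * ∫ t in (-1 : ℝ)..1, V t * θ t := by
    intro θ hθ h0
    obtain ⟨hΘ, hd⟩ := hθ.primitive h0
    have h1 := h _ hΘ.contDiff hΘ.hasCompactSupport hΘ.tsupport_subset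
    rw [iteratedDeriv_succ', hd] at h1
    have h2 := integral_primitive_mul_eq hv (fun t => by
      have := (hΘ.contDiff.differentiable (by simp) t).hasDerivAt
      rwa [hd] at this) hθ.continuous 0
    rw [hΘ.eq_zero_of_notMem (by simp), hΘ.eq_zero_of_notMem (by simp)] at h2
    simp only [zero_add, mul_zero, zero_sub] at h2
    rw [h1, hV, h2, pow_succ]
    ring
  set c := (-1) ^ k * (∫ t in (-1 : ℝ)..1, ξ t * iteratedDeriv k ψ t)
    - ∫ t in (-1 : ℝ)..1, V t * ψ t with hc
  refine ⟨c, hξ, (continuousOn_const.add hVc).intervalIntegrable, fun φ hφ1 hφ2 hφ3 => ?_⟩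
  have hφ : IsTestFunction φ := ⟨hφ1, hφ2, hφ3⟩
  set I := ∫ t in (-1 : ℝ)..1, φ t with hI
  have hθ := hφ.sub_const_mul hψ I
  have h1 := hzero _ hθ (by
    rw [intervalIntegral.integral_sub (hφ.continuous.intervalIntegrable _ _)
      ((hψ.continuous.intervalIntegrable _ _).const_mul _), intervalIntegral.integral_const_mul,
      hψ1, mul_one, sub_self])
  have h2 : ∀ t, iteratedDeriv k (fun t => φ t - I * ψ t) t
      = iteratedDeriv k φ t - I * iteratedDeriv k ψ t := by
    intro t
    have e1 : ContDiffAt ℝ k φ t := (hφ.contDiff.of_le (by exact_mod_cast le_top)).contDiffAt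
    have e2 : ContDiffAt ℝ k ψ t := (hψ.contDiff.of_le (by exact_mod_cast le_top)).contDiffAt
    rw [iteratedDeriv_fun_sub e1 (contDiffAt_const.mul e2), iteratedDeriv_const_mul_field]
  have hi1 : ∀ χ : ℝ → ℝ, Continuous χ → IntervalIntegrable (fun t => ξ t * χ t) volume (-1) 1 :=
    fun χ hχ => hξ.mul_continuousOn hχ.continuousOn
  have hi2 : ∀ χ : ℝ → ℝ, Continuous χ → IntervalIntegrable (fun t => V t * χ t) volume (-1) 1 :=
    fun χ hχ => (hVc.mul hχ.continuousOn).intervalIntegrable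
  have h3 : ∫ t in (-1 : ℝ)..1, ξ t * iteratedDeriv k (fun t => φ t - I * ψ t) t
      = (∫ t in (-1 : ℝ)..1, ξ t * iteratedDeriv k φ t)
        - I * ∫ t in (-1 : ℝ)..1, ξ t * iteratedDeriv k ψ t := by
    rw [← intervalIntegral.integral_const_mul, ← intervalIntegral.integral_sub
      (hi1 _ (hkcont φ hφ)) ((hi1 _ (hkcont ψ hψ)).const_mul _)]
    refine intervalIntegral.integral_congr fun t _ => ?_
    simp only [h2]
    ring
  have h4 : ∫ t in (-1 : ℝ)..1, V t * (φ t - I * ψ t)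
      = (∫ t in (-1 : ℝ)..1, V t * φ t) - I * ∫ t in (-1 : ℝ)..1, V t * ψ t := by
    rw [← intervalIntegral.integral_const_mul, ← intervalIntegral.integral_sub
      (hi2 _ hφ.continuous) ((hi2 _ hψ.continuous).const_mul _)]
    refine intervalIntegral.integral_congr fun t _ => ?_
    ring
  have h5 : ∫ t in (-1 : ℝ)..1, (c + V t) * φ t = c * I + ∫ t in (-1 : ℝ)..1, V t * φ t := by
    simp only [add_mul]
    rw [intervalIntegral.integral_add ((hφ.continuous.intervalIntegrable _ _).const_mul _)
      (hi2 _ hφ.continuous), intervalIntegral.integral_const_mul]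
  rw [h3, h4] at h1
  rw [h5]
  have h6 : ((-1 : ℝ) ^ k) * (-1) ^ k = 1 := by rw [← mul_pow]; simp
  rw [hc]
  linear_combination h1 - I * (∫ t in (-1 : ℝ)..1, ξ t * iteratedDeriv k ψ t) * h6

theorem IsWeakDeriv.ae_eq {ξ w : ℝ → ℝ} (h : IsWeakDeriv 0 ξ w) :
    ∀ᵐ t, t ∈ Ioo (-1 : ℝ) 1 → ξ t = w t := by
  obtain ⟨hξ, hw, h⟩ := h
  have hle : (-1 : ℝ) ≤ 1 := by norm_num
  have hint : IntervalIntegrable (fun t => ξ t - w t) volume (-1) 1 := hξ.sub hw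
  have h1 := isOpen_Ioo.ae_eq_zero_of_integral_contDiff_smul_eq_zero
    (f := fun t => ξ t - w t) (μ := volume) (U := Ioo (-1 : ℝ) 1)
    (((intervalIntegrable_iff_integrableOn_Ioo_of_le hle).1 hint).locallyIntegrableOn) ?_
  · filter_upwards [h1] with t ht hmem
    linarith [ht hmem]
  · intro g hg1 hg2 hg3
    have hg : IsTestFunction g := ⟨hg1, hg2, hg3⟩
    have h2 := h g hg1 hg2 hg3
    simp only [iteratedDeriv_zero, pow_zero, one_mul] at h2
    have h3 : ∫ t in (-1 : ℝ)..1, g t • (ξ t - w t) = 0 := by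
      rw [← sub_eq_zero.2 h2, ← intervalIntegral.integral_sub
        (hξ.mul_continuousOn hg.continuous.continuousOn)
        (hw.mul_continuousOn hg.continuous.continuousOn)]
      refine intervalIntegral.integral_congr fun t _ => ?_
      simp only [smul_eq_mul]
      ring
    rw [intervalIntegral.integral_of_le hle, setIntegral_eq_integral_of_forall_compl_eq_zero] at h3
    · exact h3
    · intro t ht
      rw [hg.eq_zero_of_notMem (fun h => ht (Ioo_subset_Ioc_self h)), zero_smul]

theorem contDiff_succ_of_iteratedDeriv {k : ℕ} {H : ℝ → ℝ} (h : ContDiff ℝ k H)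
    (h1 : ContDiff ℝ 1 (iteratedDeriv k H)) : ContDiff ℝ (k + 1 : ℕ) H := by
  induction k generalizing H with
  | zero => simpa using h1
  | succ k ih =>
    have e1 : ContDiff ℝ ((k : WithTop ℕ∞) + 1) H := by exact_mod_cast h
    have h2 := contDiff_succ_iff_deriv.1 e1
    have h3 := ih h2.2.2 (by rwa [← iteratedDeriv_succ'])
    have h4 : ContDiff ℝ (((k + 1 : ℕ) : WithTop ℕ∞) + 1) H :=
      contDiff_succ_iff_deriv.2 ⟨h2.1, by simp, h3⟩
    exact_mod_cast h4

theorem hasDerivAt_primitive {w : ℝ → ℝ} (hw : Continuous w) (c t : ℝ) :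
    HasDerivAt (fun t => c + ∫ s in (-1 : ℝ)..t, w s) (w t) t :=
  (intervalIntegral.integral_hasDerivAt_right (hw.intervalIntegrable _ _)
    hw.stronglyMeasurable.stronglyMeasurableAtFilter hw.continuousAt).const_add c

/-- A function with a continuous weak derivative agrees almost everywhere with a `C^k` function. -/
theorem IsWeakDeriv.exists_contDiff {k : ℕ} {ξ w : ℝ → ℝ} (hw : Continuous w)
    (h : IsWeakDeriv k ξ w) : ∃ H : ℝ → ℝ, ContDiff ℝ k H ∧ iteratedDeriv k H = w ∧
      ∀ᵐ t, t ∈ Ioo (-1 : ℝ) 1 → ξ t = H t := by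
  induction k generalizing w with
  | zero => exact ⟨w, by rw [Nat.cast_zero]; exact contDiff_zero.2 hw, iteratedDeriv_zero, h.ae_eq⟩
  | succ k ih =>
    obtain ⟨c, hc⟩ := h.exists_primitive
    have hd := hasDerivAt_primitive hw c
    have hderiv : deriv (fun t => c + ∫ s in (-1 : ℝ)..t, w s) = w := funext fun t => (hd t).deriv
    have hdiff : Differentiable ℝ (fun t => c + ∫ s in (-1 : ℝ)..t, w s) :=
      fun t => (hd t).differentiableAt
    obtain ⟨H, hH, hHk, hae⟩ := ih hdiff.continuous hc
    refine ⟨H, contDiff_succ_of_iteratedDeriv hH ?_, ?_, hae⟩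
    · rw [hHk, contDiff_one_iff_deriv, hderiv]
      exact ⟨hdiff, hw⟩
    · rw [iteratedDeriv_succ, hHk, hderiv]

/-- Iterated antiderivatives with given initial values. -/
theorem exists_iteratedDeriv_eq {l : ℕ} {h : ℝ → ℝ} (hh : ContDiff ℝ l h) (k : ℕ) (c : ℕ → ℝ) :
    ∃ y : ℝ → ℝ, ContDiff ℝ (k + l : ℕ) y ∧ iteratedDeriv k y = h ∧
      ∀ j < k, iteratedDeriv j y (-1) = c j := by
  induction k generalizing c with
  | zero => exact ⟨h, by simpa using hh, iteratedDeriv_zero, by simp⟩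
  | succ k ih =>
    obtain ⟨z, hz, hzk, hzc⟩ := ih fun j => c (j + 1)
    have hd := hasDerivAt_primitive hz.continuous (c 0)
    have hderiv : deriv (fun t => c 0 + ∫ s in (-1 : ℝ)..t, z s) = z :=
      funext fun t => (hd t).deriv
    refine ⟨fun t => c 0 + ∫ s in (-1 : ℝ)..t, z s, ?_, ?_, ?_⟩
    · have : ContDiff ℝ (((k + l : ℕ) : WithTop ℕ∞) + 1) fun t => c 0 + ∫ s in (-1 : ℝ)..t, z s := by
        rw [contDiff_succ_iff_deriv, hderiv]
        exact ⟨fun t => (hd t).differentiableAt, by simp, hz⟩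
      rw [show k + 1 + l = k + l + 1 by ring]
      exact_mod_cast this
    · rw [iteratedDeriv_succ', hderiv, hzk]
    · intro j hj
      rcases j with _ | j
      · simp
      · rw [iteratedDeriv_succ', hderiv]
        exact hzc j (by omega)

/-! ### The flat output of a trajectory -/

/-- The trajectory `(y, y', …, y^{(r-1)})` of the chain of integrators whose first coordinate is
`y`. -/
noncomputable def flatState (r : ℕ) (y : ℝ → ℝ) (t : ℝ) : Fin r → ℝ :=
  fun i => iteratedDeriv (i : ℕ) y t

theorem absolutelyContinuousOnInterval_apply {r : ℕ} {x : ℝ → Fin r → ℝ} {a b : ℝ}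
    (h : AbsolutelyContinuousOnInterval x a b) (i : Fin r) :
    AbsolutelyContinuousOnInterval (fun t => x t i) a b := by
  rw [absolutelyContinuousOnInterval_iff] at h ⊢
  intro ε hε
  obtain ⟨δ, hδ, h⟩ := h ε hε
  exact ⟨δ, hδ, fun E hE hs => lt_of_le_of_lt
    (Finset.sum_le_sum fun j _ => dist_le_pi_dist _ _ i) (h E hE hs)⟩

theorem hasDerivAt_iteratedDeriv {n k : ℕ} {y : ℝ → ℝ} (hy : ContDiff ℝ n y) (hk : k < n) (t : ℝ) :
    HasDerivAt (iteratedDeriv k y) (iteratedDeriv (k + 1) y t) t := by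
  rw [iteratedDeriv_succ]
  exact (hy.differentiable_iteratedDeriv k (by exact_mod_cast hk) t).hasDerivAt

/-- An admissible trajectory whose last coordinate has a weak derivative of order `n + 1` and of
bounded variation comes from a flat output of class `C^{r-1+n}`. -/
theorem BolzaProblem.IsAdmissible.exists_flatOutput {r : ℕ} [NeZero r] {P : BolzaProblem r}
    {xs : ℝ → Fin r → ℝ} {us : ℝ → ℝ} (had : P.IsAdmissible xs us) {n : ℕ} (hn : 1 ≤ n)
    (hBV : HasBVWeakDeriv (n + 1) fun t => xs t (lastIdx r)) :
    ∃ (y v : ℝ → ℝ) (c : ℝ), ContDiff ℝ (r - 1 + n : ℕ) y ∧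
      BoundedVariationOn v (Icc (-1 : ℝ) 1) ∧
      (∀ t ∈ Icc (-1 : ℝ) 1, iteratedDeriv (r - 1 + n) y t = c + ∫ s in (-1 : ℝ)..t, v s) ∧
      (∀ t ∈ Icc (-1 : ℝ) 1, xs t = flatState r y t) ∧
      ∀ᵐ t ∂(volume.restrict (Icc (-1 : ℝ) 1)),
        P.f (xs t) + P.g (xs t) * us t = iteratedDeriv r y t := by
  have hle : (-1 : ℝ) ≤ 1 := by norm_num
  have hu : uIcc (-1 : ℝ) 1 = Icc (-1) 1 := uIcc_of_le hle
  have hr : 0 < r := Nat.pos_of_ne_zero (NeZero.ne r)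
  obtain ⟨v, hwd, hv⟩ := hBV
  obtain ⟨c, hc⟩ := hwd.exists_primitive
  -- `v` is cut off outside `[-1, 1]`, so that its primitive is continuous on the line
  have hvint : Integrable ((Icc (-1 : ℝ) 1).indicator v) := by
    rw [integrable_indicator_iff measurableSet_Icc]
    exact (intervalIntegrable_iff_integrableOn_Icc_of_le hle).1 hwd.2.1
  set w : ℝ → ℝ := fun t => c + ∫ s in (-1 : ℝ)..t, (Icc (-1 : ℝ) 1).indicator v s with hw
  have hwc : Continuous w := continuous_const.add (intervalIntegral.continuous_primitive
    (fun a b => hvint.intervalIntegrable) (-1))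
  have hweq : ∀ t ∈ Icc (-1 : ℝ) 1, w t = c + ∫ s in (-1 : ℝ)..t, v s := by
    intro t ht
    simp only [hw]
    congr 1
    refine intervalIntegral.integral_congr fun s hs => ?_
    rw [uIcc_of_le ht.1] at hs
    have hmem : s ∈ Icc (-1 : ℝ) 1 := ⟨hs.1, hs.2.trans ht.2⟩
    simp only [indicator_of_mem hmem]
  have hwd' : IsWeakDeriv n (fun t => xs t (lastIdx r)) w := by
    refine ⟨hc.1, hwc.intervalIntegrable _ _, fun φ h1 h2 h3 => ?_⟩
    rw [hc.2.2 φ h1 h2 h3]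
    congr 1
    refine intervalIntegral.integral_congr fun t ht => ?_
    rw [hu] at ht
    simp only [hweq t ht]
  obtain ⟨H, hH, hHn, hae⟩ := hwd'.exists_contDiff hwc
  obtain ⟨y, hy, hyk, hyc⟩ := exists_iteratedDeriv_eq hH (r - 1)
    (fun j => if h : j < r then P.x0 ⟨j, h⟩ else 0)
  have hcomp := fun i => absolutelyContinuousOnInterval_apply had.traj_ac i
  have hlast : ∀ t ∈ Icc (-1 : ℝ) 1, xs t (lastIdx r) = H t := by
    refine Measure.eqOn_Icc_of_ae_eq volume (by norm_num : (-1 : ℝ) ≠ 1) ?_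
      (hu ▸ (hcomp (lastIdx r)).continuousOn) hH.continuous.continuousOn
    rw [← restrict_Ioo_eq_restrict_Icc]
    exact (ae_restrict_iff' measurableSet_Ioo).2 hae
  have hstate : ∀ j : ℕ, ∀ i : Fin r, (i : ℕ) + j = r - 1 →
      ∀ t ∈ Icc (-1 : ℝ) 1, xs t i = iteratedDeriv (i : ℕ) y t := by
    intro j
    induction j with
    | zero =>
      intro i hi t ht
      have : i = lastIdx r := Fin.ext (by simpa [lastIdx] using hi)
      rw [add_zero] at hi
      rw [hi, hyk, this]
      exact hlast t ht
    | succ j ih =>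
      intro i hi t ht
      have hi1 : (i : ℕ) + 1 < r := by omega
      have hyd := hasDerivAt_iteratedDeriv hy (k := (i : ℕ)) (by omega)
      have hac : AbsolutelyContinuousOnInterval
          (fun t => xs t i - iteratedDeriv (i : ℕ) y t) (-1) 1 := by
        refine (hcomp i).sub (ContDiffOn.absolutelyContinuousOnInterval (ContDiff.contDiffOn ?_))
        rw [contDiff_one_iff_deriv, ← iteratedDeriv_succ]
        exact ⟨fun t => (hyd t).differentiableAt,
          hy.continuous_iteratedDeriv _ (by exact_mod_cast (by omega : (i : ℕ) + 1 ≤ r - 1 + n))⟩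
      obtain ⟨C, hC⟩ := hac.const_of_ae_hasDerivAt_zero (by
        filter_upwards [(ae_restrict_iff' measurableSet_Icc).1 had.ode] with t ht hmem
        rw [hu] at hmem
        have h1 := hasDerivAt_pi.1 (ht hmem) i
        have h2 := h1.sub (hyd t)
        rw [BolzaProblem.field, dif_pos hi1, ih ⟨(i : ℕ) + 1, hi1⟩ (by simp; omega) t hmem,
          sub_self] at h2
        exact h2)
      have h0 := hC (-1) (by simp)
      have h1 := hC t (hu ▸ ht)
      rw [hyc i (by omega), dif_pos i.2, had.init, sub_self] at h0
      rw [← h0] at h1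
      exact sub_eq_zero.1 h1
  have hstate' : ∀ t ∈ Icc (-1 : ℝ) 1, xs t = flatState r y t := fun t ht =>
    funext fun i => hstate (r - 1 - i) i (by omega) t ht
  refine ⟨y, v, c, hy, hv, fun t ht => ?_, hstate', ?_⟩
  · rw [← hweq t ht, ← hHn, ← hyk]
    simp only [iteratedDeriv_eq_iterate, ← Function.iterate_add_apply, add_comm]
  · rw [← restrict_Ioo_eq_restrict_Icc]
    have hode := had.ode
    rw [← restrict_Ioo_eq_restrict_Icc, ae_restrict_iff' measurableSet_Ioo] at hode
    rw [ae_restrict_iff' measurableSet_Ioo]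
    filter_upwards [hode] with t ht hmem
    have h1 := hasDerivAt_pi.1 (ht hmem) (lastIdx r)
    have h2 : P.field (xs t) (us t) (lastIdx r) = P.f (xs t) + P.g (xs t) * us t := by
      rw [BolzaProblem.field, dif_neg]
      simp only [lastIdx]
      omega
    have h3 := hasDerivAt_iteratedDeriv hy (k := r - 1) (by omega) t
    rw [show r - 1 + 1 = r by omega] at h3
    rw [h2] at h1
    refine h1.unique (h3.congr_of_eventuallyEq ?_)
    filter_upwards [Icc_mem_nhds hmem.1 hmem.2] with s hs
    rw [hyk]
    exact hlast s hs

end PSOptimalControl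

namespace PSOptimalControl

/-! ### The cost as a functional of the flat output -/

/-- The state together with the derivative of its last coordinate, for the flat output `y`. -/
noncomputable def flatCurve (r : ℕ) (y : ℝ → ℝ) (t : ℝ) : (Fin r → ℝ) × ℝ :=
  (flatState r y t, iteratedDeriv r y t)

/-- The running cost as a function of the state and the derivative of its last coordinate. -/
noncomputable def BolzaProblem.lagrangian {r : ℕ} (P : BolzaProblem r) (z : (Fin r → ℝ) × ℝ) : ℝ :=
  P.F (z.1, (z.2 - P.f z.1) / P.g z.1)

/-- The control that steers the system along the flat output `y`. -/
noncomputable def BolzaProblem.flatControl {r : ℕ} (P : BolzaProblem r) (y : ℝ → ℝ) (t : ℝ) : ℝ :=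
  (iteratedDeriv r y t - P.f (flatState r y t)) / P.g (flatState r y t)

/-- The cost of the trajectory with flat output `y`. -/
noncomputable def BolzaProblem.flatCost {r : ℕ} (P : BolzaProblem r) (y : ℝ → ℝ) : ℝ :=
  (∫ t in (-1 : ℝ)..1, P.lagrangian (flatCurve r y t)) + P.E P.x0 (flatState r y 1)

theorem BolzaProblem.contDiff_lagrangian {r : ℕ} {P : BolzaProblem r} {n : WithTop ℕ∞}
    (hg0 : ∀ x, P.g x ≠ 0) (hf : ContDiff ℝ n P.f) (hg : ContDiff ℝ n P.g)
    (hF : ContDiff ℝ n P.F) : ContDiff ℝ n P.lagrangian := by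
  unfold BolzaProblem.lagrangian
  exact hF.comp (contDiff_fst.prodMk ((contDiff_snd.sub (hf.comp contDiff_fst)).div
    (hg.comp contDiff_fst) fun z => hg0 z.1))

theorem contDiff_flatState {r : ℕ} {y : ℝ → ℝ} {n : ℕ} (hy : ContDiff ℝ (r - 1 + n : ℕ) y) :
    ContDiff ℝ n (flatState r y) := by
  refine contDiff_pi.2 fun i => ?_
  have : (n : WithTop ℕ∞) + ((i : ℕ) : WithTop ℕ∞) ≤ ((r - 1 + n : ℕ) : WithTop ℕ∞) := by
    exact_mod_cast (by omega : n + (i : ℕ) ≤ r - 1 + n)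
  have h := (hy.of_le this).iterate_deriv' n (i : ℕ)
  rw [← iteratedDeriv_eq_iterate] at h
  exact h

theorem contDiff_flatCurve {r : ℕ} {y : ℝ → ℝ} {n : ℕ} (hy : ContDiff ℝ (r + n : ℕ) y) :
    ContDiff ℝ n (flatCurve r y) := by
  refine ContDiff.prodMk (contDiff_flatState (hy.of_le ?_)) ?_
  · exact_mod_cast (by omega : r - 1 + n ≤ r + n)
  · have : (n : WithTop ℕ∞) + (r : WithTop ℕ∞) ≤ ((r + n : ℕ) : WithTop ℕ∞) := by
      exact_mod_cast (by omega : n + r ≤ r + n)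
    simpa only [iteratedDeriv_eq_iterate] using (hy.of_le this).iterate_deriv' n r

theorem continuous_flatCurve {r : ℕ} {y : ℝ → ℝ} (hy : ContDiff ℝ r y) :
    Continuous (flatCurve r y) :=
  (contDiff_flatCurve (n := 0) (by simpa using hy)).continuous

theorem continuous_flatControl {r : ℕ} {P : BolzaProblem r} (hg0 : ∀ x, P.g x ≠ 0)
    (hf : Continuous P.f) (hg : Continuous P.g) {y : ℝ → ℝ} (hy : ContDiff ℝ r y) :
    Continuous (P.flatControl y) := by
  have hc := continuous_flatCurve hy
  have h1 : Continuous (flatState r y) := continuous_fst.comp hc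
  have h2 : Continuous (iteratedDeriv r y) := continuous_snd.comp hc
  exact (h2.sub (hf.comp h1)).div (hg.comp h1) fun t => hg0 _

theorem BolzaProblem.isAdmissible_flatState {r : ℕ} {P : BolzaProblem r}
    (hg0 : ∀ x, P.g x ≠ 0) (hf : Continuous P.f) (hg : Continuous P.g) {y : ℝ → ℝ}
    (hy : ContDiff ℝ r y) (h0 : flatState r y (-1) = P.x0) :
    P.IsAdmissible (flatState r y) (P.flatControl y) := by
  have hu := continuous_flatControl hg0 hf hg hy
  refine ⟨?_, ?_, ?_, h0⟩
  · obtain ⟨C, hC⟩ := isCompact_Icc.exists_bound_of_continuousOn (s := Icc (-1 : ℝ) 1)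
      hu.continuousOn
    refine memLp_top_of_bound hu.aestronglyMeasurable C ?_
    exact (ae_restrict_iff' measurableSet_Icc).2 (Filter.Eventually.of_forall hC)
  · refine ContDiffOn.absolutelyContinuousOnInterval (ContDiff.contDiffOn ?_)
    rcases Nat.eq_zero_or_pos r with rfl | hr
    · exact contDiff_pi.2 fun i => i.elim0
    · exact contDiff_flatState (n := 1) (by rwa [Nat.sub_add_cancel hr])
  · refine Filter.Eventually.of_forall fun t => hasDerivAt_pi.2 fun i => ?_
    have h1 := hasDerivAt_iteratedDeriv hy i.2 t
    rw [BolzaProblem.field]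
    split_ifs with h
    · exact h1
    · rw [show (i : ℕ) + 1 = r by omega] at h1
      rw [BolzaProblem.flatControl, mul_div_cancel₀ _ (hg0 _), add_sub_cancel]
      exact h1

theorem BolzaProblem.cost_flatState {r : ℕ} {P : BolzaProblem r} {y : ℝ → ℝ}
    (h0 : flatState r y (-1) = P.x0) :
    P.cost (flatState r y) (P.flatControl y) = P.flatCost y := by
  rw [BolzaProblem.cost, BolzaProblem.flatCost, h0]
  rfl

theorem BolzaProblem.cost_eq_flatCost {r : ℕ} {P : BolzaProblem r} (hg0 : ∀ x, P.g x ≠ 0)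
    {xs : ℝ → Fin r → ℝ} {us y : ℝ → ℝ} (h0 : xs (-1) = P.x0)
    (hx : ∀ t ∈ Icc (-1 : ℝ) 1, xs t = flatState r y t)
    (hu : ∀ᵐ t ∂(volume.restrict (Icc (-1 : ℝ) 1)),
      P.f (xs t) + P.g (xs t) * us t = iteratedDeriv r y t) :
    P.cost xs us = P.flatCost y := by
  rw [BolzaProblem.cost, BolzaProblem.flatCost, h0, hx 1 (by norm_num)]
  congr 1
  refine intervalIntegral.integral_congr_ae ?_
  filter_upwards [(ae_restrict_iff' measurableSet_Icc).1 hu] with t ht hmem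
  rw [uIoc_of_le (by norm_num)] at hmem
  have hmem' := Ioc_subset_Icc_self hmem
  rw [BolzaProblem.lagrangian, flatCurve, ← ht hmem', ← hx t hmem', add_sub_cancel_left,
    mul_div_cancel_left₀ _ (hg0 _)]

/-! ### Second-order behaviour of the cost at a minimum -/

/-- Second differences of a `C²` function are quadratic, uniformly on bounded sets. -/
theorem exists_abs_second_difference_le {E : Type*} [NormedAddCommGroup E] [NormedSpace ℝ E]
    [ProperSpace E] {G : E → ℝ} (hG : ContDiff ℝ 2 G) (R ρ : ℝ) :
    ∃ C : ℝ, 0 ≤ C ∧ ∀ z d : E, ‖z‖ ≤ R → ‖d‖ ≤ ρ →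
      |G (z + d) + G (z - d) - 2 * G z| ≤ C * ‖d‖ ^ 2 := by
  have hG1 : ContDiff ℝ 1 (fderiv ℝ G) := hG.fderiv_right (by norm_num)
  obtain ⟨K, hK⟩ := (hG1.contDiffOn (s := Metric.closedBall 0 (R + ρ))).exists_lipschitzOnWith
    (by decide) (convex_closedBall 0 (R + ρ)) (isCompact_closedBall 0 (R + ρ))
  refine ⟨2 * K, by positivity, fun z d hz hd => ?_⟩
  have hGd : Differentiable ℝ G := hG.differentiable (by norm_num)
  have hmem : ∀ s ∈ Icc (0 : ℝ) 1, z + s • d ∈ Metric.closedBall (0 : E) (R + ρ) ∧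
      z - s • d ∈ Metric.closedBall (0 : E) (R + ρ) := by
    intro s hs
    have h1 : ‖s • d‖ ≤ ρ := by
      rw [norm_smul, Real.norm_eq_abs, abs_of_nonneg hs.1]
      exact (mul_le_of_le_one_left (norm_nonneg _) hs.2).trans hd
    rw [mem_closedBall_zero_iff, mem_closedBall_zero_iff]
    exact ⟨(norm_add_le _ _).trans (by linarith), (norm_sub_le _ _).trans (by linarith)⟩
  have h2 := Convex.norm_image_sub_le_of_norm_hasDerivWithin_le
    (f := fun s : ℝ => G (z + s • d) + G (z - s • d))
    (f' := fun s => fderiv ℝ G (z + s • d) d - fderiv ℝ G (z - s • d) d)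
    (C := 2 * K * ‖d‖ ^ 2) (s := Icc (0 : ℝ) 1) (x := 0) (y := 1) ?_ ?_ (convex_Icc _ _)
    (by simp) (by simp)
  · simp only [one_smul, zero_smul, add_zero, sub_zero, norm_one, mul_one] at h2
    rw [show G (z + d) + G (z - d) - 2 * G z = G (z + d) + G (z - d) - (G z + G z) by ring]
    exact h2
  · intro s _
    have hl : HasDerivAt (fun s : ℝ => s • d) d s := by
      simpa using (hasDerivAt_id s).smul_const d
    have e1 := (hGd (z + s • d)).hasFDerivAt.comp_hasDerivAt s (hl.const_add z)
    have e2 := (hGd (z - s • d)).hasFDerivAt.comp_hasDerivAt s (hl.const_sub z)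
    have e3 := e1.add e2
    rw [map_neg, ← sub_eq_add_neg] at e3
    exact e3.hasDerivWithinAt
  · intro s hs
    obtain ⟨m1, m2⟩ := hmem s hs
    have h3 := hK.dist_le_mul _ m1 _ m2
    rw [dist_eq_norm, dist_eq_norm] at h3
    have h4 : ‖z + s • d - (z - s • d)‖ ≤ 2 * ‖d‖ := by
      rw [show z + s • d - (z - s • d) = (2 * s) • d by rw [mul_smul, two_smul]; abel, norm_smul,
        Real.norm_eq_abs, abs_of_nonneg (by linarith [hs.1])]
      gcongr
      linarith [hs.2]
    calc ‖fderiv ℝ G (z + s • d) d - fderiv ℝ G (z - s • d) d‖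
        = ‖(fderiv ℝ G (z + s • d) - fderiv ℝ G (z - s • d)) d‖ := by simp
      _ ≤ ‖fderiv ℝ G (z + s • d) - fderiv ℝ G (z - s • d)‖ * ‖d‖ :=
          ContinuousLinearMap.le_opNorm _ _
      _ ≤ (K * (2 * ‖d‖)) * ‖d‖ := by gcongr; exact h3.trans (by gcongr)
      _ = _ := by ring

theorem iteratedDeriv_two_mul_sub {n : ℕ} {y Y : ℝ → ℝ} (hy : ContDiff ℝ n y)
    (hY : ContDiff ℝ n Y) {k : ℕ} (hk : k ≤ n) (t : ℝ) :
    iteratedDeriv k (fun t => 2 * y t - Y t) t = 2 * iteratedDeriv k y t - iteratedDeriv k Y t := by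
  have hkn : (k : WithTop ℕ∞) ≤ n := by exact_mod_cast hk
  rw [iteratedDeriv_fun_sub (contDiffAt_const.mul (hy.of_le hkn).contDiffAt)
    (hY.of_le hkn).contDiffAt, iteratedDeriv_const_mul_field]

/-- At a minimum `ys` of the cost, the excess of the cost is quadratic in the distance: by
minimality at the reflected output `2 ys - Y`, the excess at `Y` is at most the second difference
of the cost. -/
theorem BolzaProblem.exists_flatCost_le {r : ℕ} {P : BolzaProblem r}
    (hG : ContDiff ℝ 2 P.lagrangian) (hE : ContDiff ℝ 2 (P.E P.x0)) {ys : ℝ → ℝ}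
    (hys : ContDiff ℝ r ys) (hys0 : flatState r ys (-1) = P.x0)
    (hmin : ∀ y : ℝ → ℝ, ContDiff ℝ r y → flatState r y (-1) = P.x0 →
      P.flatCost ys ≤ P.flatCost y) (ρ : ℝ) :
    ∃ C : ℝ, 0 ≤ C ∧ ∀ (Y : ℝ → ℝ) (ε : ℝ), ContDiff ℝ r Y → flatState r Y (-1) = P.x0 →
      ε ≤ ρ → (∀ t ∈ Icc (-1 : ℝ) 1, ‖flatCurve r Y t - flatCurve r ys t‖ ≤ ε) →
      P.flatCost Y ≤ P.flatCost ys + C * ε ^ 2 := by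
  have hcs := continuous_flatCurve hys
  obtain ⟨R, hR⟩ := isCompact_Icc.exists_bound_of_continuousOn (s := Icc (-1 : ℝ) 1)
    hcs.continuousOn
  obtain ⟨C1, hC1, h1⟩ := exists_abs_second_difference_le hG R ρ
  obtain ⟨C2, hC2, h2⟩ := exists_abs_second_difference_le hE R ρ
  refine ⟨2 * C1 + C2, by positivity, fun Y ε hY hY0 hε hd => ?_⟩
  have hmem1 : (1 : ℝ) ∈ Icc (-1 : ℝ) 1 := by norm_num
  have hε0 : 0 ≤ ε := (norm_nonneg _).trans (hd 1 hmem1)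
  set Z : ℝ → ℝ := fun t => 2 * ys t - Y t with hZdef
  have hZ : ContDiff ℝ r Z := (contDiff_const.mul hys).sub hY
  have hZc : ∀ t, flatCurve r Z t = flatCurve r ys t - (flatCurve r Y t - flatCurve r ys t) := by
    intro t
    refine Prod.ext (funext fun i => ?_) ?_
    · simp only [flatCurve, flatState, Prod.fst_sub, Pi.sub_apply]
      rw [hZdef, iteratedDeriv_two_mul_sub hys hY i.2.le]
      ring
    · simp only [flatCurve, Prod.snd_sub]
      rw [hZdef, iteratedDeriv_two_mul_sub hys hY le_rfl]
      ring
  have hYc : ∀ t, flatCurve r Y t = flatCurve r ys t + (flatCurve r Y t - flatCurve r ys t) :=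
    fun t => by abel
  have hZ0 : flatState r Z (-1) = P.x0 := by
    have := congrArg Prod.fst (hZc (-1))
    simp only [Prod.fst_sub, flatCurve] at this
    rw [this, hys0, hY0, sub_self, sub_zero]
  have hpt : ∀ t ∈ Icc (-1 : ℝ) 1, P.lagrangian (flatCurve r Y t) + P.lagrangian (flatCurve r Z t)
      - 2 * P.lagrangian (flatCurve r ys t) ≤ C1 * ε ^ 2 := by
    intro t ht
    have h3 := h1 (flatCurve r ys t) (flatCurve r Y t - flatCurve r ys t) (hR t ht)
      ((hd t ht).trans hε)
    rw [← hYc, ← hZc] at h3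
    refine (le_abs_self _).trans (h3.trans ?_)
    gcongr
    exact hd t ht
  have hEpt : P.E P.x0 (flatState r Y 1) + P.E P.x0 (flatState r Z 1)
      - 2 * P.E P.x0 (flatState r ys 1) ≤ C2 * ε ^ 2 := by
    have e1 : ‖flatState r Y 1 - flatState r ys 1‖ ≤ ε := (norm_fst_le _).trans (hd 1 hmem1)
    have e2 : flatState r Z 1 = flatState r ys 1 - (flatState r Y 1 - flatState r ys 1) :=
      congrArg Prod.fst (hZc 1)
    have e3 : flatState r Y 1 = flatState r ys 1 + (flatState r Y 1 - flatState r ys 1) := by abel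
    have h3 := h2 (flatState r ys 1) (flatState r Y 1 - flatState r ys 1)
      ((norm_fst_le _).trans (hR 1 hmem1)) (e1.trans hε)
    rw [← e2, ← e3] at h3
    refine (le_abs_self _).trans (h3.trans ?_)
    gcongr
  have hGc := hG.continuous
  have hi : ∀ y : ℝ → ℝ, ContDiff ℝ r y →
      IntervalIntegrable (fun t => P.lagrangian (flatCurve r y t)) volume (-1) 1 :=
    fun y hy => (hGc.comp (continuous_flatCurve hy)).intervalIntegrable _ _
  have hint : (∫ t in (-1 : ℝ)..1, P.lagrangian (flatCurve r Y t))
      + (∫ t in (-1 : ℝ)..1, P.lagrangian (flatCurve r Z t))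
      - 2 * (∫ t in (-1 : ℝ)..1, P.lagrangian (flatCurve r ys t)) ≤ 2 * (C1 * ε ^ 2) := by
    rw [← intervalIntegral.integral_const_mul, ← intervalIntegral.integral_add (hi Y hY) (hi Z hZ),
      ← intervalIntegral.integral_sub ((hi Y hY).add (hi Z hZ)) ((hi ys hys).const_mul 2)]
    refine (intervalIntegral.integral_mono_on (by norm_num)
      (((hi Y hY).add (hi Z hZ)).sub ((hi ys hys).const_mul 2)) (by simp) hpt).trans ?_
    simp
    linarith
  have h4 := hmin Z hZ hZ0
  simp only [BolzaProblem.flatCost] at h4 ⊢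
  linarith

end PSOptimalControl

namespace PSOptimalControl

open Polynomial

/-! ### The discretized problem in terms of a polynomial flat output -/

theorem iteratedDeriv_eval (Y : ℝ[X]) (k : ℕ) :
    iteratedDeriv k (fun t => Y.eval t) = fun t => (derivative^[k] Y).eval t := by
  induction k with
  | zero => simp
  | succ k ih =>
    rw [iteratedDeriv_succ, ih, Function.iterate_succ_apply']
    funext t
    exact Polynomial.deriv _

theorem contDiff_eval (Y : ℝ[X]) {n : WithTop ℕ∞} : ContDiff ℝ n fun t => Y.eval t := by
  simpa only [coe_aeval_eq_eval] using contDiff_aeval (R := ℝ) (𝕜 := ℝ) Y n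

section Interpolation

variable {r N : ℕ} {P : BolzaProblem r} {X : Fin (N + 1) → Fin r → ℝ} {U : Fin (N + 1) → ℝ}

theorem natDegree_interpPoly_le (hN : 1 ≤ N) (X : Fin (N + 1) → Fin r → ℝ) (i : Fin r) :
    (interpPoly X i).natDegree ≤ N := by
  have h := Lagrange.degree_interpolate_lt (s := Finset.univ) (v := lglNode N)
    (fun k => X k i) (lglNode_injective hN).injOn
  rw [Finset.card_univ, Fintype.card_fin] at h
  exact natDegree_le_of_degree_le (Order.le_of_lt_succ (by exact_mod_cast h))

theorem interpPoly_eval (hN : 1 ≤ N) (X : Fin (N + 1) → Fin r → ℝ) (i : Fin r)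
    (k : Fin (N + 1)) : (interpPoly X i).eval (lglNode N k) = X k i :=
  Lagrange.eval_interpolate_at_node _ (lglNode_injective hN).injOn (Finset.mem_univ k)

theorem derivative_interpPoly_eval (hN : 1 ≤ N)
    (h : ∀ i k, (diffMatrix N *ᵥ fun l => X l i) k = P.field (X k) (U k) i) (i : Fin r)
    (k : Fin (N + 1)) :
    (derivative (interpPoly X i)).eval (lglNode N k) = P.field (X k) (U k) i := by
  rw [← h i k, ← congrFun (diffMatrix_mulVec_eval hN (natDegree_interpPoly_le hN X i)) k]
  simp only [interpPoly_eval hN]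

theorem interpState_lglNode (hN : 1 ≤ N) (X : Fin (N + 1) → Fin r → ℝ) (k : Fin (N + 1)) :
    interpState X (lglNode N k) = X k :=
  funext fun i => interpPoly_eval hN X i k

variable [NeZero r]

/-- The nodal dynamics of the integrators hold identically, both sides being polynomials of degree at
most `N`. -/
theorem interpPoly_eq_iterate_derivative (hN : 1 ≤ N)
    (h : ∀ i k, (diffMatrix N *ᵥ fun l => X l i) k = P.field (X k) (U k) i) (j : ℕ)
    (hj : j < r) : interpPoly X ⟨j, hj⟩ = derivative^[j] (interpPoly X 0) := by
  induction j with
  | zero => rfl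
  | succ j ih =>
    rw [Function.iterate_succ_apply', ← ih (by omega)]
    refine eq_of_eval_lglNode_eq hN (natDegree_interpPoly_le hN X _)
      ((natDegree_derivative_le _).trans
        ((Nat.sub_le _ _).trans (natDegree_interpPoly_le hN X _))) fun k => ?_
    rw [derivative_interpPoly_eval hN h, interpPoly_eval hN, BolzaProblem.field, dif_pos hj]

theorem interpState_eq_flatState (hN : 1 ≤ N)
    (h : ∀ i k, (diffMatrix N *ᵥ fun l => X l i) k = P.field (X k) (U k) i) :
    interpState X = flatState r fun t => (interpPoly X 0).eval t := by
  funext t i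
  rw [interpState, flatState, iteratedDeriv_eval, ← interpPoly_eq_iterate_derivative hN h i i.2]

theorem derivative_interpPoly_lastIdx (hN : 1 ≤ N)
    (h : ∀ i k, (diffMatrix N *ᵥ fun l => X l i) k = P.field (X k) (U k) i) :
    derivative (interpPoly X (lastIdx r)) = derivative^[r] (interpPoly X 0) := by
  have hr : 0 < r := Nat.pos_of_ne_zero (NeZero.ne r)
  have h1 := interpPoly_eq_iterate_derivative hN h (r - 1) (by omega)
  rw [show lastIdx r = ⟨r - 1, by omega⟩ from rfl, h1, ← Function.iterate_succ_apply' (f := derivative),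
    Nat.succ_eq_add_one, Nat.sub_add_cancel hr]

theorem interpControl_eq_flatControl (hN : 1 ≤ N)
    (h : ∀ i k, (diffMatrix N *ᵥ fun l => X l i) k = P.field (X k) (U k) i) :
    P.interpControl X = P.flatControl fun t => (interpPoly X 0).eval t := by
  funext t
  rw [BolzaProblem.interpControl, BolzaProblem.flatControl, iteratedDeriv_eval,
    derivative_interpPoly_lastIdx hN h, interpState_eq_flatState hN h]

theorem discreteCost_eq (hg0 : ∀ x, P.g x ≠ 0) (hN : 1 ≤ N)
    (h : ∀ i k, (diffMatrix N *ᵥ fun l => X l i) k = P.field (X k) (U k) i) (h0 : X 0 = P.x0) :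
    P.discreteCost X U = (∑ k, P.lagrangian
      (flatCurve r (fun t => (interpPoly X 0).eval t) (lglNode N k)) * lglWeight N k)
      + P.E P.x0 (flatState r (fun t => (interpPoly X 0).eval t) 1) := by
  have hr : 0 < r := Nat.pos_of_ne_zero (NeZero.ne r)
  rw [BolzaProblem.discreteCost, h0, ← interpState_eq_flatState hN h]
  have h1 : interpState X 1 = X (Fin.last N) := by
    rw [← lglNode_last hN, interpState_lglNode hN]
  rw [h1]
  congr 1
  refine Finset.sum_congr rfl fun k _ => ?_
  congr 1
  rw [BolzaProblem.lagrangian, flatCurve, ← interpState_eq_flatState hN h,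
    interpState_lglNode hN, iteratedDeriv_eval, ← derivative_interpPoly_lastIdx hN h]
  beta_reduce
  rw [derivative_interpPoly_eval hN h, BolzaProblem.field, dif_neg (by simp only [lastIdx]; omega),
    add_sub_cancel_left, mul_div_cancel_left₀ _ (hg0 _)]

theorem nodalDeriv_eq (hN : 1 ≤ N)
    (h : ∀ i k, (diffMatrix N *ᵥ fun l => X l i) k = P.field (X k) (U k) i) (j : ℕ) :
    nodalDeriv j X = fun k => (derivative^[r - 1 + j] (interpPoly X 0)).eval (lglNode N k) := by
  have hr : 0 < r := Nat.pos_of_ne_zero (NeZero.ne r)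
  have h1 := interpPoly_eq_iterate_derivative hN h (r - 1) (by omega)
  have h2 := diffMatrix_pow_mulVec_eval hN (natDegree_interpPoly_le hN X (lastIdx r)) j
  simp only [interpPoly_eval hN] at h2
  rw [nodalDeriv, h2]
  funext k
  rw [add_comm, Function.iterate_add_apply, ← h1]
  rfl

/-- The spectral coefficients are the Legendre coefficients, since the quadrature is exact. -/
theorem spectralCoeff_eq (hN : 1 ≤ N)
    (h : ∀ i k, (diffMatrix N *ᵥ fun l => X l i) k = P.field (X k) (U k) i) {m1 n : ℕ}
    (hm1 : 1 ≤ m1) (hNr : r + m1 ≤ N) (hn : n ≤ N + 1 - (r + m1)) :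
    spectralCoeff m1 X n
      = legendreCoeff (fun t => (derivative^[r - 1 + m1] (interpPoly X 0)).eval t) n := by
  have hr : 0 < r := Nat.pos_of_ne_zero (NeZero.ne r)
  rw [spectralCoeff, legendreCoeff, nodalDeriv_eq hN h]
  congr 1
  have hd : (derivative^[r - 1 + m1] (interpPoly X 0) * legendre n).natDegree ≤ 2 * N - 1 := by
    refine natDegree_mul_le.trans ?_
    have h1 := natDegree_iterate_derivative (interpPoly X 0) (r - 1 + m1)
    have h2 := natDegree_interpPoly_le hN X 0
    rw [natDegree_legendre]
    omega
  have h3 := lgl_quadrature hN hd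
  simp only [eval_mul] at h3
  rw [← h3]
  refine Finset.sum_congr rfl fun k _ => ?_
  rw [legendreEval]
  ring

end Interpolation

/-! ### Uniform bounds and the quadrature error on the feasible set -/

/-- Bounds of the top derivative on `[-1, 1]` and of the lower ones at `-1` bound all derivatives. -/
theorem abs_iteratedDeriv_le {n : ℕ} {y : ℝ → ℝ} (hy : ContDiff ℝ n y) {A : ℝ}
    (h0 : ∀ i < n, |iteratedDeriv i y (-1)| ≤ A)
    (h1 : ∀ t ∈ Icc (-1 : ℝ) 1, |iteratedDeriv n y t| ≤ A) {i : ℕ} (hi : i ≤ n) :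
    ∀ t ∈ Icc (-1 : ℝ) 1, |iteratedDeriv i y t| ≤ 3 ^ n * A := by
  have hA : 0 ≤ A := (abs_nonneg _).trans (h1 1 (by norm_num))
  have key : ∀ j : ℕ, ∀ i, i + j = n → ∀ t ∈ Icc (-1 : ℝ) 1, |iteratedDeriv i y t| ≤ 3 ^ j * A := by
    intro j
    induction j with
    | zero =>
      intro i hi t ht
      rw [add_zero] at hi
      simpa [hi] using h1 t ht
    | succ j ih =>
      intro i hi t ht
      have h2 := Convex.norm_image_sub_le_of_norm_hasDerivWithin_le
        (f := iteratedDeriv i y) (f' := iteratedDeriv (i + 1) y) (C := 3 ^ j * A)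
        (s := Icc (-1 : ℝ) 1) (x := -1) (y := t)
        (fun s _ => (hasDerivAt_iteratedDeriv hy (by omega) s).hasDerivWithinAt)
        (ih (i + 1) (by omega)) (convex_Icc _ _) (by norm_num) ht
      have h3 : ‖t - -1‖ ≤ 2 := by
        rw [Real.norm_eq_abs, abs_of_nonneg (by linarith [ht.1])]
        linarith [ht.2]
      have h4 : ‖iteratedDeriv i y t - iteratedDeriv i y (-1)‖ ≤ 3 ^ j * A * 2 :=
        h2.trans (by gcongr)
      have h5 := h0 i (by omega)
      have h6 : A ≤ 3 ^ j * A := le_mul_of_one_le_left hA (one_le_pow₀ (by norm_num))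
      rw [Real.norm_eq_abs] at h4
      have h7 := abs_sub_abs_le_abs_sub (iteratedDeriv i y t) (iteratedDeriv i y (-1))
      rw [pow_succ]
      linarith
  intro t ht
  refine (key (n - i) i (by omega) t ht).trans ?_
  gcongr
  · norm_num
  · omega

theorem iteratedDeriv_flatCurve_eval (r : ℕ) (Y : ℝ[X]) (i : ℕ) :
    iteratedDeriv i (flatCurve r fun t => Y.eval t)
      = flatCurve r fun t => (derivative^[i] Y).eval t := by
  induction i generalizing Y with
  | zero => simp
  | succ i ih =>
    have h1 : deriv (flatCurve r fun t => Y.eval t) = flatCurve r fun t => (derivative Y).eval t := by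
      funext t
      refine HasDerivAt.deriv (HasDerivAt.prodMk (hasDerivAt_pi.2 fun j => ?_) ?_)
      · have := hasDerivAt_iteratedDeriv (contDiff_eval Y) (Nat.lt_succ_self (j : ℕ)) t
        simp only [flatState, iteratedDeriv_eval, ← Function.iterate_succ_apply (f := derivative)]
        simpa only [iteratedDeriv_eval] using this
      · have := hasDerivAt_iteratedDeriv (contDiff_eval Y) (Nat.lt_succ_self r) t
        simp only [iteratedDeriv_eval, ← Function.iterate_succ_apply (f := derivative)]
        simpa only [iteratedDeriv_eval] using this
    rw [iteratedDeriv_succ', h1, ih, Function.iterate_succ_apply]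

theorem norm_flatCurve_le {r : ℕ} {y : ℝ → ℝ} {t R : ℝ}
    (h : ∀ i ≤ r, |iteratedDeriv i y t| ≤ R) : ‖flatCurve r y t‖ ≤ R := by
  have hR : 0 ≤ R := (abs_nonneg _).trans (h 0 (Nat.zero_le _))
  refine max_le ((pi_norm_le_iff_of_nonneg hR).2 fun i => ?_) (h r le_rfl)
  exact h i i.2.le

/-- The derivative of order `k` of `G` along a polynomial curve is bounded in terms of bounds of the
derivatives of the curve. -/
theorem exists_abs_iteratedDeriv_comp_flatCurve_le {r k : ℕ} {G : (Fin r → ℝ) × ℝ → ℝ}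
    (hG : ContDiff ℝ k G) {R : ℝ} (hR : 1 ≤ R) :
    ∃ M : ℝ, 0 ≤ M ∧ ∀ (Y : ℝ[X]) (t : ℝ),
      (∀ i ≤ r + k, |(derivative^[i] Y).eval t| ≤ R) →
      |iteratedDeriv k (fun t => G (flatCurve r (fun t => Y.eval t) t)) t| ≤ M := by
  have h1 : ∀ i : ℕ, ∃ C : ℝ, i ≤ k → ∀ z ∈ Metric.closedBall (0 : (Fin r → ℝ) × ℝ) R,
      ‖iteratedFDeriv ℝ i G z‖ ≤ C := by
    intro i
    by_cases hi : i ≤ k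
    · obtain ⟨C, hC⟩ := (isCompact_closedBall (0 : (Fin r → ℝ) × ℝ) R).exists_bound_of_continuousOn
        (hG.continuous_iteratedFDeriv (m := i) (by exact_mod_cast hi)).continuousOn
      exact ⟨C, fun _ => hC⟩
    · exact ⟨0, fun h => absurd h hi⟩
  choose C hC using h1
  have hC0 : ∀ i ≤ k, 0 ≤ C i := fun i hi => (norm_nonneg _).trans
    (hC i hi 0 (Metric.mem_closedBall_self (by linarith)))
  have hsum : ∀ i ≤ k, C i ≤ ∑ j ∈ Finset.range (k + 1), C j := fun i hi =>
    Finset.single_le_sum (f := C)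
      (fun j hj => hC0 j (Nat.lt_succ_iff.1 (Finset.mem_range.1 hj)))
      (Finset.mem_range.2 (Nat.lt_succ_of_le hi))
  have hS0 := (hC0 0 (Nat.zero_le _)).trans (hsum 0 (Nat.zero_le _))
  refine ⟨k.factorial * (∑ j ∈ Finset.range (k + 1), C j) * R ^ k, by positivity,
    fun Y t hY => ?_⟩
  have hcurve : ∀ i ≤ k, ‖flatCurve r (fun t => (derivative^[i] Y).eval t) t‖ ≤ R := by
    intro i hi
    refine norm_flatCurve_le fun j hj => ?_
    rw [iteratedDeriv_eval, ← Function.iterate_add_apply]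
    exact hY (j + i) (by omega)
  have hc : ContDiff ℝ k (flatCurve r fun t => Y.eval t) :=
    contDiff_flatCurve (contDiff_eval Y)
  have h2 := norm_iteratedFDeriv_comp_le hG hc le_rfl t (C := ∑ j ∈ Finset.range (k + 1), C j)
    (D := R) (fun i hi => (hC i hi _ (by
      rw [mem_closedBall_zero_iff]
      exact hcurve 0 (Nat.zero_le _))).trans (hsum i hi)) (fun i hi1 hi => by
      rw [norm_iteratedFDeriv_eq_norm_iteratedDeriv, iteratedDeriv_flatCurve_eval]
      exact (hcurve i hi).trans (le_self_pow₀ hR (by omega)))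
  rw [norm_iteratedFDeriv_eq_norm_iteratedDeriv] at h2
  exact h2

/-- The constraints on the initial derivatives and on the spectral coefficients bound the
derivatives of the flat output up to order `r - 1 + m₁`, uniformly in `N`. -/
theorem BolzaProblem.exists_bound_of_isDiscreteFeasible {r : ℕ} [NeZero r] (P : BolzaProblem r)
    {m1 : ℕ} (hm1 : 1 ≤ m1) (b : Bounds r) :
    ∃ R : ℝ, 1 ≤ R ∧ ∀ (N : ℕ), r + m1 ≤ N → ∀ (X : Fin (N + 1) → Fin r → ℝ)
      (U : Fin (N + 1) → ℝ), P.IsDiscreteFeasible m1 b X U → ∀ i ≤ r - 1 + m1,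
        ∀ t ∈ Icc (-1 : ℝ) 1, |(derivative^[i] (interpPoly X 0)).eval t| ≤ R := by
  have hr : 0 < r := Nat.pos_of_ne_zero (NeZero.ne r)
  set S := ∑ j ∈ Finset.range m1, (|b.dLo j| + |b.dHi j|) with hS
  have hS0 : 0 ≤ S := Finset.sum_nonneg fun _ _ => by positivity
  set A := 1 + ‖P.x0‖ + S + |b.d| with hA
  have hA1 : 1 ≤ A := by
    have := norm_nonneg P.x0
    have := abs_nonneg b.d
    linarith
  refine ⟨3 ^ (r - 1 + m1) * A, one_le_mul_of_one_le_of_one_le (one_le_pow₀ (by norm_num)) hA1,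
    fun N hN X U hX i hi t ht => ?_⟩
  have hN1 : 1 ≤ N := by omega
  have hx0 := norm_nonneg P.x0
  have hd0 := abs_nonneg b.d
  have h := abs_iteratedDeriv_le (n := r - 1 + m1) (A := A) (contDiff_eval (interpPoly X 0))
    (fun j hj => ?_) (fun t ht => ?_) hi t ht
  · rwa [iteratedDeriv_eval] at h
  · rw [iteratedDeriv_eval]
    beta_reduce
    by_cases hjr : j < r
    · rw [← interpPoly_eq_iterate_derivative hN1 hX.dynamics j hjr, ← lglNode_zero hN1,
        interpPoly_eval hN1, hX.init]
      have := norm_le_pi_norm P.x0 ⟨j, hjr⟩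
      rw [Real.norm_eq_abs] at this
      linarith
    · obtain ⟨l, rfl⟩ : ∃ l, j = r - 1 + l := ⟨j - (r - 1), by omega⟩
      have h1 := hX.deriv_box l (by omega) (by omega)
      rw [nodalDeriv_eq hN1 hX.dynamics] at h1
      simp only [lglNode_zero hN1] at h1
      have h2 : |b.dLo l| + |b.dHi l| ≤ S :=
        Finset.single_le_sum (f := fun j => |b.dLo j| + |b.dHi j|) (fun _ _ => by positivity)
          (Finset.mem_range.2 (by omega))
      have h3 := neg_abs_le (b.dLo l)
      have h4 := le_abs_self (b.dHi l)
      have h5 := abs_nonneg (b.dLo l)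
      have h6 := abs_nonneg (b.dHi l)
      rw [abs_le]
      constructor <;> linarith [h1.1, h1.2]
  · rw [iteratedDeriv_eval]
    have hdeg : (derivative^[r - 1 + m1] (interpPoly X 0)).natDegree ≤ N + 1 - (r + m1) := by
      have h1 := natDegree_iterate_derivative (interpPoly X 0) (r - 1 + m1)
      have h2 := natDegree_interpPoly_le hN1 X 0
      omega
    have h1 := abs_eval_le_sum_abs_legendreCoeff hdeg ht
    have h2 := hX.spectral
    rw [show N + 2 - (r + m1) = N + 1 - (r + m1) + 1 by omega] at h2
    rw [Finset.sum_congr rfl fun n hn => by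
      rw [spectralCoeff_eq hN1 hX.dynamics hm1 hN
        (Nat.lt_succ_iff.1 (Finset.mem_range.1 hn))]] at h2
    linarith [le_abs_self b.d]

/-- On the feasible set of the discretized problem the discrete cost differs from the cost of the
interpolated trajectory by `O(N^{-(m₁-1)})`. -/
theorem BolzaProblem.exists_abs_discreteCost_sub_le {r : ℕ} [NeZero r] {P : BolzaProblem r}
    (hg0 : ∀ x, P.g x ≠ 0) {k : ℕ} (hG : ContDiff ℝ k P.lagrangian) (b : Bounds r) :
    ∃ Q : ℝ, 0 ≤ Q ∧ ∀ (N : ℕ), r + (k + 1) ≤ N → ∀ (X : Fin (N + 1) → Fin r → ℝ)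
      (U : Fin (N + 1) → ℝ), P.IsDiscreteFeasible (k + 1) b X U →
        |P.discreteCost X U - P.flatCost fun t => (interpPoly X 0).eval t| ≤ Q / N ^ k := by
  obtain ⟨R, hR, hbd⟩ := P.exists_bound_of_isDiscreteFeasible (Nat.succ_pos k) b
  obtain ⟨M, hM, hder⟩ := exists_abs_iteratedDeriv_comp_flatCurve_le hG hR
  obtain ⟨K, hK, hquad⟩ := exists_lgl_quadrature_error k
  refine ⟨K * M, by positivity, fun N hN X U hX => ?_⟩
  have hN1 : 1 ≤ N := by omega
  have hr : 0 < r := Nat.pos_of_ne_zero (NeZero.ne r)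
  rw [discreteCost_eq hg0 hN1 hX.dynamics hX.init, BolzaProblem.flatCost, add_sub_add_right_eq_sub]
  refine hquad (fun t => P.lagrangian (flatCurve r (fun t => (interpPoly X 0).eval t) t)) M
    (hG.comp (contDiff_flatCurve (contDiff_eval _))) (fun t ht => ?_) N hN1 (by omega)
  exact hder _ t fun i hi => hbd N hN X U hX i (by omega) t ht

end PSOptimalControl

namespace PSOptimalControl

open Polynomial

/-! ### A feasible point of the discretized problem near the optimal trajectory -/

theorem exists_iterate_derivative_eq (p : ℝ[X]) (k : ℕ) (c : ℕ → ℝ) :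
    ∃ Y : ℝ[X], derivative^[k] Y = p ∧ (∀ j < k, (derivative^[j] Y).eval (-1) = c j) ∧
      Y.natDegree ≤ p.natDegree + k := by
  induction k generalizing p with
  | zero => exact ⟨p, rfl, by simp, le_rfl⟩
  | succ k ih =>
    obtain ⟨q, hq, hq0, hqd⟩ := exists_derivative_eq p (c k)
    obtain ⟨Y, hY, hY0, hYd⟩ := ih q
    refine ⟨Y, by rw [Function.iterate_succ_apply', hY, hq], fun j hj => ?_, by omega⟩
    rcases Nat.lt_succ_iff_lt_or_eq.1 hj with h | rfl
    · exact hY0 j h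
    · rw [hY, hq0]

/-- Polynomial approximation by truncating the Legendre series of the derivative of order `s` and
integrating it `s` times from `-1`. -/
theorem exists_polynomial_approx {s q : ℕ} {y v : ℝ → ℝ} {c : ℝ} (hy : ContDiff ℝ (s + q : ℕ) y)
    (hv : BoundedVariationOn v (Icc (-1) 1))
    (hyv : ∀ t ∈ Icc (-1 : ℝ) 1, iteratedDeriv (s + q) y t = c + ∫ τ in (-1 : ℝ)..t, v τ) :
    ∃ K : ℝ, 0 ≤ K ∧ ∀ M : ℕ, 1 ≤ M → ∃ Y : ℝ[X], Y.natDegree ≤ M + s ∧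
      (∀ j < s, (derivative^[j] Y).eval (-1) = iteratedDeriv j y (-1)) ∧
      ∑ n ∈ Finset.range (M + 1), |legendreCoeff (fun t => (derivative^[s] Y).eval t) n| ≤ K ∧
      ∀ i ≤ s, ∀ t ∈ Icc (-1 : ℝ) 1,
        |(derivative^[i] Y).eval t - iteratedDeriv i y t| ≤ 3 ^ s * (K / (M ^ q * √M)) := by
  have hz : ContDiff ℝ q (iteratedDeriv s y) := by
    rw [iteratedDeriv_eq_iterate]
    exact ContDiff.iterate_deriv' q s (hy.of_le (by exact_mod_cast (by omega : q + s ≤ s + q)))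
  have hzq : iteratedDeriv q (iteratedDeriv s y) = iteratedDeriv (s + q) y := by
    rw [iteratedDeriv_eq_iterate, iteratedDeriv_eq_iterate, iteratedDeriv_eq_iterate, add_comm,
      Function.iterate_add_apply]
  obtain ⟨K, hK, hsum, happ⟩ := exists_legendre_series_error hz.continuous
    (exists_abs_legendreCoeff_le hv c q hz (by rw [hzq]; exact hyv))
  refine ⟨K, hK, fun M hM => ?_⟩
  set a := legendreCoeff (iteratedDeriv s y)
  set p : ℝ[X] := ∑ n ∈ Finset.range (M + 1), C (a n) * legendre n with hp
  have hpd : p.natDegree ≤ M := natDegree_sum_le_of_forall_le _ _ fun n hn =>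
    natDegree_mul_le.trans (by
      rw [natDegree_C, natDegree_legendre]
      have := Finset.mem_range.1 hn
      omega)
  obtain ⟨Y, hY, hY0, hYd⟩ := exists_iterate_derivative_eq p s fun j => iteratedDeriv j y (-1)
  have hys : ContDiff ℝ s y := hy.of_le (by exact_mod_cast Nat.le_add_right s q)
  have hd : ∀ i ≤ s, ∀ t, iteratedDeriv i (fun t => Y.eval t - y t) t
      = (derivative^[i] Y).eval t - iteratedDeriv i y t := by
    intro i hi t
    rw [iteratedDeriv_fun_sub (contDiff_eval Y).contDiffAt
      (hys.of_le (by exact_mod_cast hi)).contDiffAt, iteratedDeriv_eval]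
  refine ⟨Y, by omega, hY0, ?_, fun i hi t ht => ?_⟩
  · rw [hY, hp, Finset.sum_congr rfl fun n hn => by
      rw [legendreCoeff_sum a (Nat.lt_succ_iff.1 (Finset.mem_range.1 hn))]]
    exact hsum (M + 1)
  · rw [← hd i hi]
    refine abs_iteratedDeriv_le ((contDiff_eval Y).sub hys) (fun j hj => ?_) (fun t ht => ?_) hi t ht
    · rw [hd j hj.le, hY0 j hj, sub_self, abs_zero]
      positivity
    · rw [hd s le_rfl, hY, abs_sub_comm, hp, eval_finsetSum]
      simpa only [eval_mul, eval_C] using happ M hM t ht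

/-- The nodal values of the trajectory with flat output `Y`. -/
noncomputable def nodalState (r N : ℕ) (Y : ℝ[X]) (k : Fin (N + 1)) : Fin r → ℝ :=
  flatState r (fun t => Y.eval t) (lglNode N k)

theorem nodalState_apply (r N : ℕ) (Y : ℝ[X]) (k : Fin (N + 1)) (i : Fin r) :
    nodalState r N Y k i = (derivative^[i] Y).eval (lglNode N k) := by
  rw [nodalState, flatState, iteratedDeriv_eval]

theorem diffMatrix_mulVec_nodalState {r N : ℕ} (P : BolzaProblem r) (hg0 : ∀ x, P.g x ≠ 0)
    (hN : 1 ≤ N) {Y : ℝ[X]} (hY : Y.natDegree ≤ N) (i : Fin r) (k : Fin (N + 1)) :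
    (diffMatrix N *ᵥ fun l => nodalState r N Y l i) k
      = P.field (nodalState r N Y k) (P.flatControl (fun t => Y.eval t) (lglNode N k)) i := by
  have hd : (derivative^[i] Y).natDegree ≤ N :=
    (natDegree_iterate_derivative Y i).trans ((Nat.sub_le _ _).trans hY)
  simp only [nodalState_apply]
  rw [diffMatrix_mulVec_eval hN hd, ← Function.iterate_succ_apply' (f := derivative),
    BolzaProblem.field]
  split_ifs with h
  · rw [nodalState_apply]
  · rw [BolzaProblem.flatControl, nodalState, mul_div_cancel₀ _ (hg0 _), add_sub_cancel,
      iteratedDeriv_eval, show (i : ℕ).succ = r by omega]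

theorem interpPoly_nodalState {r N : ℕ} [NeZero r] (hN : 1 ≤ N) {Y : ℝ[X]}
    (hY : Y.natDegree ≤ N) : interpPoly (nodalState r N Y) 0 = Y :=
  eq_of_eval_lglNode_eq hN (natDegree_interpPoly_le hN _ 0) hY fun k => by
    rw [interpPoly_eval hN, nodalState_apply]
    rfl

/-- If the bounds of the discretized problem are large, then its feasible set contains, for every
large `N`, a point whose flat output is close to `ys`. -/
theorem BolzaProblem.exists_isDiscreteFeasible {r : ℕ} [NeZero r] {P : BolzaProblem r}
    (hg0 : ∀ x, P.g x ≠ 0) (hf : Continuous P.f) (hg : Continuous P.g) {m1 q : ℕ} (hm1 : 1 ≤ m1)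
    {ys v : ℝ → ℝ} {c : ℝ} (hys : ContDiff ℝ (r - 1 + m1 + q : ℕ) ys)
    (hys0 : flatState r ys (-1) = P.x0) (hv : BoundedVariationOn v (Icc (-1) 1))
    (hysv : ∀ t ∈ Icc (-1 : ℝ) 1,
      iteratedDeriv (r - 1 + m1 + q) ys t = c + ∫ τ in (-1 : ℝ)..t, v τ) :
    ∃ B K : ℝ, 0 ≤ K ∧ ∀ b : Bounds r, b.AtLeast m1 B → ∀ N : ℕ, r + m1 + 1 < N →
      ∃ (Y : ℝ[X]) (X : Fin (N + 1) → Fin r → ℝ) (U : Fin (N + 1) → ℝ),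
        P.IsDiscreteFeasible m1 b X U ∧ interpPoly X 0 = Y ∧
        flatState r (fun t => Y.eval t) (-1) = P.x0 ∧
        ∀ t ∈ Icc (-1 : ℝ) 1, ‖flatCurve r (fun t => Y.eval t) t - flatCurve r ys t‖
          ≤ K / ((N + 1 - (r + m1) : ℕ) ^ q * √(N + 1 - (r + m1) : ℕ)) := by
  have hr : 0 < r := Nat.pos_of_ne_zero (NeZero.ne r)
  obtain ⟨K, hK, happ⟩ := exists_polynomial_approx hys hv hysv
  have hysr : ContDiff ℝ r ys :=
    hys.of_le (by exact_mod_cast (by omega : r ≤ r - 1 + m1 + q))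
  obtain ⟨R, hR⟩ := isCompact_Icc.exists_bound_of_continuousOn (s := Icc (-1 : ℝ) 1)
    (continuous_flatCurve hysr).continuousOn
  set R2 := R + 3 ^ (r - 1 + m1) * K with hR2
  -- Bound of the control, as a function of the state and of the derivative of its last coordinate.
  obtain ⟨Bu, hBu⟩ := (isCompact_closedBall (0 : (Fin r → ℝ) × ℝ) R2).exists_bound_of_continuousOn
    (f := fun z : (Fin r → ℝ) × ℝ => (z.2 - P.f z.1) / P.g z.1)
    (((continuous_snd.sub (hf.comp continuous_fst)).div (hg.comp continuous_fst)
      fun z => hg0 z.1).continuousOn)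
  set Bd := ∑ j ∈ Finset.range m1, |iteratedDeriv (r - 1 + j) ys (-1)| with hBd
  have hR0 : 0 ≤ R := (norm_nonneg _).trans (hR 1 (by norm_num))
  have hR20 : 0 ≤ R2 := by positivity
  have hBu0 : 0 ≤ Bu := (norm_nonneg _).trans (hBu 0 (Metric.mem_closedBall_self hR20))
  have hBd0 : 0 ≤ Bd := Finset.sum_nonneg fun _ _ => abs_nonneg _
  refine ⟨R2 + Bu + Bd + K, 3 ^ (r - 1 + m1) * K, by positivity, fun b hb N hN => ?_⟩
  -- The degree of the truncated Legendre series, so that the output has degree at most `N`.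
  set M := N + 1 - (r + m1) with hM
  obtain ⟨Y, hYd, hY0, hYs, hYe⟩ := happ M (by omega)
  have hN1 : 1 ≤ N := by omega
  have hYN : Y.natDegree ≤ N := by omega
  have hdyn := diffMatrix_mulVec_nodalState P hg0 hN1 hYN
  have hint := interpPoly_nodalState (r := r) hN1 hYN
  have hinit : flatState r (fun t => Y.eval t) (-1) = P.x0 := by
    rw [← hys0]
    funext i
    simp only [flatState, iteratedDeriv_eval]
    exact hY0 i (by omega)
  have hM1 : (1 : ℝ) ≤ M := by exact_mod_cast (by omega : 1 ≤ M)
  have herr : ∀ t ∈ Icc (-1 : ℝ) 1, ‖flatCurve r (fun t => Y.eval t) t - flatCurve r ys t‖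
      ≤ 3 ^ (r - 1 + m1) * (K / (M ^ q * √M)) := by
    intro t ht
    refine max_le ((pi_norm_le_iff_of_nonneg (by positivity)).2 fun i => ?_) ?_
    · have := hYe i (by omega) t ht
      simpa only [flatCurve, flatState, iteratedDeriv_eval, Prod.fst_sub, Pi.sub_apply,
        Real.norm_eq_abs] using this
    · have := hYe r (by omega) t ht
      simpa only [flatCurve, iteratedDeriv_eval, Prod.snd_sub, Real.norm_eq_abs] using this
  have hbd : ∀ t ∈ Icc (-1 : ℝ) 1, ‖flatCurve r (fun t => Y.eval t) t‖ ≤ R2 := by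
    intro t ht
    have h1 : K / (M ^ q * √M) ≤ K :=
      div_le_self hK (one_le_mul_of_one_le_of_one_le (one_le_pow₀ hM1) (Real.one_le_sqrt.2 hM1))
    have h2 := norm_le_norm_add_norm_sub' (flatCurve r (fun t => Y.eval t) t) (flatCurve r ys t)
    have h3 : 3 ^ (r - 1 + m1) * (K / (M ^ q * √M)) ≤ 3 ^ (r - 1 + m1) * K := by gcongr
    linarith [hR t ht, herr t ht]
  refine ⟨Y, nodalState r N Y, fun k => P.flatControl (fun t => Y.eval t) (lglNode N k),
    ⟨hdyn, ?_, fun k i => ?_, fun k => ?_, fun j hj1 hj2 => ?_, ?_⟩, hint, hinit, fun t ht => ?_⟩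
  · rw [nodalState, lglNode_zero hN1, hinit]
  · have h1 := (norm_le_pi_norm _ i).trans
      ((norm_fst_le _).trans (hbd _ (lglNode_mem_Icc hN1 k)))
    have h2 := abs_le.1 ((Real.norm_eq_abs _).symm.le.trans h1)
    have h3 := hb.xLo_le i
    have h4 := hb.le_xHi i
    change -R2 ≤ nodalState r N Y k i ∧ nodalState r N Y k i ≤ R2 at h2
    constructor <;> linarith [h2.1, h2.2]
  · have h1 := hBu _ (mem_closedBall_zero_iff.2 (hbd _ (lglNode_mem_Icc hN1 k)))
    have h2 := abs_le.1 ((Real.norm_eq_abs _).symm.le.trans h1)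
    have h3 := hb.uLo_le
    have h4 := hb.le_uHi
    change -Bu ≤ P.flatControl (fun t => Y.eval t) (lglNode N k) ∧
      P.flatControl (fun t => Y.eval t) (lglNode N k) ≤ Bu at h2
    constructor <;> linarith [h2.1, h2.2]
  · rw [nodalDeriv_eq hN1 hdyn, hint]
    simp only [lglNode_zero hN1]
    rw [hY0 _ (by omega)]
    have h2 : |iteratedDeriv (r - 1 + j) ys (-1)| ≤ Bd :=
      Finset.single_le_sum (f := fun j => |iteratedDeriv (r - 1 + j) ys (-1)|)
        (fun _ _ => abs_nonneg _) (Finset.mem_range.2 (by omega))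
    have h3 := hb.dLo_le j hj1 hj2
    have h4 := hb.le_dHi j hj1 hj2
    have h5 := abs_le.1 h2
    constructor <;> linarith [h5.1, h5.2]
  · rw [show N + 2 - (r + m1) = M + 1 by omega, Finset.sum_congr rfl fun n hn => by
      rw [spectralCoeff_eq hN1 hdyn hm1 (by omega)
        (Nat.lt_succ_iff.1 (Finset.mem_range.1 hn)), hint]]
    linarith [hb.le_d]
  · rw [mul_div_assoc]
    exact herr t ht

end PSOptimalControl

open PSOptimalControl in
theorem mainTheorem1 (r : ℕ) [NeZero r] (P : PSOptimalControl.BolzaProblem r) (m m1 : ℕ)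
    (hg0 : ∀ x, P.g x ≠ 0)
    (hf : ContDiff ℝ m P.f) (hfL : ∃ K, LipschitzWith K P.f)
    (hg : ContDiff ℝ m P.g) (hgL : ∃ K, LipschitzWith K P.g)
    (hF : ContDiff ℝ m P.F) (hFL : ∃ K, LipschitzWith K P.F)
    (hE : ContDiff ℝ m (P.E P.x0)) (hEL : ∃ K, LipschitzWith K (P.E P.x0))
    (hm : 3 ≤ m) (hm1 : 1 ≤ m1) (hm1m : m1 ≤ m - 1)
    (xs : ℝ → Fin r → ℝ) (us : ℝ → ℝ) (hopt : P.IsOptimal xs us)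
    (hBV : PSOptimalControl.HasBVWeakDeriv m (fun t => xs t (PSOptimalControl.lastIdx r))) :
    ∃ B : ℝ, ∀ b : PSOptimalControl.Bounds r, b.AtLeast m1 B →
      ∀ α : ℝ, 0 < α → α < (m1 : ℝ) - 1 →
        ∃ M1 M2 : ℝ, ∀ (N1 : ℕ), 1 ≤ N1 →
          ∀ (X : ∀ N : ℕ, Fin (N + 1) → Fin r → ℝ) (U : ∀ N : ℕ, Fin (N + 1) → ℝ),
            (∀ N, N1 ≤ N → P.IsDiscreteOptimal m1 b (X N) (U N)) →
            ∀ N, N1 ≤ N →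
              P.IsAdmissible (PSOptimalControl.interpState (X N)) (P.interpControl (X N)) ∧
              (r + m1 + 1 < N →
                |P.cost xs us
                    - P.cost (PSOptimalControl.interpState (X N)) (P.interpControl (X N))|
                  ≤ M1 / ((N : ℝ) - r - m1 - 1) ^ (2 * m - 2 * m1 - 1) + M2 / (N : ℝ) ^ α ∧
                |P.cost xs us - P.discreteCost (X N) (U N)|
                  ≤ M1 / ((N : ℝ) - r - m1 - 1) ^ (2 * m - 2 * m1 - 1) + M2 / (N : ℝ) ^ α) := by
  have hr : 0 < r := Nat.pos_of_ne_zero (NeZero.ne r)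
  obtain ⟨had, hmin⟩ := hopt
  obtain ⟨q, rfl⟩ : ∃ q, m = m1 + q + 1 := ⟨m - 1 - m1, by omega⟩
  obtain ⟨ys, v, c, hys, hv, hysv, hxs, hus⟩ :=
    had.exists_flatOutput (n := m1 + q) (by omega) hBV
  rw [← add_assoc] at hys hysv
  have hysr : ContDiff ℝ r ys := hys.of_le (by exact_mod_cast (by omega : r ≤ r - 1 + m1 + q))
  have hys0 : flatState r ys (-1) = P.x0 := by rw [← hxs (-1) (by norm_num), had.init]
  have hJ : P.cost xs us = P.flatCost ys :=
    BolzaProblem.cost_eq_flatCost hg0 had.init hxs hus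
  have hmin' : ∀ y : ℝ → ℝ, ContDiff ℝ r y → flatState r y (-1) = P.x0 →
      P.flatCost ys ≤ P.flatCost y := fun y hy hy0 => by
    rw [← hJ, ← BolzaProblem.cost_flatState hy0]
    exact hmin _ _ (BolzaProblem.isAdmissible_flatState hg0 hf.continuous hg.continuous hy hy0)
  have hG : ContDiff ℝ (m1 + q + 1 : ℕ) P.lagrangian :=
    BolzaProblem.contDiff_lagrangian hg0 hf hg hF
  obtain ⟨B, K, hK, hfeas⟩ := BolzaProblem.exists_isDiscreteFeasible hg0 hf.continuous
    hg.continuous hm1 hys hys0 hv hysv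
  have h2m : ((2 : ℕ) : WithTop ℕ∞) ≤ ((m1 + q + 1 : ℕ) : WithTop ℕ∞) := by
    exact_mod_cast (by omega : 2 ≤ m1 + q + 1)
  obtain ⟨C, hC, hquad⟩ := BolzaProblem.exists_flatCost_le (hG.of_le h2m) (hE.of_le h2m)
    hysr hys0 hmin' K
  refine ⟨B, fun b hb α hα hαm => ?_⟩
  obtain ⟨k, rfl⟩ : ∃ k, m1 = k + 1 := ⟨m1 - 1, by omega⟩
  obtain ⟨Q, hQ, hdisc⟩ := BolzaProblem.exists_abs_discreteCost_sub_le hg0 (k := k)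
    (hG.of_le (by exact_mod_cast (by omega : k ≤ k + 1 + q + 1))) b
  refine ⟨C * K ^ 2, 2 * Q, fun N1 hN1 X U hX N hN => ?_⟩
  obtain ⟨hXf, hXmin⟩ := hX N hN
  have hN1' : 1 ≤ N := hN1.trans hN
  have hst := interpState_eq_flatState hN1' hXf.dynamics
  have hct := interpControl_eq_flatControl hN1' hXf.dynamics
  have hinit : flatState r (fun t => (interpPoly (X N) 0).eval t) (-1) = P.x0 := by
    rw [← hst, ← lglNode_zero hN1', interpState_lglNode hN1', hXf.init]
  rw [hst, hct, BolzaProblem.cost_flatState hinit, hJ]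
  refine ⟨BolzaProblem.isAdmissible_flatState hg0 hf.continuous hg.continuous
    (contDiff_eval _) hinit, fun hNr => ?_⟩
  obtain ⟨Y, X', U', hX', hYX, hY0, herr⟩ := hfeas b hb N hNr
  set M : ℕ := N + 1 - (r + (k + 1)) with hM
  -- The base of the first error term is at most the degree `M` of the truncated series.
  set L : ℝ := (N : ℝ) - r - (k + 1 : ℕ) - 1 with hL
  have hL0 : 0 < L := by
    have : ((r + (k + 1) + 1 : ℕ) : ℝ) < N := by exact_mod_cast hNr
    push_cast at this hL
    linarith
  have hLM : L ≤ M := by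
    rw [hM, Nat.cast_sub (by omega)]
    push_cast at hL ⊢
    linarith
  have hM1 : (1 : ℝ) ≤ M := by exact_mod_cast (by omega : 1 ≤ M)
  have hε := hquad (fun t => Y.eval t) _ (contDiff_eval Y) hY0
    (div_le_self hK (one_le_mul_of_one_le_of_one_le (one_le_pow₀ hM1) (Real.one_le_sqrt.2 hM1)))
    herr
  have hε2 : C * (K / (M ^ q * √M)) ^ 2
      ≤ C * K ^ 2 / L ^ (2 * (k + 1 + q + 1) - 2 * (k + 1) - 1) := by
    rw [show 2 * (k + 1 + q + 1) - 2 * (k + 1) - 1 = q * 2 + 1 by omega, div_pow, mul_pow,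
      Real.sq_sqrt (Nat.cast_nonneg M), ← pow_mul, ← pow_succ, mul_div_assoc]
    gcongr
  have hQN : Q / (N : ℝ) ^ k ≤ Q / (N : ℝ) ^ α := by
    have hN1r : (1 : ℝ) ≤ N := by exact_mod_cast hN1'
    rw [← Real.rpow_natCast]
    gcongr
    push_cast at hαm
    linarith
  have hQ0 : 0 ≤ Q / (N : ℝ) ^ k := by positivity
  have hCK0 : 0 ≤ C * K ^ 2 / L ^ (2 * (k + 1 + q + 1) - 2 * (k + 1) - 1) := by positivity
  -- With the quadrature error `δ`, and the discrete optimum `X N` compared with the point `X'`: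
  -- `J* ≤ J(x^N) ≤ J^N(X N) + δ ≤ J^N(X') + δ ≤ J(Y) + 2 δ ≤ J* + C ε² + 2 δ`.
  have e1 := abs_le.1 (hdisc N (by omega) _ _ hXf)
  have e2 := abs_le.1 (hdisc N (by omega) _ _ hX')
  rw [hYX] at e2
  have e3 := hXmin _ _ hX'
  have e4 := hmin' _ (contDiff_eval (interpPoly (X N) 0)) hinit
  rw [mul_div_assoc 2 Q, abs_le, abs_le]
  refine ⟨⟨?_, ?_⟩, ⟨?_, ?_⟩⟩ <;> linarith [e1.1, e1.2, e2.1, e2.2]
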